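/- Setting. Let $d\ge 1$ and $A^*\in\mathbb R^{d\times d}$ with operator norm $\|A^*\|<1$. Let $\mu$ be a law on $\mathbb R^d$ with mean $0$ and full-rank covariance $\Sigma$ such that for $\eta\sim\mu$ and every $x$ the variable $\langle x,\eta\rangle$ is sub-Gaussian with variance proxy $C_\mu\langle x,\Sigma x\rangle$. Let $\pi$ be the stationary distribution of $X\mapsto A^*X+\eta$, $\eta\sim\mu$; put $G=\mathbb E_\pi XX^\top$, $M_4=\mathbb E_\pi\|X\|^4$, let $\sigma_{\max},\sigma_{\min}$ be the largest and smallest singular values and $\kappa(G)=\sigma_{\max}(G)/\sigma_{\min}(G)$. The data are $X_{\tau+1}=A^*X_\tau+\eta_\tau$, $0\le\tau<T$, with $X_0\sim\pi$ independent of the i.i.d. noise $\eta_\tau\sim\mu$. The prediction loss is $\mathcal L_{\rm pred}(A)=\mathbb E\|A^*X+\eta-AX\|^2$, where $X\sim\pi$ and $\eta\sim\mu$ are independent. Algorithm (SGD-RER). Given $B\ge1$, $u\ge0$, put $S=B+u$, $N=\lfloor T/S\rfloor$. Start from a matrix $A_0$. In buffer $t-1$ ($1\le t\le N$), for $i=0,\dots,B-1$,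 update $A\leftarrow A-2\gamma\,(AX_{(t-1)S+S-1-i}-X_{(t-1)S+S-i})X_{(t-1)S+S-1-i}^\top$; let $A^{t-1}_B$ be the matrix obtained at the end of that buffer, which also starts the next one. For $a<t\le N$ the output is $\hat A_{a,t}=\frac1{t-a}\sum_{s=a+1}^{t}A^{s-1}_B$ if $\|X_\tau\|^2\le R$ for all $\tau<tS$, and $\hat A_{a,t}=0$ otherwise. Theorem. For every $C_\mu>0$ there are $c_1,c_2>0$ such that for every $\alpha>0$ there is $C_0>0$ such that for all $C_R\ge C_0$ and all $c\in(0,1)$ the following hold, with $R=C_R\operatorname{tr}(G)\log T$ and $\gamma=\frac{c}{4RB}$. (1) There are $b_1,b_2>0$ (depending on $C_\mu,\alpha,C_R,c$) and, for every $K\ge0$, a constant $c_3>0$ (depending on the same quantities and $K$) such that for all $d,A^*,\mu,\pi,T$ as above, all $A_0$ with $\|A_0\|\le K$, and all $B\ge1$, $u\ge0$, $0\le a<t\le N$: if $T^{\alpha/2}>c_1\sqrt{M_4}/\sigma_{\min}(G)$, then $\mathcal L_{\rm pred}(\hat A_{a,t})$ is integrable and $$\begin{aligned}\mathbb E\,\mathcal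 L_{\rm pred}(\hat A_{a,t})-\operatorname{tr}(\Sigma)\le{}& c_2\Big[\frac{d\operatorname{tr}(\Sigma)}{B(t-a)}+\frac{d^2\sigma_{\max}(\Sigma)}{B(t-a)}\frac{\sqrt{\kappa(G)}}{B}\Big]\\&+c_3\Big[\frac{d^2\sigma_{\max}(\Sigma)}{B^2(t-a)^2}\kappa(G)^{3/2}dB\log T+\beta_b\operatorname{tr}(G)\|A_0-A^*\|^2\\&\qquad+\Big(\frac{T^3}{B^3}\|(A^*)^u\|+\frac{d\,\sigma_{\max}(\Sigma)}{R}\frac{T^2}{B^2}\frac1{T^{\alpha/2}}\Big)\operatorname{tr}(G)\Big],\end{aligned}$$ where $\beta_b=b_1\frac{d\kappa(G)\log T}{t-a}\exp\big(-b_2\frac{a}{d\kappa(G)\log T}\big)$. (2) Suppose $\alpha\ge6$ and fix $d,A^*,\mu,\pi,A_0$. Call $a_T,B_T,u_T$ (with $N_T=\lfloor T/(B_T+u_T)\rfloor$) a $\theta$-tuning if $B_T\to\infty$, $B_T=O(\log T)$, and, for some $C>0$ and all large $T$, $\|(A^*)^{u_T}\|\le T^{-4}$, $a_T\ge C\,R\log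 T/\sigma_{\min}(G)$ and $B_T(N_T-a_T)\ge\theta T$. Then $\tfrac12$-tunings exist, and for every $\theta>0$ and every $\theta$-tuning, as $T\to\infty$ (with $\mathcal L_{\rm pred}(\hat A_{a_T,N_T})$ integrable for all large $T$), $$\mathbb E\,\mathcal L_{\rm pred}(\hat A_{a_T,N_T})-\operatorname{tr}(\Sigma)\le \frac{c_2}{\theta}\,\frac{d\operatorname{tr}(\Sigma)}{T}+o\Big(\frac1T\Big).$$ -/

import Mathlib

open MeasureTheory ProbabilityTheory Filter Asymptotics

noncomputable section

/-- `ℝ^d` with the Euclidean norm. -/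
abbrev Vec (d : ℕ) : Type := EuclideanSpace ℝ (Fin d)

/-- Real `d × d` matrices acting on `ℝ^d`; the norm of this type is the operator norm. -/
abbrev Op (d : ℕ) : Type := Vec d →L[ℝ] Vec d

/-- The second moment matrix `E[x xᵀ]` of a law on `ℝ^d` (the covariance if the mean is zero). -/
def momentMatrix {d : ℕ} (ν : Measure (Vec d)) : Matrix (Fin d) (Fin d) ℝ :=
  Matrix.of fun i j => ∫ x, x i * x j ∂ν

/-- The fourth moment `E ‖x‖⁴`. -/
def fourthMoment {d : ℕ} (ν : Measure (Vec d)) : ℝ := ∫ x, ‖x‖ ^ 4 ∂ν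

/-- Largest singular value. -/
def sigmaMax {d : ℕ} (M : Matrix (Fin d) (Fin d) ℝ) : ℝ :=
  (Matrix.toEuclideanLin M).singularValues 0

/-- Smallest singular value (Mathlib lists the singular values decreasingly, starting at `0`). -/
def sigmaMin {d : ℕ} (M : Matrix (Fin d) (Fin d) ℝ) : ℝ :=
  (Matrix.toEuclideanLin M).singularValues (d - 1)

/-- Condition number. -/
def condNumber {d : ℕ} (M : Matrix (Fin d) (Fin d) ℝ) : ℝ := sigmaMax M / sigmaMin M

/-- Assumptions on the noise law `μ`: mean zero, covariance `Σ` of full rank, and `⟨x, η⟩` is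
sub-Gaussian with variance proxy `Cμ ⟨x, Σ x⟩` for all `x`. -/
structure IsNoiseLaw {d : ℕ} (Cμ : ℝ) (μ : Measure (Vec d)) : Prop where
  isProb : IsProbabilityMeasure μ
  mean_zero : ∫ e, e ∂μ = 0
  full_rank : (momentMatrix μ).rank = d
  subGaussian : ∀ x : Vec d,
    HasSubgaussianMGF (fun e : Vec d => inner ℝ x e)
      (Real.toNNReal (Cμ * inner ℝ x (Matrix.toEuclideanLin (momentMatrix μ) x))) μ

/-- `π` is a stationary distribution of the chain `x ↦ A x + η`, `η ∼ μ`. -/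
structure IsStationaryLaw {d : ℕ} (A : Op d) (μ π : Measure (Vec d)) : Prop where
  isProb : IsProbabilityMeasure π
  invariant : (π.prod μ).map (fun p : Vec d × Vec d => A p.1 + p.2) = π

/-- `X 0, …, X T` is a stationary trajectory of `VAR(A, μ)` with noise `η 0, …, η (T - 1)`. -/
structure IsStationaryVAR {d : ℕ} (A : Op d) (μ π : Measure (Vec d))
    {Ω : Type*} [MeasurableSpace Ω] (P : Measure Ω)
    (T : ℕ) (X η : ℕ → Ω → Vec d) : Prop where
  measurable_init : Measurable (X 0)
  law_init : P.map (X 0) = π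
  measurable_noise : ∀ τ < T, Measurable (η τ)
  law_noise : ∀ τ < T, P.map (η τ) = μ
  indep_noise : iIndepFun (fun τ : Fin T => η τ) P
  indep_init : IndepFun (X 0) (fun ω (τ : Fin T) => η τ ω) P
  step : ∀ τ < T, ∀ ω, X (τ + 1) ω = A (X τ ω) + η τ ω

/-- The prediction error at stationarity of the matrix `M`:
`E ‖X_{τ+1} - M X_τ‖²` with `X_τ ∼ π` and `X_{τ+1} = A X_τ + η`, `η ∼ μ` independent of `X_τ`. -/
def predLoss {d : ℕ} (A : Op d) (μ π : Measure (Vec d)) (M : Op d) : ℝ :=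
  ∫ p : Vec d × Vec d, ‖(A p.1 + p.2) - M p.1‖ ^ 2 ∂(π.prod μ)

/-- One gradient step on the transition `(x, y)`: `M ↦ M - 2γ (M x - y) xᵀ`. -/
def sgdStep {d : ℕ} (γ : ℝ) (M : Op d) (x y : Vec d) : Op d :=
  M - (2 * γ) • InnerProductSpace.rankOne ℝ (M x - y) x

/-- The first `i` steps of reverse-order SGD inside the buffer `x s, …, x (s + S - 1)`: the step
number `i` (counted from `0`) uses the transition `(x (s + S - 1 - i), x (s + S - i))`. -/
def bufferPass {d : ℕ} (γ : ℝ) (x : ℕ → Vec d) (s S : ℕ) (M : Op d) : ℕ → Op d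
  | 0 => M
  | i + 1 => sgdStep γ (bufferPass γ x s S M i) (x (s + S - 1 - i)) (x (s + S - i))

/-- The iterate of SGD-RER after `t` buffers of total size `S = B + u`, of which the last `B`
transitions are used. -/
def rerIterate {d : ℕ} (γ : ℝ) (B u : ℕ) (A₀ : Op d) (x : ℕ → Vec d) : ℕ → Op d
  | 0 => A₀
  | t + 1 => bufferPass γ x (t * (B + u)) (B + u) (rerIterate γ B u A₀ x t) B

open Classical in
/-- The tail-averaged output of SGD-RER at the end of the `t`-th buffer: the average of the
iterates after buffers `a + 1, …, t`, or the zero matrix if some sample in the first `t` buffers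
has squared norm exceeding `R`. -/
def rerOutput {d : ℕ} (R γ : ℝ) (B u a t : ℕ) (A₀ : Op d) (x : ℕ → Vec d) : Op d :=
  if ∀ τ < t * (B + u), ‖x τ‖ ^ 2 ≤ R then
    ((t : ℝ) - (a : ℝ))⁻¹ • ∑ s ∈ Finset.Ioc a t, rerIterate γ B u A₀ x s
  else 0

/-- The bias coefficient `β_b = b₁ (d κ log T / (t - a)) exp (- b₂ a / (d κ log T))`. -/
def biasCoeff (b₁ b₂ : ℝ) (d : ℕ) (κ : ℝ) (T a t : ℕ) : ℝ :=
  b₁ * (d * κ * Real.log T / ((t : ℝ) - a)) * Real.exp (-(b₂ * (a / (d * κ * Real.log T))))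

/-- Choices of the burn-in `a`, buffer size `B` and gap `u` as functions of the horizon `T`:
the buffer size tends to infinity, at most logarithmically in `T`; the gap makes `‖A^u‖`
at most `T⁻⁴`; the burn-in is at least a multiple of `R log T / σ_min(G)`, where
`R = C_R tr(G) log T`; and the `N - a` averaged buffers, `N = ⌊T / (B + u)⌋`, contain at least
`θ T` used samples. -/
structure IsTuning {d : ℕ} (A : Op d) (G : Matrix (Fin d) (Fin d) ℝ) (C_R θ : ℝ)
    (a B u : ℕ → ℕ) : Prop where
  buffer_large : Tendsto B atTop atTop
  buffer_log : (fun T => (B T : ℝ)) =O[atTop] (fun T : ℕ => Real.log T)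
  gap : ∀ᶠ T : ℕ in atTop, ‖A ^ u T‖ ≤ 1 / (T : ℝ) ^ 4
  burnIn : ∃ C > 0, ∀ᶠ T : ℕ in atTop,
    C * ((C_R * G.trace * Real.log T) * Real.log T / sigmaMin G) ≤ a T
  used : ∀ᶠ T : ℕ in atTop,
    θ * T ≤ (B T : ℝ) * (((T / (B T + u T) : ℕ) : ℝ) - a T)

end

/-! Write an iterate as `A + M`. Since a buffer is traversed backwards in time, one pass acts on the
error by `M ↦ M H + Z`. Here `H` is the product of the contractions `1 - 2γ w wᵀ` of the used
samples. In `Z` the noise entering after the sample `w k` is weighted only by `a k = ⟨w k, H_k x⟩`,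
with `H_k` the product over the earlier samples. This weight is independent of that noise, so `Z` is
centred and its contributions are orthogonal; this is what the reverse order buys.

Two formulas then match. The norm lost by the contraction is `‖x‖² - ‖H x‖² = ∑ 4γ(1 - γ‖w k‖²) (a
k)²` (`norm_sq_sub_bufH`), and the noise satisfies `E‖Z x‖² = 4γ² tr(Σ) E ∑ (a k)²`
(`integral_norm_sq_bufZ_block`). So each buffer injects `γ tr(Σ)` times the norm it removes, up to a
factor `1 + O(1/B)`. The accumulated noise `N_s` is therefore nearly isotropic: `E⟨N_s x, N_s y⟩ ≈ γ
tr(Σ) ⟨x, y⟩` after a transient (`integral_inner_chain_le`). Correlations in time are powers of `E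
H`, so the tail average has `G`-weighted variance about `2γ tr(Σ) tr(G (1 - E H)⁻¹) / (t - a)`. The
coercivity of `1 - E H`, of order `γ B G`, bounds the trace by a multiple of `d / (γ B)`. Step size
and condition number cancel, which leaves `d tr(Σ) / (B (t - a))` (`integral_average_noise_le`). The
bias decays geometrically at rate of order `γ B σ_min(G)` (`integral_average_bias_le`).

Three reductions lead to this model. Samples are truncated to the ball of radius `√R`; since `π`
inherits the sub-Gaussian constant of `μ` (`IsStationaryLaw.subGaussianLaw`), at least half of the
second moment survives. The state at the start of each buffer is replaced by an independent draw
from `π`, and the gap makes this cost a factor `‖A^u‖` (`exists_coupling_bound`). If some sample is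
too large the output is zero and the excess loss is at most `tr(G)`, on an event of polynomially
small probability. `canonical_bound` adds these up on a product space, and
`IsStationaryVAR.transfer` carries the result to any trajectory. For tuned parameters everything
except the leading term is `o(1/T)`. -/

namespace RER

/-- The contraction `1 - 2 γ w wᵀ` of one gradient step. -/
noncomputable def damp {d : ℕ} (γ : ℝ) (w : Vec d) : Op d :=
  1 - (2 * γ) • InnerProductSpace.rankOne ℝ w w

/-- The product of the contractions of one buffer; `w` lists the samples chronologically. -/
noncomputable def bufH {d : ℕ} (γ : ℝ) (w : ℕ → Vec d) : ℕ → Op d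
  | 0 => 1
  | k + 1 => damp γ (w k) * bufH γ w k

/-- The noise accumulated in one buffer. -/
noncomputable def bufZ {d : ℕ} (γ : ℝ) (w h : ℕ → Vec d) : ℕ → Op d
  | 0 => 0
  | k + 1 => bufZ γ w h k + ((2 * γ) • InnerProductSpace.rankOne ℝ (h k) (w k)) * bufH γ w k

/-- Radial truncation to the ball of radius `r`. -/
noncomputable def clip {d : ℕ} (r : ℝ) (x : Vec d) : Vec d := (r / max r ‖x‖) • x

/-! ### Algebra of one buffer: affine form, energy identity, Lipschitz dependence on the samples. -/

section Deterministic

variable {d : ℕ}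

lemma damp_apply (γ : ℝ) (w y : Vec d) : damp γ w y = y - (2 * γ * inner ℝ w y) • w := by
  simp [damp, smul_smul]

lemma norm_sq_damp (γ : ℝ) (w y : Vec d) :
    ‖damp γ w y‖ ^ 2 = ‖y‖ ^ 2 - 4 * γ * (1 - γ * ‖w‖ ^ 2) * inner ℝ w y ^ 2 := by
  rw [damp_apply, norm_sub_sq_real, inner_smul_right, norm_smul, mul_pow, Real.norm_eq_abs, sq_abs,
    real_inner_comm]
  ring

lemma bufH_succ_apply (γ : ℝ) (w : ℕ → Vec d) (k : ℕ) (x : Vec d) :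
    bufH γ w (k + 1) x = damp γ (w k) (bufH γ w k x) := rfl

lemma bufZ_succ_apply (γ : ℝ) (w h : ℕ → Vec d) (k : ℕ) (x : Vec d) :
    bufZ γ w h (k + 1) x = bufZ γ w h k x + (2 * γ * inner ℝ (w k) (bufH γ w k x)) • h k := by
  simp [bufZ, smul_smul]

/-- A longer buffer has one more transition at its end, which the reverse order uses first. So an
induction on the length alters only the starting matrix. -/
lemma bufferPass_succ (γ : ℝ) (x : ℕ → Vec d) (s S : ℕ) (M : Op d) (i : ℕ) :
    bufferPass γ x s (S + 1) M (i + 1) =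
      bufferPass γ x s S (sgdStep γ M (x (s + S)) (x (s + S + 1))) i := by
  induction i with
  | zero => simp [bufferPass, add_assoc]
  | succ i ih =>
    rw [bufferPass, ih, bufferPass]
    congr 2 <;> omega

/-- With `y = A x + h` the residual is `(M - A) x - h`, so a gradient step is affine in the error `M
- A`. -/
lemma sgdStep_eq (γ : ℝ) (A M : Op d) (x h : Vec d) :
    sgdStep γ M x (A x + h) =
      A + ((M - A) * damp γ x + (2 * γ) • InnerProductSpace.rankOne ℝ h x) := by
  ext1 y
  have e : ((M - A) * damp γ x) y = (M - A) (damp γ x y) := rfl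
  simp only [sgdStep, add_apply, sub_apply, smul_apply, InnerProductSpace.rankOne_apply, e,
    damp_apply, map_sub, map_smul]
  module

/-- A pass over a buffer is affine in the deviation from the system matrix. -/
lemma bufferPass_eq (γ : ℝ) (A : Op d) (x : ℕ → Vec d) (s u : ℕ) (w h : ℕ → Vec d) (B : ℕ)
    (M : Op d) (hw : ∀ k < B, w k = x (s + u + k))
    (hx : ∀ k < B, x (s + u + k + 1) = A (x (s + u + k)) + h k) :
    bufferPass γ x s (B + u) M B = A + ((M - A) * bufH γ w B + bufZ γ w h B) := by
  induction B generalizing M with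
  | zero => simp [bufferPass, bufH, bufZ]
  | succ B ih =>
    -- The step split off uses the latest sample `w B`, so its contraction lands to the left of
    -- `bufH γ w B`, as in the recursion defining `bufH`.
    rw [add_right_comm, bufferPass_succ, ih _ (fun k hk => hw k (by omega))
      (fun k hk => hx k (by omega))]
    have e : s + (B + u) = s + u + B := by ring
    rw [e, hx B (by omega), ← hw B (by omega), sgdStep_eq, bufH, bufZ]
    simp only [add_sub_cancel_left, add_mul, mul_assoc]
    abel

variable {γ R : ℝ} {w : ℕ → Vec d} {B : ℕ}

/-- Telescoping of `norm_sq_damp`. The squares on the right are the ones that give the second moment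
of `bufZ`, which ties the noise of a buffer to its contraction. -/
lemma norm_sq_sub_bufH (γ : ℝ) (w : ℕ → Vec d) (B : ℕ) (x : Vec d) :
    ‖x‖ ^ 2 - ‖bufH γ w B x‖ ^ 2 =
      ∑ k ∈ Finset.range B, 4 * γ * (1 - γ * ‖w k‖ ^ 2) * inner ℝ (w k) (bufH γ w k x) ^ 2 := by
  induction B with
  | zero => simp [bufH]
  | succ B ih => rw [Finset.sum_range_succ, ← ih, bufH_succ_apply, norm_sq_damp]; ring

lemma norm_damp_le (hγ : 0 ≤ γ) (hγR : γ * R ≤ 1) {w : Vec d} (hw : ‖w‖ ^ 2 ≤ R) :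
    ‖damp γ w‖ ≤ 1 := by
  refine ContinuousLinearMap.opNorm_le_bound _ zero_le_one fun y => ?_
  rw [one_mul]
  refine le_of_sq_le_sq ?_ (norm_nonneg _)
  rw [norm_sq_damp]
  have : γ * ‖w‖ ^ 2 ≤ 1 := (mul_le_mul_of_nonneg_left hw hγ).trans hγR
  have : 0 ≤ 4 * γ * (1 - γ * ‖w‖ ^ 2) * inner ℝ w y ^ 2 := by
    have : 0 ≤ 1 - γ * ‖w‖ ^ 2 := by linarith
    positivity
  linarith

lemma norm_bufH_le (hγ : 0 ≤ γ) (hγR : γ * R ≤ 1) (hw : ∀ k, ‖w k‖ ^ 2 ≤ R) :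
    ‖bufH γ w B‖ ≤ 1 := by
  induction B with
  | zero => exact ContinuousLinearMap.norm_id_le
  | succ B ih =>
    exact (norm_mul_le _ _).trans (mul_le_one₀ (norm_damp_le hγ hγR (hw B)) (norm_nonneg _) ih)

lemma norm_sq_sub_bufH_le (hγ : 0 ≤ γ) (x : Vec d) :
    ‖x‖ ^ 2 - ‖bufH γ w B x‖ ^ 2 ≤
      4 * γ * ∑ k ∈ Finset.range B, inner ℝ (w k) (bufH γ w k x) ^ 2 := by
  rw [norm_sq_sub_bufH, Finset.mul_sum]
  refine Finset.sum_le_sum fun k _ => ?_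
  have : 0 ≤ 4 * γ * (γ * ‖w k‖ ^ 2) * inner ℝ (w k) (bufH γ w k x) ^ 2 := by positivity
  linarith

lemma le_norm_sq_sub_bufH (hγ : 0 ≤ γ) (hw : ∀ k, ‖w k‖ ^ 2 ≤ R) (x : Vec d) :
    4 * γ * (1 - γ * R) * ∑ k ∈ Finset.range B, inner ℝ (w k) (bufH γ w k x) ^ 2 ≤
      ‖x‖ ^ 2 - ‖bufH γ w B x‖ ^ 2 := by
  rw [norm_sq_sub_bufH, Finset.mul_sum]
  refine Finset.sum_le_sum fun k _ => ?_
  have := mul_le_mul_of_nonneg_left (hw k) hγ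
  gcongr

/-- By telescoping, `x - bufH γ w k x` is the sum over `j < k` of `2 γ ⟨w j, bufH γ w j x⟩ w j`, and
`|⟨v, w j⟩| ≤ R`. -/
lemma abs_inner_sub_bufH_le (hγ : 0 ≤ γ) (hw : ∀ k, ‖w k‖ ^ 2 ≤ R) (k : ℕ) (v x : Vec d)
    (hv : ‖v‖ ^ 2 ≤ R) :
    |inner ℝ v (x - bufH γ w k x)| ≤
      2 * γ * R * ∑ j ∈ Finset.range k, |inner ℝ (w j) (bufH γ w j x)| := by
  induction k with
  | zero => simp [bufH]
  | succ k ih =>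
    rw [bufH_succ_apply, damp_apply, Finset.sum_range_succ, mul_add, sub_sub_eq_add_sub,
      add_sub_right_comm, inner_add_right, inner_smul_right]
    refine (abs_add_le _ _).trans (add_le_add ih ?_)
    rw [abs_mul, abs_mul, abs_of_nonneg (by positivity : 0 ≤ 2 * γ)]
    have h1 : |inner ℝ v (w k)| ≤ R := by
      refine (abs_real_inner_le_norm _ _).trans ?_
      nlinarith [hw k, sq_nonneg (‖v‖ - ‖w k‖)]
    calc _ = 2 * γ * |inner ℝ v (w k)| * |inner ℝ (w k) (bufH γ w k x)| := by ring
      _ ≤ _ := by gcongr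

/-- The contraction achieved by a buffer dominates the energy of its samples. -/
lemma sum_inner_sq_le (hγ : 0 ≤ γ) (hw : ∀ k, ‖w k‖ ^ 2 ≤ R) (hγR : γ * R * B ≤ 1 / 4)
    (hγR' : γ * R ≤ 1 / 4) (x : Vec d) :
    6 / 5 * γ * ∑ k ∈ Finset.range B, inner ℝ (w k) x ^ 2 ≤ ‖x‖ ^ 2 - ‖bufH γ w B x‖ ^ 2 := by
  set a : ℕ → ℝ := fun k => inner ℝ (w k) (bufH γ w k x) with ha
  have hR : 0 ≤ R := (sq_nonneg _).trans (hw 0)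
  set Q := ∑ j ∈ Finset.range B, |a j| with hQ
  have hQ0 : 0 ≤ Q := Finset.sum_nonneg fun _ _ => abs_nonneg _
  -- The energy identity sees the partially contracted vectors through `a k`; going back to `x`
  -- costs a multiple of `Q`, itself controlled by the `a j`.
  have h1 : ∀ k ∈ Finset.range B, inner ℝ (w k) x ^ 2 ≤ 2 * a k ^ 2 + 2 * (2 * γ * R * Q) ^ 2 := by
    intro k hk
    have e : inner ℝ (w k) x = a k + inner ℝ (w k) (x - bufH γ w k x) := by
      rw [inner_sub_right]; simp [ha]
    have h2 := abs_inner_sub_bufH_le hγ hw k (w k) x (hw k)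
    have h3 : ∑ j ∈ Finset.range k, |inner ℝ (w j) (bufH γ w j x)| ≤ Q :=
      Finset.sum_le_sum_of_subset_of_nonneg
        (Finset.range_mono (Finset.mem_range.1 hk).le) fun _ _ _ => abs_nonneg _
    have h4 : |inner ℝ (w k) (x - bufH γ w k x)| ≤ 2 * γ * R * Q :=
      h2.trans (by gcongr)
    have h5 : inner ℝ (w k) (x - bufH γ w k x) ^ 2 ≤ (2 * γ * R * Q) ^ 2 :=
      sq_le_sq' (neg_le_of_abs_le h4) (le_of_abs_le h4)
    rw [e]
    nlinarith [sq_nonneg (a k - inner ℝ (w k) (x - bufH γ w k x))]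
  have h6 : Q ^ 2 ≤ B * ∑ k ∈ Finset.range B, a k ^ 2 := by
    have := sq_sum_le_card_mul_sum_sq (s := Finset.range B) (f := fun j => |a j|)
    simpa using this
  have hS : 0 ≤ ∑ k ∈ Finset.range B, a k ^ 2 := Finset.sum_nonneg fun _ _ => sq_nonneg _
  -- `5/2` is `2` from splitting the square plus `8 (γ R B)² ≤ 1/2`. The `6/5` of the statement is
  -- `4 · (3/4)` divided by `5/2`.
  have h7 : ∑ k ∈ Finset.range B, inner ℝ (w k) x ^ 2 ≤
      5 / 2 * ∑ k ∈ Finset.range B, a k ^ 2 := by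
    refine (Finset.sum_le_sum h1).trans ?_
    rw [Finset.sum_add_distrib, ← Finset.mul_sum, Finset.sum_const, Finset.card_range, nsmul_eq_mul]
    have h8 : (B : ℝ) * (2 * (2 * γ * R * Q) ^ 2) ≤
        8 * (γ * R * B) ^ 2 * ∑ k ∈ Finset.range B, a k ^ 2 := by
      calc (B : ℝ) * (2 * (2 * γ * R * Q) ^ 2) = 8 * (γ * R) ^ 2 * B * Q ^ 2 := by ring
        _ ≤ 8 * (γ * R) ^ 2 * B * (B * ∑ k ∈ Finset.range B, a k ^ 2) := by gcongr
        _ = _ := by ring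
    have h9 : (γ * R * B) ^ 2 ≤ (1 / 4) ^ 2 := by
      have : 0 ≤ γ * R * B := by positivity
      gcongr
    nlinarith
  have h10 := le_norm_sq_sub_bufH (B := B) hγ hw x
  have h11 : 6 / 5 * γ * ∑ k ∈ Finset.range B, inner ℝ (w k) x ^ 2 ≤
      6 / 5 * γ * (5 / 2 * ∑ k ∈ Finset.range B, a k ^ 2) := by gcongr
  have h12 : 4 * γ * (3 / 4) * ∑ k ∈ Finset.range B, a k ^ 2 ≤
      4 * γ * (1 - γ * R) * ∑ k ∈ Finset.range B, a k ^ 2 := by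
    gcongr; linarith
  linarith

lemma norm_bufZ_le (hγ : 0 ≤ γ) (hγR : γ * R ≤ 1) (hw : ∀ k, ‖w k‖ ^ 2 ≤ R) (h : ℕ → Vec d) :
    ‖bufZ γ w h B‖ ≤ 2 * γ * √R * ∑ k ∈ Finset.range B, ‖h k‖ := by
  induction B with
  | zero => simp [bufZ]
  | succ B ih =>
    rw [Finset.sum_range_succ, mul_add]
    refine (norm_add_le _ _).trans (add_le_add ih ((norm_mul_le _ _).trans ?_))
    rw [norm_smul, InnerProductSpace.norm_rankOne, Real.norm_of_nonneg (by positivity)]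
    calc _ ≤ 2 * γ * (‖h B‖ * √R) * 1 := by
          gcongr
          · exact Real.le_sqrt_of_sq_le (hw B)
          · exact norm_bufH_le hγ hγR hw
      _ = _ := by ring

variable {w' : ℕ → Vec d}

lemma norm_damp_sub_le (hγ : 0 ≤ γ) {v v' : Vec d} (hv : ‖v‖ ≤ √R) (hv' : ‖v'‖ ≤ √R) :
    ‖damp γ v - damp γ v'‖ ≤ 4 * γ * √R * ‖v - v'‖ := by
  have e : damp γ v - damp γ v' = -((2 * γ) • (InnerProductSpace.rankOne ℝ (v - v') v +
      InnerProductSpace.rankOne ℝ v' (v - v'))) := by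
    simp only [damp, map_sub, sub_apply]
    module
  rw [e, norm_neg, norm_smul, Real.norm_of_nonneg (by positivity)]
  have : ‖InnerProductSpace.rankOne ℝ (v - v') v + InnerProductSpace.rankOne ℝ v' (v - v')‖ ≤
      ‖v - v'‖ * √R + √R * ‖v - v'‖ := by
    refine (norm_add_le _ _).trans ?_
    rw [InnerProductSpace.norm_rankOne, InnerProductSpace.norm_rankOne]
    gcongr
  calc _ ≤ 2 * γ * (‖v - v'‖ * √R + √R * ‖v - v'‖) := by gcongr
    _ = _ := by ring

/-- Each factor has norm at most one and is `4γ√R`-Lipschitz in its sample, so errors only add up.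
This and `norm_bufZ_sub_le` compare a buffer with its independently restarted copy. -/
lemma norm_bufH_sub_le (hγ : 0 ≤ γ) (hγR : γ * R ≤ 1) (hw : ∀ k, ‖w k‖ ^ 2 ≤ R)
    (hw' : ∀ k, ‖w' k‖ ^ 2 ≤ R) {δ : ℝ} (hδ : ∀ k, ‖w k - w' k‖ ≤ δ) :
    ‖bufH γ w B - bufH γ w' B‖ ≤ 4 * γ * √R * B * δ := by
  induction B with
  | zero => simp [bufH]
  | succ B ih =>
    have e : bufH γ w (B + 1) - bufH γ w' (B + 1) =
        damp γ (w B) * (bufH γ w B - bufH γ w' B) +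
          (damp γ (w B) - damp γ (w' B)) * bufH γ w' B := by
      simp only [bufH, mul_sub, sub_mul]; abel
    rw [e]
    refine (norm_add_le _ _).trans ?_
    have h1 := (norm_mul_le (damp γ (w B)) (bufH γ w B - bufH γ w' B)).trans
      (mul_le_of_le_one_left (norm_nonneg _) (norm_damp_le hγ hγR (hw B)))
    have h2 := (norm_mul_le (damp γ (w B) - damp γ (w' B)) (bufH γ w' B)).trans
      (mul_le_of_le_one_right (norm_nonneg _) (norm_bufH_le hγ hγR hw'))
    have h3 := norm_damp_sub_le hγ (Real.le_sqrt_of_sq_le (hw B)) (Real.le_sqrt_of_sq_le (hw' B))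
    have h4 : 4 * γ * √R * ‖w B - w' B‖ ≤ 4 * γ * √R * δ := by gcongr; exact hδ B
    push_cast
    linarith

/-- A sample enters directly and through `bufH`. The indirect error carries the factor `4 γ R B ≤
1`, so each of the two is at most `2 γ δ ‖h k‖`. -/
lemma norm_bufZ_sub_le (hγ : 0 ≤ γ) (hγR : γ * R ≤ 1) (hw : ∀ k, ‖w k‖ ^ 2 ≤ R)
    (hw' : ∀ k, ‖w' k‖ ^ 2 ≤ R) {δ : ℝ} (hδ : ∀ k, ‖w k - w' k‖ ≤ δ)
    (hγB : γ * R * B ≤ 1 / 4) (h : ℕ → Vec d) :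
    ‖bufZ γ w h B - bufZ γ w' h B‖ ≤ 4 * γ * δ * ∑ k ∈ Finset.range B, ‖h k‖ := by
  have hδ0 : 0 ≤ δ := (norm_nonneg _).trans (hδ 0)
  have hR : 0 ≤ R := (sq_nonneg _).trans (hw 0)
  induction B with
  | zero => simp [bufZ]
  | succ B ih =>
    push_cast at hγB
    have hγB' : γ * R * B ≤ 1 / 4 := by
      have : 0 ≤ γ * R := by positivity
      linarith
    have e : bufZ γ w h (B + 1) - bufZ γ w' h (B + 1) = (bufZ γ w h B - bufZ γ w' h B) +
        ((2 * γ) • InnerProductSpace.rankOne ℝ (h B) (w B - w' B) * bufH γ w B +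
        (2 * γ) • InnerProductSpace.rankOne ℝ (h B) (w' B) * (bufH γ w B - bufH γ w' B)) := by
      simp only [bufZ, map_sub, smul_sub, mul_sub, sub_mul]
      abel
    rw [e, Finset.sum_range_succ, mul_add]
    refine (norm_add_le _ _).trans (add_le_add (ih hγB') ((norm_add_le _ _).trans ?_))
    have h1 : ‖(2 * γ) • InnerProductSpace.rankOne ℝ (h B) (w B - w' B) * bufH γ w B‖ ≤
        2 * γ * (‖h B‖ * δ) * 1 := by
      refine (norm_mul_le _ _).trans ?_
      rw [norm_smul, InnerProductSpace.norm_rankOne, Real.norm_of_nonneg (by positivity)]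
      gcongr
      · exact hδ B
      · exact norm_bufH_le hγ hγR hw
    have h2 : ‖(2 * γ) • InnerProductSpace.rankOne ℝ (h B) (w' B) *
        (bufH γ w B - bufH γ w' B)‖ ≤ 2 * γ * (‖h B‖ * √R) * (4 * γ * √R * B * δ) := by
      refine (norm_mul_le _ _).trans ?_
      rw [norm_smul, InnerProductSpace.norm_rankOne, Real.norm_of_nonneg (by positivity)]
      gcongr
      · exact Real.le_sqrt_of_sq_le (hw' B)
      · exact norm_bufH_sub_le hγ hγR hw hw' hδ
    have h3 : 2 * γ * (‖h B‖ * √R) * (4 * γ * √R * B * δ) ≤ 2 * γ * (‖h B‖ * δ) := by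
      calc _ = 2 * γ * (‖h B‖ * δ) * (4 * (γ * (√R * √R) * B)) := by ring
        _ = 2 * γ * (‖h B‖ * δ) * (4 * (γ * R * B)) := by rw [Real.mul_self_sqrt hR]
        _ ≤ 2 * γ * (‖h B‖ * δ) * 1 := by gcongr; linarith
        _ = _ := mul_one _
    linarith

end Deterministic

/-! ### Radial truncation. -/

section Clip

variable {d : ℕ} {r : ℝ}

lemma clip_of_norm_le (hr : 0 < r) {x : Vec d} (hx : ‖x‖ ≤ r) : clip r x = x := by
  rw [clip, max_eq_left hx, div_self hr.ne', one_smul]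

lemma norm_clip_le (hr : 0 < r) (x : Vec d) : ‖clip r x‖ ≤ r := by
  have : 0 < max r ‖x‖ := lt_max_of_lt_left hr
  rw [clip, norm_smul, Real.norm_of_nonneg (by positivity), div_mul_eq_mul_div, div_le_iff₀ this]
  gcongr
  exact le_max_right _ _

/-- The difference splits into a rescaled `x - y` and a change of the scaling factor, each of size
at most `‖x - y‖`. No sharper constant is needed. -/
lemma norm_clip_sub_le (hr : 0 < r) (x y : Vec d) : ‖clip r x - clip r y‖ ≤ 2 * ‖x - y‖ := by
  set a := max r ‖x‖ with ha
  set b := max r ‖y‖ with hb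
  have ha0 : 0 < a := lt_max_of_lt_left hr
  have hb0 : 0 < b := lt_max_of_lt_left hr
  have e : clip r x - clip r y = (r / b) • (x - y) + (r / a - r / b) • x := by
    simp only [clip, ← ha, ← hb]; module
  rw [e]
  refine (norm_add_le _ _).trans ?_
  have h1 : ‖(r / b) • (x - y)‖ ≤ ‖x - y‖ := by
    rw [norm_smul, Real.norm_of_nonneg (by positivity)]
    refine mul_le_of_le_one_left (norm_nonneg _) ?_
    rw [div_le_one hb0]
    exact le_max_left _ _
  have h2 : ‖(r / a - r / b) • x‖ ≤ ‖x - y‖ := by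
    have e2 : r / a - r / b = (r / b) * ((b - a) / a) := by field_simp
    rw [norm_smul, e2, norm_mul, norm_div (b - a), Real.norm_of_nonneg ha0.le,
      Real.norm_of_nonneg (by positivity : 0 ≤ r / b)]
    have h3 : ‖b - a‖ ≤ ‖x - y‖ := by
      have := abs_max_sub_max_le_abs ‖y‖ ‖x‖ r
      rw [max_comm, ← hb, max_comm, ← ha] at this
      refine this.trans ((abs_norm_sub_norm_le y x).trans ?_)
      rw [norm_sub_rev]
    have h4 : r / b ≤ 1 := by rw [div_le_one hb0]; exact le_max_left _ _
    calc r / b * (‖b - a‖ / a) * ‖x‖ = (r / b) * ‖b - a‖ * (‖x‖ / a) := by ring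
      _ ≤ 1 * ‖x - y‖ * 1 := by
        gcongr
        rw [div_le_one ha0]; exact le_max_right _ _
      _ = _ := by ring
  linarith

lemma continuous_clip (hr : 0 < r) : Continuous (clip r : Vec d → Vec d) := by
  unfold clip
  refine Continuous.smul (f := fun x : Vec d => r / max r ‖x‖)
    (continuous_const.div (by fun_prop) fun x => (lt_max_of_lt_left hr).ne') continuous_id

end Clip

end RER

namespace RER

/-! ### Singular values as bounds for an operator. -/

section SingularValues

variable {d : ℕ}

/-- Parseval in an eigenbasis of `T* T`, whose eigenvalues are the squared singular values. Both
extreme-value bounds below follow by comparing coefficients. -/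
lemma norm_sq_toEuclideanLin (M : Matrix (Fin d) (Fin d) ℝ) (x : Vec d) :
    ‖Matrix.toEuclideanLin M x‖ ^ 2 =
      ∑ i : Fin d, (Matrix.toEuclideanLin M).singularValues i ^ 2 *
        inner ℝ ((Matrix.toEuclideanLin M).isSymmetric_adjoint_comp_self.eigenvectorBasis
          (finrank_euclideanSpace_fin) i) x ^ 2 := by
  set T := Matrix.toEuclideanLin M
  set hT := T.isSymmetric_adjoint_comp_self
  set b := hT.eigenvectorBasis (finrank_euclideanSpace_fin (𝕜 := ℝ) (n := d))
  have h1 : ‖T x‖ ^ 2 = inner ℝ x ((LinearMap.adjoint T ∘ₗ T) x) := by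
    rw [LinearMap.comp_apply, LinearMap.adjoint_inner_right, real_inner_self_eq_norm_sq]
  rw [h1, ← b.sum_inner_mul_inner]
  refine Finset.sum_congr rfl fun i _ => ?_
  rw [← hT (b i) x, hT.apply_eigenvectorBasis, inner_smul_left,
    ← T.sq_singularValues_fin finrank_euclideanSpace_fin, real_inner_comm]
  simp only [RCLike.ofReal_real_eq_id, id_eq, conj_trivial]
  ring

lemma norm_toEuclideanLin_le (M : Matrix (Fin d) (Fin d) ℝ) (x : Vec d) :
    ‖Matrix.toEuclideanLin M x‖ ≤ sigmaMax M * ‖x‖ := by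
  refine le_of_sq_le_sq ?_ (mul_nonneg (LinearMap.singularValues_nonneg _ _) (norm_nonneg _))
  rw [norm_sq_toEuclideanLin, mul_pow,
    ← ((Matrix.toEuclideanLin M).isSymmetric_adjoint_comp_self.eigenvectorBasis
          (finrank_euclideanSpace_fin)).sum_sq_inner_right, Finset.mul_sum]
  refine Finset.sum_le_sum fun i _ => mul_le_mul_of_nonneg_right ?_ (sq_nonneg _)
  exact pow_le_pow_left₀ (LinearMap.singularValues_nonneg _ _)
    (LinearMap.singularValues_antitone _ (Nat.zero_le _)) 2

lemma sigmaMin_mul_norm_le (M : Matrix (Fin d) (Fin d) ℝ) (x : Vec d) :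
    sigmaMin M * ‖x‖ ≤ ‖Matrix.toEuclideanLin M x‖ := by
  refine le_of_sq_le_sq ?_ (norm_nonneg _)
  rw [norm_sq_toEuclideanLin, mul_pow,
    ← ((Matrix.toEuclideanLin M).isSymmetric_adjoint_comp_self.eigenvectorBasis
          (finrank_euclideanSpace_fin)).sum_sq_inner_right, Finset.mul_sum]
  refine Finset.sum_le_sum fun i _ => mul_le_mul_of_nonneg_right ?_ (sq_nonneg _)
  exact pow_le_pow_left₀ (LinearMap.singularValues_nonneg _ _)
    (LinearMap.singularValues_antitone _ (by omega)) 2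

lemma sigmaMax_nonneg (M : Matrix (Fin d) (Fin d) ℝ) : 0 ≤ sigmaMax M :=
  LinearMap.singularValues_nonneg _ _

lemma sigmaMin_le_sigmaMax (M : Matrix (Fin d) (Fin d) ℝ) : sigmaMin M ≤ sigmaMax M :=
  LinearMap.singularValues_antitone _ (Nat.zero_le _)

lemma sigmaMin_pos (hd : 0 < d) {M : Matrix (Fin d) (Fin d) ℝ}
    (hM : ∀ x : Vec d, Matrix.toEuclideanLin M x = 0 → x = 0) : 0 < sigmaMin M := by
  refine (LinearMap.injective_iff_forall_lt_finrank_singularValues_pos _).1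
    ((injective_iff_map_eq_zero _).2 hM) _ ?_
  rw [finrank_euclideanSpace_fin]
  omega

lemma trace_le_card_mul_sigmaMax (M : Matrix (Fin d) (Fin d) ℝ) :
    M.trace ≤ d * sigmaMax M := by
  have h : ∀ i : Fin d, M i i ≤ sigmaMax M := by
    intro i
    have h1 : M i i = inner ℝ (EuclideanSpace.single i (1 : ℝ))
        (Matrix.toEuclideanLin M (EuclideanSpace.single i (1 : ℝ))) := by
      simp [EuclideanSpace.inner_single_left, Matrix.toLpLin_apply]
    rw [h1]
    refine (real_inner_le_norm _ _).trans ?_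
    simpa using norm_toEuclideanLin_le M (EuclideanSpace.single i (1 : ℝ))
  calc M.trace = ∑ i : Fin d, M i i := rfl
    _ ≤ ∑ _i : Fin d, sigmaMax M := Finset.sum_le_sum fun i _ => h i
    _ = _ := by simp

end SingularValues

/-! ### Second moment matrices as quadratic forms. -/

section MomentMatrix

variable {d : ℕ} {ν : Measure (Vec d)}

lemma memLp_inner (hν : MemLp (fun x : Vec d => x) 2 ν) (x : Vec d) :
    MemLp (fun z : Vec d => inner ℝ x z) 2 ν := hν.const_inner x

lemma memLp_coord (hν : MemLp (fun x : Vec d => x) 2 ν) (i : Fin d) :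
    MemLp (fun z : Vec d => z i) 2 ν := by
  simpa [EuclideanSpace.inner_single_left] using memLp_inner hν (EuclideanSpace.single i (1 : ℝ))

lemma integrable_inner_mul_inner (hν : MemLp (fun x : Vec d => x) 2 ν) (x y : Vec d) :
    Integrable (fun z : Vec d => inner ℝ x z * inner ℝ y z) ν :=
  (memLp_inner hν x).integrable_mul (memLp_inner hν y)

lemma inner_momentMatrix (hν : MemLp (fun x : Vec d => x) 2 ν) (x y : Vec d) :
    inner ℝ x (Matrix.toEuclideanLin (momentMatrix ν) y) = ∫ z, inner ℝ x z * inner ℝ y z ∂ν := by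
  have h : ∀ z : Vec d, inner ℝ x z * inner ℝ y z =
      ∑ i : Fin d, ∑ j : Fin d, x i * y j * (z i * z j) := by
    intro z
    simp only [PiLp.inner_apply, RCLike.inner_apply, conj_trivial, Finset.sum_mul_sum]
    exact Finset.sum_congr rfl fun i _ => Finset.sum_congr rfl fun j _ => by ring
  have hij : ∀ i j : Fin d, Integrable (fun z : Vec d => x i * y j * (z i * z j)) ν := fun i j =>
    ((memLp_coord hν i).integrable_mul (memLp_coord hν j)).const_mul _
  simp_rw [h]
  rw [integral_finsetSum _ fun i _ => integrable_finsetSum _ fun j _ => hij i j]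
  simp only [PiLp.inner_apply, RCLike.inner_apply, conj_trivial]
  refine Finset.sum_congr rfl fun i _ => ?_
  rw [integral_finsetSum _ fun j _ => hij i j]
  simp only [Matrix.toLpLin_apply, Matrix.mulVec, dotProduct, Finset.sum_mul]
  refine Finset.sum_congr rfl fun j _ => ?_
  rw [integral_const_mul]
  simp only [momentMatrix, Matrix.of_apply]
  ring

lemma integrable_norm_sq (hν : MemLp (fun x : Vec d => x) 2 ν) :
    Integrable (fun z : Vec d => ‖z‖ ^ 2) ν := hν.integrable_norm_pow (by norm_num)

lemma trace_momentMatrix (hν : MemLp (fun x : Vec d => x) 2 ν) :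
    (momentMatrix ν).trace = ∫ z, ‖z‖ ^ 2 ∂ν := by
  simp_rw [EuclideanSpace.real_norm_sq_eq]
  rw [integral_finsetSum _ fun i _ => (memLp_coord hν i).integrable_sq]
  simp [Matrix.trace, momentMatrix, pow_two]

lemma trace_momentMatrix_nonneg : 0 ≤ (momentMatrix ν).trace := by
  refine Finset.sum_nonneg fun i _ => ?_
  simp only [momentMatrix, Matrix.diag_apply, Matrix.of_apply]
  exact integral_nonneg fun z => mul_self_nonneg _

/-- Diagonalisation of the second moment of a law. -/
lemma exists_eigenbasis (hν : MemLp (fun x : Vec d => x) 2 ν) :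
    ∃ (e : OrthonormalBasis (Fin d) ℝ (Vec d)) (g : Fin d → ℝ),
      (∀ i, sigmaMin (momentMatrix ν) ≤ g i) ∧ (∀ i, g i ≤ sigmaMax (momentMatrix ν)) ∧
      ∑ i, g i = (momentMatrix ν).trace ∧
      (∀ x, ∫ z, inner ℝ z x ^ 2 ∂ν = ∑ i, g i * inner ℝ (e i) x ^ 2) ∧
      (∀ N : Op d, ∫ z, ‖N z‖ ^ 2 ∂ν = ∑ i, g i * ‖N (e i)‖ ^ 2) := by
  set T := Matrix.toEuclideanLin (momentMatrix ν) with hTdef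
  have hT : T.IsSymmetric := fun x y => by
    rw [real_inner_comm, inner_momentMatrix hν, inner_momentMatrix hν]
    simp_rw [mul_comm]
  set e := hT.eigenvectorBasis (finrank_euclideanSpace_fin (𝕜 := ℝ) (n := d))
  set g : Fin d → ℝ := hT.eigenvalues (finrank_euclideanSpace_fin (𝕜 := ℝ) (n := d))
  have hTe : ∀ i, T (e i) = g i • e i := fun i => hT.apply_eigenvectorBasis _ i
  -- The coordinates in the eigenbasis are uncorrelated, which makes every quadratic integral below
  -- diagonal.
  have horth : ∀ i j, ∫ z, inner ℝ (e i) z * inner ℝ (e j) z ∂ν = if i = j then g j else 0 := by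
    intro i j
    rw [← inner_momentMatrix hν, ← hTdef, hTe, inner_smul_right,
      orthonormal_iff_ite.1 e.orthonormal]
    simp
  have hgi : ∀ i, g i = ∫ z, inner ℝ (e i) z * inner ℝ (e i) z ∂ν := fun i => by
    rw [horth, if_pos rfl]
  have hg0 : ∀ i, 0 ≤ g i := fun i => by
    rw [hgi]; exact integral_nonneg fun z => mul_self_nonneg _
  have hnorm : ∀ i, ‖T (e i)‖ = g i := fun i => by
    rw [hTe, norm_smul, e.orthonormal.1 i, mul_one, Real.norm_of_nonneg (hg0 i)]
  have hN : ∀ N : Op d, ∫ z, ‖N z‖ ^ 2 ∂ν = ∑ i, g i * ‖N (e i)‖ ^ 2 := by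
    intro N
    have h : ∀ z : Vec d, ‖N z‖ ^ 2 = ∑ i, ∑ j, inner ℝ (N (e i)) (N (e j)) *
        (inner ℝ (e i) z * inner ℝ (e j) z) := by
      intro z
      conv_lhs => rw [← e.sum_repr' z, map_sum, ← real_inner_self_eq_norm_sq, sum_inner]
      refine Finset.sum_congr rfl fun i _ => ?_
      rw [inner_sum]
      refine Finset.sum_congr rfl fun j _ => ?_
      rw [map_smul, map_smul, inner_smul_left, inner_smul_right]
      simp only [conj_trivial]
      ring
    rw [integral_congr_ae (ae_of_all _ h)]
    have hij : ∀ i j, Integrable (fun z => inner ℝ (N (e i)) (N (e j)) *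
        (inner ℝ (e i) z * inner ℝ (e j) z)) ν := fun i j =>
      (integrable_inner_mul_inner hν _ _).const_mul _
    rw [integral_finsetSum _ fun i _ => integrable_finsetSum _ fun j _ => hij i j]
    refine Finset.sum_congr rfl fun i _ => ?_
    rw [integral_finsetSum _ fun j _ => hij i j]
    simp_rw [integral_const_mul, horth]
    simp only [mul_ite, mul_zero, Finset.sum_ite_eq, Finset.mem_univ, if_true,
      real_inner_self_eq_norm_sq]
    ring
  refine ⟨e, g, fun i => ?_, fun i => ?_, ?_, fun x => ?_, hN⟩
  · have := sigmaMin_mul_norm_le (momentMatrix ν) (e i)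
    rw [← hTdef, hnorm, e.orthonormal.1 i, mul_one] at this
    exact this
  · have := norm_toEuclideanLin_le (momentMatrix ν) (e i)
    rw [← hTdef, hnorm, e.orthonormal.1 i, mul_one] at this
    exact this
  · rw [trace_momentMatrix hν]
    have := hN 1
    simpa [e.orthonormal.1] using this.symm
  · have h : ∀ z : Vec d, inner ℝ z x ^ 2 = ∑ i, ∑ j, inner ℝ (e i) x * inner ℝ (e j) x *
        (inner ℝ (e i) z * inner ℝ (e j) z) := by
      intro z
      rw [← e.sum_inner_mul_inner z x, pow_two, Finset.sum_mul_sum]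
      refine Finset.sum_congr rfl fun i _ => Finset.sum_congr rfl fun j _ => ?_
      rw [real_inner_comm z, real_inner_comm z]
      ring
    rw [integral_congr_ae (ae_of_all _ h)]
    have hij : ∀ i j, Integrable (fun z => inner ℝ (e i) x * inner ℝ (e j) x *
        (inner ℝ (e i) z * inner ℝ (e j) z)) ν := fun i j =>
      (integrable_inner_mul_inner hν _ _).const_mul _
    rw [integral_finsetSum _ fun i _ => integrable_finsetSum _ fun j _ => hij i j]
    refine Finset.sum_congr rfl fun i _ => ?_
    rw [integral_finsetSum _ fun j _ => hij i j]
    simp_rw [integral_const_mul, horth]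
    simp only [mul_ite, mul_zero, Finset.sum_ite_eq, Finset.mem_univ, if_true]
    ring

end MomentMatrix

/-! ### Inverses of coercive, possibly non-symmetric operators. -/

section Resolvent

variable {d : ℕ}

/-- Bounds on the inverse of an operator that is coercive for a diagonal quadratic form. -/
lemma exists_inverse_of_coercive (e : OrthonormalBasis (Fin d) ℝ (Vec d)) (g : Fin d → ℝ)
    {gmin gmax κ₁ : ℝ} (hmin : 0 < gmin) (hg : ∀ i, gmin ≤ g i) (hg' : ∀ i, g i ≤ gmax)
    (hκ : 0 < κ₁) (L : Op d)
    (hL : ∀ x, κ₁ * ∑ i, g i * inner ℝ (e i) x ^ 2 ≤ inner ℝ x (L x)) :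
    ∃ K : Op d, K * L = 1 ∧ L * K = 1 ∧ (∀ i, g i * inner ℝ (e i) (K (e i)) ≤ 1 / κ₁) ∧
      ∀ i, g i * ‖K (e i)‖ ≤ √(gmax / gmin) / κ₁ := by
  have hcoer : ∀ x, κ₁ * gmin * ‖x‖ ^ 2 ≤ inner ℝ x (L x) := by
    intro x
    refine le_trans ?_ (hL x)
    rw [mul_assoc, ← e.sum_sq_inner_right x, Finset.mul_sum]
    gcongr with i
    exact hg i
  have hinj : Function.Injective L.toLinearMap := by
    rw [injective_iff_map_eq_zero]
    intro x hx
    have h := hcoer x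
    have hx' : L x = 0 := hx
    rw [hx', inner_zero_right] at h
    have : ‖x‖ ^ 2 ≤ 0 := by
      by_contra! hc
      have := mul_pos (mul_pos hκ hmin) hc
      linarith
    simpa using this
  let E := (LinearEquiv.ofInjectiveEndo L.toLinearMap hinj).toContinuousLinearEquiv
  have hE : ∀ x, E x = L x := fun x => rfl
  refine ⟨(E.symm : Vec d →L[ℝ] Vec d), ?_, ?_, ?_⟩
  · ext1 x
    exact E.symm_apply_apply x
  · ext1 x
    exact E.apply_symm_apply x
  have hLK : ∀ x, L (E.symm x) = x := fun x => E.apply_symm_apply x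
  -- Coercivity is tested at `K eᵢ`, keeping only the `i`-th summand: `κ₁ gᵢ s² ≤ s` with `s = ⟨eᵢ,
  -- K eᵢ⟩`. No condition number enters, which keeps it out of the leading term of the theorem.
  have key : ∀ i, g i * inner ℝ (e i) (E.symm (e i)) ≤ 1 / κ₁ := by
    intro i
    have h := hL (E.symm (e i))
    rw [hLK, real_inner_comm] at h
    set s := inner ℝ (e i) (E.symm (e i)) with hs
    have h1 : κ₁ * (g i * s ^ 2) ≤ s := by
      refine le_trans ?_ h
      refine mul_le_mul_of_nonneg_left ?_ hκ.le
      exact Finset.single_le_sum (f := fun j => g j * inner ℝ (e j) (E.symm (e i)) ^ 2)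
        (fun j _ => mul_nonneg (hmin.le.trans (hg j)) (sq_nonneg _)) (Finset.mem_univ i)
    have hgi : 0 < g i := hmin.trans_le (hg i)
    have hs0 : 0 ≤ s := le_trans (by positivity) h1
    rw [le_div_iff₀ hκ]
    rcases hs0.eq_or_lt with h0 | h0
    · rw [← h0]; simp
    · have : (g i * s * κ₁) * s ≤ 1 * s := by linarith
      exact le_of_mul_le_mul_right this h0
  refine ⟨key, fun i => ?_⟩
  have hgi : 0 < g i := hmin.trans_le (hg i)
  -- The full norm of `K eᵢ` needs coercivity with respect to the identity; this is what costs
  -- `√(gmax / gmin)`.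
  have h := hcoer (E.symm (e i))
  rw [hLK, real_inner_comm] at h
  refine le_of_sq_le_sq ?_ (by positivity)
  have hmax : 0 < gmax := hgi.trans_le (hg' i)
  rw [div_pow, Real.sq_sqrt (by positivity), mul_pow, div_div, le_div_iff₀ (by positivity)]
  have k := key i
  rw [le_div_iff₀ hκ] at k
  change g i ^ 2 * ‖E.symm (e i)‖ ^ 2 * (gmin * κ₁ ^ 2) ≤ gmax
  calc g i ^ 2 * ‖E.symm (e i)‖ ^ 2 * (gmin * κ₁ ^ 2)
      = g i * (κ₁ * g i * (κ₁ * gmin * ‖E.symm (e i)‖ ^ 2)) := by ring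
    _ ≤ g i * (κ₁ * g i * inner ℝ (e i) (E.symm (e i))) := by gcongr
    _ = g i * (g i * inner ℝ (e i) (E.symm (e i)) * κ₁) := by ring
    _ ≤ g i * 1 := by gcongr
    _ ≤ gmax := by rw [mul_one]; exact hg' i

end Resolvent

end RER

/-! ### Sub-Gaussian laws: exponential moments of the squared norm and tails. -/

namespace RER

/-- A law with nondegenerate second moment whose linear marginals have a Gaussian moment generating
function bound, with variance proxy `C` times the second moment. -/
structure SubGaussianLaw {d : ℕ} (C : ℝ) (ν : Measure (Vec d)) : Prop where
  isProb : IsProbabilityMeasure ν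
  memLp : MemLp (fun x : Vec d => x) 2 ν
  integrable_exp : ∀ x : Vec d, Integrable (fun z : Vec d => Real.exp (inner ℝ x z)) ν
  mgf_le : ∀ x : Vec d,
    ∫ z, Real.exp (inner ℝ x z) ∂ν ≤ Real.exp (C / 2 * ∫ z, inner ℝ x z ^ 2 ∂ν)
  nondegenerate : ∀ x : Vec d, ∫ z, inner ℝ x z ^ 2 ∂ν = 0 → x = 0

section ExpSquare

open scoped ENNReal

lemma lintegral_exp_sq_gaussianReal :
    ∫⁻ y, ENNReal.ofReal (Real.exp (y ^ 2 / 4)) ∂gaussianReal 0 1 ≤ 2 := by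
  rw [gaussianReal_of_var_ne_zero 0 one_ne_zero,
    lintegral_withDensity_eq_lintegral_mul _ (measurable_gaussianPDF _ _) (by fun_prop)]
  have h1 : ∀ y : ℝ, (gaussianPDF 0 1 * fun y => ENNReal.ofReal (Real.exp (y ^ 2 / 4))) y =
      ENNReal.ofReal ((√(2 * Real.pi))⁻¹ * Real.exp (-(1 / 4) * y ^ 2)) := by
    intro y
    rw [Pi.mul_apply, gaussianPDF, ← ENNReal.ofReal_mul (gaussianPDFReal_nonneg _ _ _),
      gaussianPDFReal, mul_assoc, ← Real.exp_add]
    norm_num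
    ring_nf
  simp_rw [h1]
  rw [← ofReal_integral_eq_lintegral_ofReal
    ((integrable_exp_neg_mul_sq (by norm_num : (0 : ℝ) < 1 / 4)).const_mul _)
    (ae_of_all _ fun _ => by positivity), integral_const_mul, integral_gaussian]
  have : (√(2 * Real.pi))⁻¹ * √(Real.pi / (1 / 4)) ≤ 2 := by
    rw [← Real.sqrt_inv, ← Real.sqrt_mul (by positivity)]
    refine Real.sqrt_le_iff.2 ⟨by norm_num, ?_⟩
    have : (2 * Real.pi)⁻¹ * (Real.pi / (1 / 4)) = 2 := by field_simp; norm_num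
    rw [this]; norm_num
  calc _ ≤ ENNReal.ofReal 2 := ENNReal.ofReal_le_ofReal this
    _ = 2 := by simp

/-- Gaussian linearisation: `exp (l X²)` is the moment generating function of a standard Gaussian
`y` at `√(2l) X`. After swapping the integrals, the bound for `X` leaves `exp (l v y²) ≤ exp (y² /
4)`. -/
lemma lintegral_exp_sq_le {α : Type*} [MeasurableSpace α] {ν : Measure α} [IsProbabilityMeasure ν]
    {X : α → ℝ} (hX : Measurable X) {v l : ℝ} (hl : 0 ≤ l) (hlv : l * v ≤ 1 / 4)
    (hint : ∀ t : ℝ, Integrable (fun a => Real.exp (t * X a)) ν)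
    (hmgf : ∀ t : ℝ, ∫ a, Real.exp (t * X a) ∂ν ≤ Real.exp (v * t ^ 2 / 2)) :
    ∫⁻ a, ENNReal.ofReal (Real.exp (l * X a ^ 2)) ∂ν ≤ 2 := by
  have h1 : ∀ a, ENNReal.ofReal (Real.exp (l * X a ^ 2)) =
      ∫⁻ y, ENNReal.ofReal (Real.exp (√(2 * l) * X a * y)) ∂gaussianReal 0 1 := by
    intro a
    rw [← ofReal_integral_eq_lintegral_ofReal (integrable_exp_mul_gaussianReal _)
      (ae_of_all _ fun _ => by positivity)]
    have := mgf_gaussianReal (p := gaussianReal 0 1) (X := id) (μ := 0) (v := 1) (by simp)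
      (√(2 * l) * X a)
    rw [mgf] at this
    simp only [id] at this
    rw [this, mul_pow, Real.sq_sqrt (by positivity)]
    congr 2
    simp
    ring
  simp_rw [h1]
  rw [lintegral_lintegral_swap (by fun_prop)]
  refine (lintegral_mono fun y => ?_).trans lintegral_exp_sq_gaussianReal
  have h2 : ∀ a, Real.exp (√(2 * l) * X a * y) = Real.exp ((√(2 * l) * y) * X a) := fun a => by
    ring_nf
  simp_rw [h2]
  rw [← ofReal_integral_eq_lintegral_ofReal (hint _) (ae_of_all _ fun _ => by positivity)]
  refine ENNReal.ofReal_le_ofReal ((hmgf _).trans (Real.exp_le_exp.2 ?_))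
  rw [mul_pow, Real.sq_sqrt (by positivity)]
  nlinarith [sq_nonneg y]

end ExpSquare

namespace SubGaussianLaw

variable {d : ℕ} {C : ℝ} {ν : Measure (Vec d)}

lemma second_moment_pos (h : SubGaussianLaw C ν) {x : Vec d} (hx : x ≠ 0) :
    0 < ∫ z, inner ℝ x z ^ 2 ∂ν :=
  (integral_nonneg fun _ => sq_nonneg _).lt_of_ne fun h0 => hx (h.nondegenerate x h0.symm)

lemma diag_pos (h : SubGaussianLaw C ν) (i : Fin d) : 0 < momentMatrix ν i i := by
  have := h.second_moment_pos (x := EuclideanSpace.single i (1 : ℝ)) (by simp)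
  simpa [EuclideanSpace.inner_single_left, momentMatrix, pow_two] using this

lemma trace_pos (h : SubGaussianLaw C ν) (hd : 0 < d) : 0 < (momentMatrix ν).trace := by
  have : Nonempty (Fin d) := ⟨⟨0, hd⟩⟩
  exact Finset.sum_pos (fun i _ => h.diag_pos i) Finset.univ_nonempty

lemma sigmaMin_pos (h : SubGaussianLaw C ν) (hd : 0 < d) : 0 < sigmaMin (momentMatrix ν) := by
  refine RER.sigmaMin_pos hd fun x hx => h.nondegenerate x ?_
  have := inner_momentMatrix h.memLp x x
  rw [hx, inner_zero_right] at this
  simpa [pow_two] using this.symm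

lemma sigmaMin_le_trace (h : SubGaussianLaw C ν) (hd : 0 < d) :
    sigmaMin (momentMatrix ν) ≤ (momentMatrix ν).trace := by
  obtain ⟨e, g, h1, -, h3, -⟩ := exists_eigenbasis h.memLp
  rw [← h3]
  refine (h1 ⟨0, hd⟩).trans (Finset.single_le_sum (f := g) (fun i _ => ?_) (Finset.mem_univ _))
  exact (h.sigmaMin_pos hd).le.trans (h1 i)

/-- The squared norm of a sub-Gaussian vector has a dimension free exponential moment. -/
lemma lintegral_exp_norm_sq_le (h : SubGaussianLaw C ν) (hd : 0 < d) {l : ℝ} (hl : 0 ≤ l)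
    (hlC : l * C ≤ 1 / 4) :
    ∫⁻ z, ENNReal.ofReal (Real.exp (l * (‖z‖ ^ 2 / (momentMatrix ν).trace))) ∂ν ≤ 2 := by
  have := h.isProb
  set tr := (momentMatrix ν).trace with htr
  have htr0 : 0 < tr := h.trace_pos hd
  set w : Fin d → ℝ := fun i => momentMatrix ν i i / tr with hw
  have hw0 : ∀ i, 0 ≤ w i := fun i => (div_pos (h.diag_pos i) htr0).le
  have hw1 : ∑ i, w i = 1 := by
    rw [hw, ← Finset.sum_div]
    exact div_self htr0.ne'
  -- `‖z‖² / tr` is the average of `zᵢ² / Mᵢᵢ` with weights `Mᵢᵢ / tr`, where `M = momentMatrix ν`.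
  -- Jensen thus reduces to one coordinate without a dimensional factor.
  have h1 : ∀ z : Vec d, Real.exp (l * (‖z‖ ^ 2 / tr)) ≤
      ∑ i, w i * Real.exp (l / momentMatrix ν i i * z i ^ 2) := by
    intro z
    have := convexOn_exp.map_sum_le (t := Finset.univ) (w := w)
      (p := fun i => l / momentMatrix ν i i * z i ^ 2) (fun i _ => hw0 i) hw1
      (fun i _ => Set.mem_univ _)
    simp only [smul_eq_mul] at this
    refine le_trans (le_of_eq ?_) this
    congr 1
    rw [EuclideanSpace.real_norm_sq_eq, Finset.sum_div, Finset.mul_sum]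
    refine Finset.sum_congr rfl fun i _ => ?_
    have := (h.diag_pos i).ne'
    simp only [hw]
    field_simp
  have h2 : ∀ i : Fin d,
      ∫⁻ z, ENNReal.ofReal (Real.exp (l / momentMatrix ν i i * z i ^ 2)) ∂ν ≤ 2 := by
    intro i
    have hin : ∀ (t : ℝ) (z : Vec d),
        inner ℝ (EuclideanSpace.single i t) z = t * z i := fun t z => by
      simp [EuclideanSpace.inner_single_left]
    refine lintegral_exp_sq_le (v := C * momentMatrix ν i i) (by fun_prop)
      (div_nonneg hl (h.diag_pos i).le) ?_ (fun t => ?_) fun t => ?_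
    · have := (h.diag_pos i).ne'
      calc _ = l * C := by field_simp
        _ ≤ _ := hlC
    · simpa [hin] using h.integrable_exp (EuclideanSpace.single i t)
    · have := h.mgf_le (EuclideanSpace.single i t)
      simp_rw [hin, mul_pow] at this
      rw [integral_const_mul] at this
      refine this.trans (le_of_eq ?_)
      simp only [momentMatrix, Matrix.of_apply, pow_two]
      ring_nf
  calc _ ≤ ∫⁻ z, ∑ i, ENNReal.ofReal (w i) *
        ENNReal.ofReal (Real.exp (l / momentMatrix ν i i * z i ^ 2)) ∂ν := by
        refine lintegral_mono fun z => (ENNReal.ofReal_le_ofReal (h1 z)).trans (le_of_eq ?_)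
        rw [ENNReal.ofReal_sum_of_nonneg fun i _ => mul_nonneg (hw0 i) (Real.exp_pos _).le]
        exact Finset.sum_congr rfl fun i _ => ENNReal.ofReal_mul (hw0 i)
    _ = ∑ i, ENNReal.ofReal (w i) *
        ∫⁻ z, ENNReal.ofReal (Real.exp (l / momentMatrix ν i i * z i ^ 2)) ∂ν := by
        rw [lintegral_finsetSum _ fun i _ => by fun_prop]
        exact Finset.sum_congr rfl fun i _ => lintegral_const_mul _ (by fun_prop)
    _ ≤ ∑ i, ENNReal.ofReal (w i) * 2 := by gcongr with i; exact h2 i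
    _ = 2 := by
        rw [← Finset.sum_mul, ← ENNReal.ofReal_sum_of_nonneg fun i _ => hw0 i, hw1]
        simp

lemma integrable_exp_norm_sq (h : SubGaussianLaw C ν) (hd : 0 < d) {l : ℝ} (hl : 0 ≤ l)
    (hlC : l * C ≤ 1 / 4) :
    Integrable (fun z => Real.exp (l * (‖z‖ ^ 2 / (momentMatrix ν).trace))) ν := by
  refine ⟨by fun_prop, ?_⟩
  rw [hasFiniteIntegral_iff_ofReal (ae_of_all _ fun _ => (Real.exp_pos _).le)]
  exact (h.lintegral_exp_norm_sq_le hd hl hlC).trans_lt (by simp)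

lemma integral_exp_norm_sq_le (h : SubGaussianLaw C ν) (hd : 0 < d) {l : ℝ} (hl : 0 ≤ l)
    (hlC : l * C ≤ 1 / 4) :
    ∫ z, Real.exp (l * (‖z‖ ^ 2 / (momentMatrix ν).trace)) ∂ν ≤ 2 := by
  rw [integral_eq_lintegral_of_nonneg_ae (ae_of_all _ fun _ => (Real.exp_pos _).le) (by fun_prop)]
  exact ENNReal.toReal_le_of_le_ofReal (by norm_num)
    ((h.lintegral_exp_norm_sq_le hd hl hlC).trans (by simp))

lemma norm_pow_four_le (h : SubGaussianLaw C ν) (hd : 0 < d) {l : ℝ} (hl : 0 < l) (z : Vec d) :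
    ‖z‖ ^ 4 ≤ 2 * (momentMatrix ν).trace ^ 2 / l ^ 2 *
      Real.exp (l * (‖z‖ ^ 2 / (momentMatrix ν).trace)) := by
  have htr0 := h.trace_pos hd
  set tr := (momentMatrix ν).trace
  have h0 : 0 ≤ l * (‖z‖ ^ 2 / tr) := by positivity
  have h1 := Real.quadratic_le_exp_of_nonneg h0
  have h2 : (l * (‖z‖ ^ 2 / tr)) ^ 2 / 2 ≤ Real.exp (l * (‖z‖ ^ 2 / tr)) := by linarith
  calc ‖z‖ ^ 4 = 2 * tr ^ 2 / l ^ 2 * ((l * (‖z‖ ^ 2 / tr)) ^ 2 / 2) := by field_simp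
    _ ≤ _ := by gcongr

lemma integrable_norm_pow_four (h : SubGaussianLaw C ν) (hd : 0 < d) (hC : 0 < C) :
    Integrable (fun z : Vec d => ‖z‖ ^ 4) ν := by
  have hl : 0 < 1 / (4 * C) := by positivity
  refine ((h.integrable_exp_norm_sq hd hl.le (by field_simp; norm_num)).const_mul
    (2 * (momentMatrix ν).trace ^ 2 / (1 / (4 * C)) ^ 2)).mono' (by fun_prop)
    (ae_of_all _ fun z => ?_)
  rw [Real.norm_of_nonneg (by positivity)]
  exact h.norm_pow_four_le hd hl z

/-- `l = 1 / (4 C)` is the largest exponent allowed by the exponential moment; `64 C²` is `4 / l²`.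
-/
lemma fourthMoment_le (h : SubGaussianLaw C ν) (hd : 0 < d) (hC : 0 < C) :
    fourthMoment ν ≤ 64 * C ^ 2 * (momentMatrix ν).trace ^ 2 := by
  have hl : 0 < 1 / (4 * C) := by positivity
  have hlC : 1 / (4 * C) * C ≤ 1 / 4 := by field_simp; norm_num
  have htr0 := h.trace_pos hd
  calc fourthMoment ν ≤ ∫ z, 2 * (momentMatrix ν).trace ^ 2 / (1 / (4 * C)) ^ 2 *
        Real.exp (1 / (4 * C) * (‖z‖ ^ 2 / (momentMatrix ν).trace)) ∂ν :=
        integral_mono (h.integrable_norm_pow_four hd hC)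
          ((h.integrable_exp_norm_sq hd hl.le hlC).const_mul _) fun z => h.norm_pow_four_le hd hl z
    _ ≤ 2 * (momentMatrix ν).trace ^ 2 / (1 / (4 * C)) ^ 2 * 2 := by
        rw [integral_const_mul]
        exact mul_le_mul_of_nonneg_left (h.integral_exp_norm_sq_le hd hl.le hlC) (by positivity)
    _ = _ := by field_simp; norm_num

/-- Nonnegativity of the variance of `‖z‖²`. With `sigmaMin_le_trace` it makes the ratio in the
lower bound on `T` at least one. -/
lemma trace_le_sqrt_fourthMoment (h : SubGaussianLaw C ν) (hd : 0 < d) (hC : 0 < C) :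
    (momentMatrix ν).trace ≤ √(fourthMoment ν) := by
  have := h.isProb
  refine Real.le_sqrt_of_sq_le ?_
  rw [trace_momentMatrix h.memLp]
  have hs := integrable_norm_sq h.memLp
  set m := ∫ z : Vec d, ‖z‖ ^ 2 ∂ν
  have h0 : 0 ≤ ∫ z : Vec d, (‖z‖ ^ 2 - m) ^ 2 ∂ν := integral_nonneg fun _ => sq_nonneg _
  have h1 : ∀ z : Vec d, (‖z‖ ^ 2 - m) ^ 2 = ‖z‖ ^ 4 - 2 * m * ‖z‖ ^ 2 + m ^ 2 := fun z => by ring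
  simp_rw [h1] at h0
  have hsub : Integrable (fun z : Vec d => ‖z‖ ^ 4 - 2 * m * ‖z‖ ^ 2) ν :=
    (h.integrable_norm_pow_four hd hC).sub (hs.const_mul _)
  rw [integral_add hsub (integrable_const _),
    integral_sub (h.integrable_norm_pow_four hd hC) (hs.const_mul _),
    integral_const_mul, integral_const] at h0
  simp only [probReal_univ, smul_eq_mul, one_mul] at h0
  unfold fourthMoment
  nlinarith

/-- Chernoff's bound. At `r = C_R log T` it controls the chance that a sample violates the threshold
`R`. -/
lemma measureReal_norm_sq_gt_le (h : SubGaussianLaw C ν) (hd : 0 < d) {l : ℝ} (hl : 0 < l)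
    (hlC : l * C ≤ 1 / 4) (r : ℝ) :
    ν.real {z | r * (momentMatrix ν).trace < ‖z‖ ^ 2} ≤ 2 * Real.exp (-(l * r)) := by
  have := h.isProb
  have htr0 := h.trace_pos hd
  set tr := (momentMatrix ν).trace
  have hm : MeasurableSet {z : Vec d | r * tr < ‖z‖ ^ 2} :=
    measurableSet_lt measurable_const (by fun_prop)
  rw [← integral_indicator_one hm]
  calc _ ≤ ∫ z, Real.exp (-(l * r)) * Real.exp (l * (‖z‖ ^ 2 / tr)) ∂ν := by
        refine integral_mono ((integrable_const 1).indicator hm)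
          ((h.integrable_exp_norm_sq hd hl.le hlC).const_mul _) fun z => ?_
        by_cases hz : z ∈ {z : Vec d | r * tr < ‖z‖ ^ 2}
        · rw [Set.indicator_of_mem hz, ← Real.exp_add]
          have : r ≤ ‖z‖ ^ 2 / tr := (le_div_iff₀ htr0).2 (le_of_lt hz)
          refine Real.one_le_exp ?_
          nlinarith
        · rw [Set.indicator_of_notMem hz]; positivity
    _ ≤ _ := by
        rw [integral_const_mul, mul_comm]
        exact mul_le_mul_of_nonneg_right (h.integral_exp_norm_sq_le hd hl.le hlC) (by positivity)

/-- Half of the exponent pays for the factor `‖z‖²`, the other half for the tail. This bounds the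
second moment lost by truncation. -/
lemma integral_indicator_norm_sq_le (h : SubGaussianLaw C ν) (hd : 0 < d) {l : ℝ} (hl : 0 < l)
    (hlC : l * C ≤ 1 / 4) (r : ℝ) :
    ∫ z, {z : Vec d | r * (momentMatrix ν).trace < ‖z‖ ^ 2}.indicator (fun z => ‖z‖ ^ 2) z ∂ν ≤
      4 / l * (momentMatrix ν).trace * Real.exp (-(l * r / 2)) := by
  have := h.isProb
  have htr0 := h.trace_pos hd
  set tr := (momentMatrix ν).trace
  have hm : MeasurableSet {z : Vec d | r * tr < ‖z‖ ^ 2} :=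
    measurableSet_lt measurable_const (by fun_prop)
  calc _ ≤ ∫ z, 2 / l * tr * Real.exp (-(l * r / 2)) * Real.exp (l * (‖z‖ ^ 2 / tr)) ∂ν := by
        refine integral_mono ((integrable_norm_sq h.memLp).indicator hm)
          ((h.integrable_exp_norm_sq hd hl.le hlC).const_mul _) fun z => ?_
        by_cases hz : z ∈ {z : Vec d | r * tr < ‖z‖ ^ 2}
        · rw [Set.indicator_of_mem hz, mul_assoc, ← Real.exp_add]
          have h1 : r ≤ ‖z‖ ^ 2 / tr := (le_div_iff₀ htr0).2 (le_of_lt hz)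
          have h2 : l * (‖z‖ ^ 2 / tr) / 2 ≤
              Real.exp (-(l * r / 2) + l * (‖z‖ ^ 2 / tr)) := by
            have := Real.add_one_le_exp (l * (‖z‖ ^ 2 / tr) / 2)
            refine (by linarith : _ ≤ Real.exp (l * (‖z‖ ^ 2 / tr) / 2)).trans
              (Real.exp_le_exp.2 ?_)
            nlinarith
          calc ‖z‖ ^ 2 = 2 / l * tr * (l * (‖z‖ ^ 2 / tr) / 2) := by field_simp
            _ ≤ _ := by gcongr
        · rw [Set.indicator_of_notMem hz]; positivity
    _ ≤ 2 / l * tr * Real.exp (-(l * r / 2)) * 2 := by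
        rw [integral_const_mul]
        exact mul_le_mul_of_nonneg_left (h.integral_exp_norm_sq_le hd hl.le hlC) (by positivity)
    _ = _ := by ring

end SubGaussianLaw

end RER

/-! ### The stationary law: sub-Gaussian tails, Lyapunov equation, excess loss. -/

namespace RER

variable {d : ℕ} {C : ℝ} {A : Op d} {μ π : Measure (Vec d)}

lemma norm_pow_op_le (N : Op d) (k : ℕ) : ‖N ^ k‖ ≤ ‖N‖ ^ k := by
  induction k with
  | zero => rw [pow_zero, pow_zero]; exact ContinuousLinearMap.norm_id_le
  | succ k ih =>
    rw [pow_succ, pow_succ]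
    exact (norm_mul_le _ _).trans (by gcongr)

lemma IsNoiseLaw.subGaussianLaw (h : IsNoiseLaw C μ) (hC : 0 < C) : SubGaussianLaw C μ := by
  have := h.isProb
  have hmem : MemLp (fun x : Vec d => x) 2 μ := by
    rw [memLp_piLp_iff]
    intro i
    simpa [EuclideanSpace.inner_single_left] using
      (h.subGaussian (EuclideanSpace.single i (1 : ℝ))).memLp 2
  have hsq : ∀ x : Vec d, inner ℝ x (Matrix.toEuclideanLin (momentMatrix μ) x) =
      ∫ z, inner ℝ x z ^ 2 ∂μ := fun x => by
    rw [inner_momentMatrix hmem]; simp_rw [pow_two]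
  refine ⟨h.isProb, hmem, fun x => by simpa using (h.subGaussian x).integrable_exp_mul 1,
    fun x => ?_, fun x hx => ?_⟩
  · have h1 := (h.subGaussian x).mgf_le 1
    rw [mgf, hsq, Real.coe_toNNReal _ (mul_nonneg hC.le (integral_nonneg fun _ => sq_nonneg _))]
      at h1
    simp only [one_mul, one_pow, mul_one] at h1
    refine h1.trans (le_of_eq ?_)
    ring_nf
  -- A vanishing second moment forces `⟨x, z⟩ = 0` almost surely, so `x` lies in the kernel of the
  -- moment matrix, which is trivial by full rank.
  · have h0 : (fun z : Vec d => inner ℝ x z ^ 2) =ᵐ[μ] 0 :=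
      (integral_eq_zero_iff_of_nonneg (fun _ => sq_nonneg _)
        (memLp_inner hmem x).integrable_sq).1 hx
    have h1 : Matrix.toEuclideanLin (momentMatrix μ) x = 0 := by
      refine ext_inner_left ℝ fun y => ?_
      rw [inner_momentMatrix hmem, inner_zero_right]
      refine integral_eq_zero_of_ae ?_
      filter_upwards [h0] with z hz
      have : inner ℝ x z = (0 : ℝ) := by simpa using hz
      simp [this]
    have h2 : Function.Injective (Matrix.toEuclideanLin (momentMatrix μ)) := by
      rw [← LinearMap.ker_eq_bot, LinearMap.ker_eq_bot_iff_range_eq_top]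
      refine Submodule.eq_top_of_finrank_eq ?_
      rw [finrank_euclideanSpace_fin]
      exact (Matrix.rank_eq_finrank_range_toLin (momentMatrix μ)
        (PiLp.basisFun 2 ℝ (Fin d)) (PiLp.basisFun 2 ℝ (Fin d))).symm.trans h.full_rank
    exact h2 (by rw [h1, map_zero])

lemma IsNoiseLaw.integral_inner_eq_zero (h : IsNoiseLaw C μ) (hC : 0 < C) (x : Vec d) :
    ∫ z, inner ℝ x z ∂μ = 0 := by
  have := h.isProb
  rw [integral_inner ((IsNoiseLaw.subGaussianLaw h hC).memLp.integrable (by norm_num)), h.mean_zero,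
    inner_zero_right]

lemma IsStationaryLaw.integral_eq (hπ : IsStationaryLaw A μ π) {f : Vec d → ℝ}
    (hf : Measurable f) : ∫ z, f z ∂π = ∫ p : Vec d × Vec d, f (A p.1 + p.2) ∂π.prod μ := by
  conv_lhs => rw [← hπ.invariant]
  exact integral_map (by fun_prop) hf.aestronglyMeasurable

lemma integral_inner_sq_le (hν : MemLp (fun x : Vec d => x) 2 μ) (x : Vec d) :
    ∫ z, inner ℝ x z ^ 2 ∂μ ≤ (momentMatrix μ).trace * ‖x‖ ^ 2 := by
  rw [trace_momentMatrix hν, ← integral_mul_const]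
  refine integral_mono (memLp_inner hν x).integrable_sq ((integrable_norm_sq hν).mul_const _)
    fun z => ?_
  have := abs_real_inner_le_norm x z
  calc inner ℝ x z ^ 2 = |inner ℝ x z| ^ 2 := (sq_abs _).symm
    _ ≤ (‖x‖ * ‖z‖) ^ 2 := by gcongr
    _ = _ := by ring

section MGF

/-- A state of law `π` is `A y + e` with fresh noise `e`, and averaging a capped exponential over
`e` gives at most the capped average. The cap `K` keeps all integrals finite before any moment of
`π` is known. -/
lemma integral_min_exp_le (hμ : SubGaussianLaw C μ) (hπ : IsStationaryLaw A μ π) {K : ℝ}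
    (hK : 0 ≤ K) (x : Vec d) (c : ℝ) :
    ∫ z, min (Real.exp (inner ℝ x z + c)) K ∂π ≤
      ∫ z, min (Real.exp (inner ℝ (ContinuousLinearMap.adjoint A x) z +
        (c + C / 2 * ∫ z, inner ℝ x z ^ 2 ∂μ))) K ∂π := by
  have := hπ.isProb
  have := hμ.isProb
  have hbd : ∀ s : ℝ, ‖min (Real.exp s) K‖ ≤ K := fun s => by
    rw [Real.norm_of_nonneg (le_min (Real.exp_pos _).le hK)]; exact min_le_right _ _
  rw [IsStationaryLaw.integral_eq hπ (by fun_prop), integral_prod _ (Integrable.of_bound (by fun_prop) K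
    (ae_of_all _ fun _ => hbd _))]
  refine integral_mono_of_nonneg (ae_of_all _ fun z => integral_nonneg fun e =>
    le_min (Real.exp_pos _).le hK) (Integrable.of_bound (by fun_prop) K
    (ae_of_all _ fun _ => hbd _)) (ae_of_all _ fun y => ?_)
  refine le_min ?_ ?_
  · have h1 : ∀ e, Real.exp (inner ℝ x (A y + e) + c) =
        Real.exp (inner ℝ (ContinuousLinearMap.adjoint A x) y + c) * Real.exp (inner ℝ x e) := by
      intro e
      rw [← Real.exp_add, ContinuousLinearMap.adjoint_inner_left, inner_add_right]
      ring_nf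
    calc ∫ e, min (Real.exp (inner ℝ x (A y + e) + c)) K ∂μ
        ≤ ∫ e, Real.exp (inner ℝ (ContinuousLinearMap.adjoint A x) y + c) *
            Real.exp (inner ℝ x e) ∂μ := by
          refine integral_mono (Integrable.of_bound (by fun_prop) K
            (ae_of_all _ fun _ => hbd _)) ((hμ.integrable_exp x).const_mul _) fun e => ?_
          rw [← h1]; exact min_le_left _ _
      _ ≤ Real.exp (inner ℝ (ContinuousLinearMap.adjoint A x) y + c) *
            Real.exp (C / 2 * ∫ z, inner ℝ x z ^ 2 ∂μ) := by
          rw [integral_const_mul]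
          exact mul_le_mul_of_nonneg_left (hμ.mgf_le x) (Real.exp_pos _).le
      _ = _ := by rw [← Real.exp_add]; ring_nf
  · calc _ ≤ ∫ _e : Vec d, K ∂μ := integral_mono (Integrable.of_bound (by fun_prop) K
            (ae_of_all _ fun _ => hbd _)) (integrable_const _) fun _ => min_le_right _ _
      _ = K := by simp

lemma integral_min_exp_le_iterate (hμ : SubGaussianLaw C μ) (hπ : IsStationaryLaw A μ π) {K : ℝ}
    (hK : 0 ≤ K) (x : Vec d) (n : ℕ) :
    ∫ z, min (Real.exp (inner ℝ x z)) K ∂π ≤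
      ∫ z, min (Real.exp (inner ℝ ((ContinuousLinearMap.adjoint A ^ n) x) z + C / 2 *
        ∑ k ∈ Finset.range n, ∫ z, inner ℝ ((ContinuousLinearMap.adjoint A ^ k) x) z ^ 2 ∂μ))
        K ∂π := by
  induction n with
  | zero => simp
  | succ n ih =>
    refine ih.trans ((integral_min_exp_le hμ hπ hK _ _).trans (le_of_eq ?_))
    rw [Finset.sum_range_succ, mul_add, pow_succ']
    rfl

/-- Iterated invariance moves the linear form to `(A*)ⁿ x → 0`, while the exponent collected on the
way stays below `C s / 2`. Dominated convergence applies at a fixed cap, then monotone convergence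
as the cap grows. -/
lemma mgf_le_of_forall_sum_le (hC : 0 ≤ C) (hμ : SubGaussianLaw C μ) (hA : ‖A‖ < 1)
    (hπ : IsStationaryLaw A μ π) (x : Vec d) {s : ℝ}
    (hs : ∀ n, ∑ k ∈ Finset.range n,
      ∫ z, inner ℝ ((ContinuousLinearMap.adjoint A ^ k) x) z ^ 2 ∂μ ≤ s) :
    Integrable (fun z => Real.exp (inner ℝ x z)) π ∧
      ∫ z, Real.exp (inner ℝ x z) ∂π ≤ Real.exp (C / 2 * s) := by
  have := hπ.isProb
  have hbd : ∀ K : ℝ, 0 ≤ K → ∀ s : ℝ, ‖min (Real.exp s) K‖ ≤ K := fun K hK s => by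
    rw [Real.norm_of_nonneg (le_min (Real.exp_pos _).le hK)]; exact min_le_right _ _
  have hlim : Tendsto (fun n : ℕ => (ContinuousLinearMap.adjoint A ^ n) x) atTop (nhds 0) := by
    refine squeeze_zero_norm (a := fun n => ‖A‖ ^ n * ‖x‖) (fun n => ?_) ?_
    · refine (ContinuousLinearMap.le_opNorm _ _).trans ?_
      gcongr
      refine (norm_pow_op_le _ _).trans (le_of_eq ?_)
      rw [LinearIsometryEquiv.norm_map]
    · simpa using (tendsto_pow_atTop_nhds_zero_of_lt_one (norm_nonneg _) hA).mul_const ‖x‖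
  have h1 : ∀ K : ℝ, 0 ≤ K → ∫ z, min (Real.exp (inner ℝ x z)) K ∂π ≤ Real.exp (C / 2 * s) := by
    intro K hK
    have h2 : ∀ n : ℕ, ∫ z, min (Real.exp (inner ℝ x z)) K ∂π ≤
        ∫ z, min (Real.exp (inner ℝ ((ContinuousLinearMap.adjoint A ^ n) x) z + C / 2 * s))
          K ∂π := by
      intro n
      refine (integral_min_exp_le_iterate hμ hπ hK x n).trans ?_
      refine integral_mono (Integrable.of_bound (by fun_prop) K (ae_of_all _ fun _ => hbd K hK _))
        (Integrable.of_bound (by fun_prop) K (ae_of_all _ fun _ => hbd K hK _)) fun z => ?_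
      have := hs n
      dsimp only
      gcongr
    have h3 : Tendsto (fun n : ℕ => ∫ z, min (Real.exp (inner ℝ
        ((ContinuousLinearMap.adjoint A ^ n) x) z + C / 2 * s)) K ∂π) atTop
        (nhds (∫ _z : Vec d, min (Real.exp (0 + C / 2 * s)) K ∂π)) := by
      refine tendsto_integral_of_dominated_convergence (fun _ => K) (fun n => by fun_prop)
        (integrable_const _) (fun n => ae_of_all _ fun _ => hbd K hK _) (ae_of_all _ fun z => ?_)
      have : Tendsto (fun n : ℕ => inner ℝ ((ContinuousLinearMap.adjoint A ^ n) x) z) atTop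
          (nhds (0 : ℝ)) := by
        simpa using hlim.inner (tendsto_const_nhds (x := z))
      exact ((Real.continuous_exp.tendsto _).comp (this.add_const _)).min tendsto_const_nhds
    refine (ge_of_tendsto' h3 h2).trans ?_
    simp
  have h4 : ∫⁻ z, ENNReal.ofReal (Real.exp (inner ℝ x z)) ∂π ≤
      ENNReal.ofReal (Real.exp (C / 2 * s)) := by
    calc _ ≤ ∫⁻ z, ⨆ n : ℕ, ENNReal.ofReal (min (Real.exp (inner ℝ x z)) n) ∂π := by
          refine lintegral_mono fun z => ?_
          obtain ⟨n, hn⟩ := exists_nat_ge (Real.exp (inner ℝ x z))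
          refine le_iSup_of_le n ?_
          rw [min_eq_left hn]
      _ = ⨆ n : ℕ, ∫⁻ z, ENNReal.ofReal (min (Real.exp (inner ℝ x z)) n) ∂π := by
          refine lintegral_iSup (fun n => by fun_prop) fun m n hmn z => ?_
          have : (m : ℝ) ≤ n := by exact_mod_cast hmn
          dsimp only
          gcongr
      _ ≤ _ := by
          refine iSup_le fun n => ?_
          rw [← ofReal_integral_eq_lintegral_ofReal (Integrable.of_bound (by fun_prop) n
            (ae_of_all _ fun _ => hbd n n.cast_nonneg _))
            (ae_of_all _ fun _ => le_min (Real.exp_pos _).le n.cast_nonneg)]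
          exact ENNReal.ofReal_le_ofReal (h1 n n.cast_nonneg)
  have h5 : Integrable (fun z => Real.exp (inner ℝ x z)) π := by
    refine ⟨by fun_prop, ?_⟩
    rw [hasFiniteIntegral_iff_ofReal (ae_of_all _ fun _ => (Real.exp_pos _).le)]
    exact h4.trans_lt ENNReal.ofReal_lt_top
  refine ⟨h5, ?_⟩
  rw [integral_eq_lintegral_of_nonneg_ae (ae_of_all _ fun _ => (Real.exp_pos _).le) (by fun_prop)]
  exact ENNReal.toReal_le_of_le_ofReal (Real.exp_pos _).le h4

end MGF

section Stationary

/-- Only finiteness matters here, so a geometric series bounds the noise variances. The sharp proxy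
must wait until the Lyapunov equation makes sense. -/
lemma memLp_of_stationary (hC : 0 ≤ C) (hμ : SubGaussianLaw C μ) (hA : ‖A‖ < 1)
    (hπ : IsStationaryLaw A μ π) : MemLp (fun x : Vec d => x) 2 π := by
  have hexp : ∀ x : Vec d, Integrable (fun z => Real.exp (inner ℝ x z)) π := by
    intro x
    refine (mgf_le_of_forall_sum_le (s := (momentMatrix μ).trace * ‖x‖ ^ 2 * (1 - ‖A‖ ^ 2)⁻¹)
      hC hμ hA hπ x fun n => ?_).1
    have hA2 : ‖A‖ ^ 2 < 1 := pow_lt_one₀ (norm_nonneg _) hA (by norm_num)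
    have ht : 0 ≤ (momentMatrix μ).trace := trace_momentMatrix_nonneg
    calc _ ≤ ∑ k ∈ Finset.range n, (momentMatrix μ).trace * ‖x‖ ^ 2 * (‖A‖ ^ 2) ^ k := by
          refine Finset.sum_le_sum fun k _ => (integral_inner_sq_le hμ.memLp _).trans ?_
          have : ‖(ContinuousLinearMap.adjoint A ^ k) x‖ ≤ ‖A‖ ^ k * ‖x‖ := by
            refine (ContinuousLinearMap.le_opNorm _ _).trans ?_
            gcongr
            refine (norm_pow_op_le _ _).trans (le_of_eq ?_)
            rw [LinearIsometryEquiv.norm_map]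
          calc _ ≤ (momentMatrix μ).trace * (‖A‖ ^ k * ‖x‖) ^ 2 := by gcongr
            _ = _ := by ring
      _ ≤ _ := by
          rw [← Finset.mul_sum]
          refine mul_le_mul_of_nonneg_left ?_ (by positivity)
          exact (Summable.sum_le_tsum _ (fun _ _ => by positivity)
            (summable_geometric_of_lt_one (by positivity) hA2)).trans
            (tsum_geometric_of_lt_one (by positivity) hA2).le
  rw [memLp_piLp_iff]
  intro i
  rw [memLp_two_iff_integrable_sq (by fun_prop)]
  refine (((hexp (EuclideanSpace.single i (1 : ℝ))).add
    (hexp (EuclideanSpace.single i (-1 : ℝ)))).const_mul 2).mono' (by fun_prop)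
    (ae_of_all _ fun z => ?_)
  have hin : ∀ (t : ℝ), inner ℝ (EuclideanSpace.single i t) z = t * z i := fun t => by
    simp [EuclideanSpace.inner_single_left]
  rw [Real.norm_of_nonneg (sq_nonneg _), Pi.add_apply, hin, hin, one_mul, neg_one_mul]
  rcases le_total 0 (z i) with h | h
  · have := Real.quadratic_le_exp_of_nonneg h
    have := Real.exp_pos (-z i)
    linarith
  · have := Real.quadratic_le_exp_of_nonneg (neg_nonneg.2 h)
    have := Real.exp_pos (z i)
    rw [neg_sq] at *
    linarith

/-- The stationary second moment solves the Lyapunov equation. -/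
lemma integral_inner_sq_stationary (hμ : MemLp (fun x : Vec d => x) 2 μ)
    (hμ' : IsProbabilityMeasure μ) (hμ0 : ∀ x, ∫ z, inner ℝ x z ∂μ = 0)
    (hπ2 : MemLp (fun x : Vec d => x) 2 π) (hπ : IsStationaryLaw A μ π) (x : Vec d) :
    ∫ z, inner ℝ x z ^ 2 ∂π =
      ∫ z, inner ℝ x z ^ 2 ∂μ + ∫ z, inner ℝ (ContinuousLinearMap.adjoint A x) z ^ 2 ∂π := by
  have := hπ.isProb
  rw [IsStationaryLaw.integral_eq hπ (by fun_prop)]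
  set y := ContinuousLinearMap.adjoint A x
  have h : ∀ p : Vec d × Vec d, inner ℝ x (A p.1 + p.2) ^ 2 =
      inner ℝ y p.1 ^ 2 + 2 * (inner ℝ y p.1 * inner ℝ x p.2) + inner ℝ x p.2 ^ 2 := by
    intro p
    rw [inner_add_right, ← ContinuousLinearMap.adjoint_inner_left]
    ring
  rw [integral_congr_ae (ae_of_all _ h)]
  have i1 : Integrable (fun p : Vec d × Vec d => inner ℝ y p.1 ^ 2) (π.prod μ) :=
    (memLp_inner hπ2 y).integrable_sq.comp_fst μ
  have i2 : Integrable (fun p : Vec d × Vec d => inner ℝ x p.2 ^ 2) (π.prod μ) :=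
    (memLp_inner hμ x).integrable_sq.comp_snd π
  have i3 : Integrable (fun p : Vec d × Vec d => 2 * (inner ℝ y p.1 * inner ℝ x p.2))
      (π.prod μ) :=
    (((memLp_inner hπ2 y).integrable (by norm_num)).mul_prod
      ((memLp_inner hμ x).integrable (by norm_num))).const_mul 2
  have i13 : Integrable (fun p : Vec d × Vec d => inner ℝ y p.1 ^ 2 +
    2 * (inner ℝ y p.1 * inner ℝ x p.2)) (π.prod μ) := i1.add i3
  rw [integral_add i13 i2, integral_add i1 i3, integral_const_mul,
    integral_prod_mul (fun a => inner ℝ y a) (fun b => inner ℝ x b), hμ0,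
    integral_fun_fst (fun a => inner ℝ y a ^ 2), integral_fun_snd (fun a => inner ℝ x a ^ 2)]
  simp
  ring

lemma integral_inner_sq_stationary_iterate (hμ : MemLp (fun x : Vec d => x) 2 μ)
    (hμ' : IsProbabilityMeasure μ) (hμ0 : ∀ x, ∫ z, inner ℝ x z ∂μ = 0)
    (hπ2 : MemLp (fun x : Vec d => x) 2 π) (hπ : IsStationaryLaw A μ π) (x : Vec d) (n : ℕ) :
    ∫ z, inner ℝ x z ^ 2 ∂π =
      ∑ k ∈ Finset.range n, ∫ z, inner ℝ ((ContinuousLinearMap.adjoint A ^ k) x) z ^ 2 ∂μ +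
        ∫ z, inner ℝ ((ContinuousLinearMap.adjoint A ^ n) x) z ^ 2 ∂π := by
  induction n with
  | zero => simp
  | succ n ih =>
    rw [ih, Finset.sum_range_succ, add_assoc,
      integral_inner_sq_stationary hμ hμ' hμ0 hπ2 hπ ((ContinuousLinearMap.adjoint A ^ n) x),
      pow_succ']
    rfl

/-- The noise variances collected along the iteration are partial sums of the Lyapunov series, hence
at most the stationary variance. So `π` inherits the constant of `μ`, with no loss as `‖A‖`
approaches one. -/
lemma IsStationaryLaw.subGaussianLaw (hC : 0 < C) (hμ : IsNoiseLaw C μ) (hA : ‖A‖ < 1)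
    (hπ : IsStationaryLaw A μ π) : SubGaussianLaw C π := by
  have hμs := IsNoiseLaw.subGaussianLaw hμ hC
  have hπ2 := memLp_of_stationary hC.le hμs hA hπ
  have hmgf : ∀ x : Vec d, _ := fun x =>
    mgf_le_of_forall_sum_le (s := ∫ z, inner ℝ x z ^ 2 ∂π) hC.le hμs hA hπ x fun n => by
      rw [integral_inner_sq_stationary_iterate hμs.memLp hμ.isProb
        (IsNoiseLaw.integral_inner_eq_zero hμ hC) hπ2 hπ x n]
      exact le_add_of_nonneg_right (integral_nonneg fun _ => sq_nonneg _)
  refine ⟨hπ.isProb, hπ2, fun x => (hmgf x).1, fun x => (hmgf x).2, fun x hx => ?_⟩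
  rw [integral_inner_sq_stationary hμs.memLp hμ.isProb
    (IsNoiseLaw.integral_inner_eq_zero hμ hC) hπ2 hπ x] at hx
  refine hμs.nondegenerate x (le_antisymm ?_ (integral_nonneg fun _ => sq_nonneg _))
  have : 0 ≤ ∫ z, inner ℝ (ContinuousLinearMap.adjoint A x) z ^ 2 ∂π :=
    integral_nonneg fun _ => sq_nonneg _
  linarith

lemma integral_norm_sq_apply_le (hν : MemLp (fun x : Vec d => x) 2 μ) (N : Op d) :
    ∫ z, ‖N z‖ ^ 2 ∂μ ≤ ‖N‖ ^ 2 * (momentMatrix μ).trace := by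
  rw [trace_momentMatrix hν, ← integral_const_mul]
  refine integral_mono_of_nonneg (ae_of_all _ fun _ => sq_nonneg _)
    ((integrable_norm_sq hν).const_mul _) (ae_of_all _ fun z => ?_)
  dsimp only
  rw [← mul_pow]
  gcongr
  exact N.le_opNorm z

lemma sum_integral_inner_adjoint_sq (hν : MemLp (fun x : Vec d => x) 2 μ) (N : Op d) :
    ∑ i : Fin d, ∫ z, inner ℝ (ContinuousLinearMap.adjoint N
      (EuclideanSpace.basisFun (Fin d) ℝ i)) z ^ 2 ∂μ = ∫ z, ‖N z‖ ^ 2 ∂μ := by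
  rw [← integral_finsetSum _ fun i _ => (memLp_inner hν _).integrable_sq]
  refine integral_congr_ae (ae_of_all _ fun z => ?_)
  dsimp only
  rw [← (EuclideanSpace.basisFun (Fin d) ℝ).sum_sq_inner_right]
  exact Finset.sum_congr rfl fun i _ => by rw [ContinuousLinearMap.adjoint_inner_left]

/-- The stationary variance over `n` steps: noise plus what is left of the initial state. -/
lemma trace_stationary_le (hC : 0 < C) (hμ : IsNoiseLaw C μ) (hA : ‖A‖ < 1)
    (hπ : IsStationaryLaw A μ π) (n : ℕ) :
    (momentMatrix π).trace ≤
      n * (momentMatrix μ).trace + ‖A ^ n‖ ^ 2 * (momentMatrix π).trace := by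
  have hμs := IsNoiseLaw.subGaussianLaw hμ hC
  have hπs := IsStationaryLaw.subGaussianLaw hC hμ hA hπ
  have hadj : ∀ k, ContinuousLinearMap.adjoint A ^ k = ContinuousLinearMap.adjoint (A ^ k) :=
    fun k => (star_pow A k).symm
  have h := fun i : Fin d => integral_inner_sq_stationary_iterate hμs.memLp hμ.isProb
        (IsNoiseLaw.integral_inner_eq_zero hμ hC) hπs.memLp hπ
        (EuclideanSpace.basisFun (Fin d) ℝ i) n
  simp_rw [hadj] at h
  have h0 := sum_integral_inner_adjoint_sq hπs.memLp (1 : Op d)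
  have hone : ContinuousLinearMap.adjoint (1 : Op d) = 1 := star_one _
  simp only [hone, one_apply_eq_self] at h0
  have key : (momentMatrix π).trace =
      ∑ k ∈ Finset.range n, ∫ z, ‖(A ^ k) z‖ ^ 2 ∂μ + ∫ z, ‖(A ^ n) z‖ ^ 2 ∂π := by
    rw [trace_momentMatrix hπs.memLp, ← h0]
    simp_rw [h]
    rw [Finset.sum_add_distrib, Finset.sum_comm, sum_integral_inner_adjoint_sq hπs.memLp]
    simp_rw [sum_integral_inner_adjoint_sq hμs.memLp]
  refine key.le.trans (add_le_add ?_ ?_)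
  · calc _ ≤ ∑ _k ∈ Finset.range n, (momentMatrix μ).trace := by
          refine Finset.sum_le_sum fun k _ => (integral_norm_sq_apply_le hμs.memLp _).trans ?_
          refine mul_le_of_le_one_left trace_momentMatrix_nonneg ?_
          refine pow_le_one₀ (norm_nonneg _) ?_
          exact (norm_pow_op_le _ _).trans (pow_le_one₀ (norm_nonneg _) hA.le)
      _ = _ := by simp
  · exact integral_norm_sq_apply_le hπs.memLp _

lemma trace_noise_le_trace_stationary (hC : 0 < C) (hμ : IsNoiseLaw C μ) (hA : ‖A‖ < 1)
    (hπ : IsStationaryLaw A μ π) : (momentMatrix μ).trace ≤ (momentMatrix π).trace := by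
  have hμs := IsNoiseLaw.subGaussianLaw hμ hC
  have hπs := IsStationaryLaw.subGaussianLaw hC hμ hA hπ
  refine Finset.sum_le_sum fun i _ => ?_
  have h := integral_inner_sq_stationary hμs.memLp hμ.isProb
    (IsNoiseLaw.integral_inner_eq_zero hμ hC) hπs.memLp hπ (EuclideanSpace.single i (1 : ℝ))
  have h0 : 0 ≤ ∫ z, inner ℝ (ContinuousLinearMap.adjoint A
    (EuclideanSpace.single i (1 : ℝ))) z ^ 2 ∂π := integral_nonneg fun _ => sq_nonneg _
  simp only [EuclideanSpace.inner_single_left, conj_trivial, one_mul] at h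
  simp only [Matrix.diag_apply, momentMatrix, Matrix.of_apply, ← pow_two]
  linarith

/-- The excess prediction loss is the squared error weighted by the stationary second moment. -/
lemma predLoss_eq (hC : 0 < C) (hμ : IsNoiseLaw C μ) (hA : ‖A‖ < 1)
    (hπ : IsStationaryLaw A μ π) (M : Op d) :
    predLoss A μ π M = (momentMatrix μ).trace + ∫ z, ‖(M - A) z‖ ^ 2 ∂π := by
  have hμs := IsNoiseLaw.subGaussianLaw hμ hC
  have hπs := IsStationaryLaw.subGaussianLaw hC hμ hA hπ
  have := hπ.isProb
  have := hμ.isProb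
  have h : ∀ p : Vec d × Vec d, ‖(A p.1 + p.2) - M p.1‖ ^ 2 =
      ‖(M - A) p.1‖ ^ 2 - 2 * inner ℝ ((M - A) p.1) p.2 + ‖p.2‖ ^ 2 := by
    intro p
    have e : (A p.1 + p.2) - M p.1 = -((M - A) p.1 - p.2) := by
      rw [sub_apply]; abel
    rw [e, norm_neg, norm_sub_sq_real]
  have hM : MemLp (fun z => (M - A) z) 2 π := (M - A).comp_memLp' hπs.memLp
  have i1 : Integrable (fun p : Vec d × Vec d => ‖(M - A) p.1‖ ^ 2) (π.prod μ) :=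
    Integrable.comp_fst (f := fun a => ‖(M - A) a‖ ^ 2) (hM.integrable_norm_pow (by norm_num)) μ
  have i2 : Integrable (fun p : Vec d × Vec d => ‖p.2‖ ^ 2) (π.prod μ) :=
    Integrable.comp_snd (f := fun a : Vec d => ‖a‖ ^ 2) (integrable_norm_sq hμs.memLp) π
  have i3 : Integrable (fun p : Vec d × Vec d => inner ℝ ((M - A) p.1) p.2) (π.prod μ) := by
    refine ((hM.integrable (by norm_num)).norm.mul_prod
      (hμs.memLp.integrable (by norm_num)).norm).mono' (by fun_prop) (ae_of_all _ fun p => ?_)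
    exact norm_inner_le_norm _ _
  have i13 : Integrable (fun p : Vec d × Vec d => ‖(M - A) p.1‖ ^ 2 -
    2 * inner ℝ ((M - A) p.1) p.2) (π.prod μ) := i1.sub (i3.const_mul 2)
  unfold predLoss
  rw [integral_congr_ae (ae_of_all _ h), integral_add i13 i2, integral_sub i1 (i3.const_mul 2),
    integral_const_mul, integral_prod _ i3]
  simp_rw [IsNoiseLaw.integral_inner_eq_zero hμ hC]
  rw [integral_fun_fst (fun a => ‖(M - A) a‖ ^ 2), integral_fun_snd (fun a : Vec d => ‖a‖ ^ 2),
    trace_momentMatrix hμs.memLp]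
  simp
  ring

end Stationary

end RER

namespace RER

/-! ### Integrating out one coordinate of an infinite product. -/

section ProductMeasure

variable {ι : Type*} {𝓧 : ι → Type*} [∀ i, MeasurableSpace (𝓧 i)] {ν : (i : ι) → Measure (𝓧 i)}
  [∀ i, IsProbabilityMeasure (ν i)] {γ : Type*} [MeasurableSpace γ]

/-- On a product space, a function of finitely many coordinates is independent of any other
coordinate. -/
lemma indepFun_eval_of_dependsOn {f : (∀ i, 𝓧 i) → γ} (hf : Measurable f) {s : Finset ι}
    (hfs : DependsOn f s) {i : ι} (hi : i ∉ s) :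
    IndepFun f (fun ω => ω i) (Measure.infinitePi ν) := by
  classical
  have hne : ∀ j, Nonempty (𝓧 j) := fun j => nonempty_of_isProbabilityMeasure (ν j)
  let z : ∀ j, 𝓧 j := fun j => (hne j).some
  have h := (iIndepFun_infinitePi (P := ν) (X := fun _ x => x) (fun _ => measurable_id)).indepFun_finset
    s {i} (by simpa using hi) (fun j => measurable_pi_apply j)
  -- `f` factors through the restriction to `s`: the remaining coordinates are filled with arbitrary
  -- fixed points.
  let φ : (∀ j : s, 𝓧 j) → γ := fun y => f fun j => if hj : j ∈ s then y ⟨j, hj⟩ else z j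
  have hφ : Measurable φ := by
    refine hf.comp (measurable_pi_lambda _ fun j => ?_)
    by_cases hj : j ∈ s
    · simp only [hj, dif_pos]; exact measurable_pi_apply _
    · simp only [hj, dif_neg, not_false_eq_true]; exact measurable_const
  have hψ : Measurable fun y : (∀ j : ({i} : Finset ι), 𝓧 j) =>
      y ⟨i, Finset.mem_singleton_self i⟩ := measurable_pi_apply _
  have h2 := h.comp hφ hψ
  have e : (φ ∘ fun (ω : ∀ j, 𝓧 j) (j : s) => ω j) = f := by
    ext ω
    refine hfs fun j hj => ?_
    have : j ∈ s := hj
    simp [this]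
  rw [← e]
  exact h2

lemma map_prod_eval_of_dependsOn {f : (∀ i, 𝓧 i) → γ} (hf : Measurable f) {s : Finset ι}
    (hfs : DependsOn f s) {i : ι} (hi : i ∉ s) :
    (Measure.infinitePi ν).map (fun ω => (f ω, ω i)) =
      ((Measure.infinitePi ν).prod (ν i)).map (fun p => (f p.1, p.2)) := by
  rw [(indepFun_iff_map_prod_eq_prod_map_map hf.aemeasurable
    (measurable_pi_apply i).aemeasurable).1 (indepFun_eval_of_dependsOn hf hfs hi),
    Measure.infinitePi_map_eval]
  have := Measure.map_prod_map (Measure.infinitePi ν) (ν i) hf measurable_id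
  rw [Measure.map_id] at this
  exact this

variable {E : Type*} [NormedAddCommGroup E]

lemma integrable_dependsOn {f : (∀ i, 𝓧 i) → γ} (hf : Measurable f) {s : Finset ι}
    (hfs : DependsOn f s) {i : ι} (hi : i ∉ s) {G : γ × 𝓧 i → E} (hG : StronglyMeasurable G)
    (hint : Integrable (fun ω => G (f ω, ω i)) (Measure.infinitePi ν)) :
    Integrable (fun p : (∀ i, 𝓧 i) × 𝓧 i => G (f p.1, p.2))
      ((Measure.infinitePi ν).prod (ν i)) := by
  have h1 : Measurable fun ω : ∀ i, 𝓧 i => (f ω, ω i) := hf.prodMk (measurable_pi_apply i)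
  have h2 : Measurable fun p : (∀ i, 𝓧 i) × 𝓧 i => (f p.1, p.2) :=
    (hf.comp measurable_fst).prodMk measurable_snd
  have h3 := (integrable_map_measure hG.aestronglyMeasurable h1.aemeasurable).2 hint
  rw [map_prod_eval_of_dependsOn hf hfs hi] at h3
  exact (integrable_map_measure hG.aestronglyMeasurable h2.aemeasurable).1 h3

variable [NormedSpace ℝ E]

/-- Fubini on a product space: a coordinate can be integrated out before the others. -/
lemma integral_dependsOn {f : (∀ i, 𝓧 i) → γ} (hf : Measurable f) {s : Finset ι}
    (hfs : DependsOn f s) {i : ι} (hi : i ∉ s) {G : γ × 𝓧 i → E} (hG : StronglyMeasurable G)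
    (hint : Integrable (fun ω => G (f ω, ω i)) (Measure.infinitePi ν)) :
    ∫ ω, G (f ω, ω i) ∂Measure.infinitePi ν =
      ∫ ω, ∫ y, G (f ω, y) ∂ν i ∂Measure.infinitePi ν := by
  have h1 : Measurable fun ω : ∀ i, 𝓧 i => (f ω, ω i) := hf.prodMk (measurable_pi_apply i)
  have h2 : Measurable fun p : (∀ i, 𝓧 i) × 𝓧 i => (f p.1, p.2) :=
    (hf.comp measurable_fst).prodMk measurable_snd
  rw [← integral_map (f := G) h1.aemeasurable hG.aestronglyMeasurable,
    map_prod_eval_of_dependsOn hf hfs hi, integral_map h2.aemeasurable hG.aestronglyMeasurable,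
    integral_prod _ (integrable_dependsOn hf hfs hi hG hint)]

end ProductMeasure

/-! ### One buffer as a random block. -/

section Block

variable {d : ℕ}

/-- The state at time `j` of the system started at `x` and driven by the noise `e`. -/
noncomputable def traj (A : Op d) (x : Vec d) (e : ℕ → Vec d) : ℕ → Vec d
  | 0 => x
  | j + 1 => A (traj A x e j) + e j

/-- The randomness of one buffer: the initial state (`none`) and the noise sequence. -/
abbrev Block (d : ℕ) : Type := Option ℕ → Vec d

/-- The law of `Block d` with initial law `π` and i.i.d. noise of law `μ`. -/
noncomputable def blockLaw (μ π : Measure (Vec d)) : Measure (Block d) :=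
  Measure.infinitePi fun o : Option ℕ => o.elim π fun _ => μ

/-- The truncated used samples of a block. -/
noncomputable def blockState (A : Op d) (R : ℝ) (u : ℕ) (b : Block d) (k : ℕ) : Vec d :=
  clip (√R) (traj A (b none) (fun j => b (some j)) (u + k))

/-- The noise entering after the used samples of a block. -/
def blockNoise (u : ℕ) (b : Block d) (k : ℕ) : Vec d := b (some (u + k))

variable {μ π : Measure (Vec d)}

instance isProbabilityMeasure_option_elim [IsProbabilityMeasure μ] [IsProbabilityMeasure π]
    (o : Option ℕ) : IsProbabilityMeasure (o.elim π fun _ => μ) := by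
  cases o <;> assumption

instance [IsProbabilityMeasure μ] [IsProbabilityMeasure π] :
    IsProbabilityMeasure (blockLaw μ π) := by
  unfold blockLaw; infer_instance

lemma continuous_damp (γ : ℝ) : Continuous (damp γ : Vec d → Op d) := by
  have h : Continuous fun w : Vec d => InnerProductSpace.rankOne ℝ w w :=
    (InnerProductSpace.rankOne ℝ).continuous.clm_apply continuous_id
  exact continuous_const.sub (h.const_smul (2 * γ))

lemma measurable_bufH {α : Type*} [MeasurableSpace α] {γ : ℝ} {w : α → ℕ → Vec d}
    (hw : ∀ k, Measurable fun a => w a k) (B : ℕ) : Measurable fun a => bufH γ (w a) B := by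
  induction B with
  | zero => exact measurable_const
  | succ B ih => exact ((continuous_damp γ).measurable.comp (hw B)).mul ih

lemma measurable_bufZ {α : Type*} [MeasurableSpace α] {γ : ℝ} {w h : α → ℕ → Vec d}
    (hw : ∀ k, Measurable fun a => w a k) (hh : ∀ k, Measurable fun a => h a k) (B : ℕ) :
    Measurable fun a => bufZ γ (w a) (h a) B := by
  induction B with
  | zero => exact measurable_const
  | succ B ih =>
    have h1 : Continuous fun p : Vec d × Vec d => InnerProductSpace.rankOne ℝ p.1 p.2 :=
      ((InnerProductSpace.rankOne ℝ).continuous.comp continuous_fst).clm_apply continuous_snd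
    have h2 := (h1.measurable.comp ((hh B).prodMk (hw B))).const_smul (2 * γ)
    exact ih.add (h2.mul (measurable_bufH hw B))

lemma bufH_congr {γ : ℝ} {w w' : ℕ → Vec d} {B : ℕ} (h : ∀ k < B, w k = w' k) :
    bufH γ w B = bufH γ w' B := by
  induction B with
  | zero => rfl
  | succ B ih => rw [bufH, bufH, h B (by omega), ih fun k hk => h k (by omega)]

lemma bufZ_congr {γ : ℝ} {w w' e e' : ℕ → Vec d} {B : ℕ} (h : ∀ k < B, w k = w' k)
    (h' : ∀ k < B, e k = e' k) : bufZ γ w e B = bufZ γ w' e' B := by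
  induction B with
  | zero => rfl
  | succ B ih =>
    rw [bufZ, bufZ, h B (by omega), h' B (by omega),
      ih (fun k hk => h k (by omega)) fun k hk => h' k (by omega),
      bufH_congr fun k hk => h k (by omega)]

lemma traj_congr (A : Op d) {x x' : Vec d} {e e' : ℕ → Vec d} (hx : x = x') {j : ℕ}
    (h : ∀ k < j, e k = e' k) : traj A x e j = traj A x' e' j := by
  induction j with
  | zero => exact hx
  | succ j ih => rw [traj, traj, ih fun k hk => h k (by omega), h j (by omega)]

lemma traj_sub (A : Op d) (x x' : Vec d) (e : ℕ → Vec d) (j : ℕ) :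
    traj A x e j - traj A x' e j = (A ^ j) (x - x') := by
  induction j with
  | zero => rfl
  | succ j ih =>
    rw [traj, traj, add_sub_add_right_eq_sub, ← map_sub, ih, pow_succ']
    rfl

lemma traj_add (A : Op d) (x : Vec d) (e : ℕ → Vec d) (i j : ℕ) :
    traj A x e (i + j) = traj A (traj A x e i) (fun k => e (i + k)) j := by
  induction j with
  | zero => rfl
  | succ j ih => rw [← add_assoc, traj, ih]; rfl

lemma dependsOn_traj (A : Op d) (j : ℕ) :
    DependsOn (fun b : Block d => traj A (b none) (fun j => b (some j)) j)
      (Finset.insertNone (Finset.range j) : Finset (Option ℕ)) := fun b b' h =>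
  traj_congr A (h none (by simp)) fun k hk => h (some k) (by simpa using hk)

lemma measurable_traj (A : Op d) (j : ℕ) :
    Measurable (fun b : Block d => traj A (b none) (fun j => b (some j)) j) := by
  induction j with
  | zero => exact measurable_pi_apply _
  | succ j ih => exact (A.continuous.measurable.comp ih).add (measurable_pi_apply _)

lemma measurable_blockState (A : Op d) {R : ℝ} (hR : 0 < R) (u k : ℕ) :
    Measurable fun b : Block d => blockState A R u b k :=
  (continuous_clip (Real.sqrt_pos.2 hR)).measurable.comp (measurable_traj A _)

lemma measurable_blockNoise (u k : ℕ) : Measurable fun b : Block d => blockNoise u b k :=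
  measurable_pi_apply _

lemma norm_blockState_sq_le (A : Op d) {R : ℝ} (hR : 0 < R) (u : ℕ) (b : Block d) (k : ℕ) :
    ‖blockState A R u b k‖ ^ 2 ≤ R := by
  have := norm_clip_le (Real.sqrt_pos.2 hR) (traj A (b none) (fun j => b (some j)) (u + k))
  calc _ ≤ √R ^ 2 := pow_le_pow_left₀ (norm_nonneg _) this 2
    _ = R := Real.sq_sqrt hR.le

lemma blockState_congr (A : Op d) (R : ℝ) (u : ℕ) {b b' : Block d} {k : ℕ}
    (h : ∀ o ∈ (Finset.insertNone (Finset.range (u + k)) : Finset (Option ℕ)), b o = b' o) :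
    blockState A R u b k = blockState A R u b' k :=
  congrArg (clip (√R)) (dependsOn_traj A (u + k) h)

section Law

variable [IsProbabilityMeasure μ] [IsProbabilityMeasure π] {A : Op d}

lemma map_blockLaw_none : (blockLaw μ π).map (fun b => b none) = π :=
  Measure.infinitePi_map_eval _ _

lemma map_blockLaw_some (k : ℕ) : (blockLaw μ π).map (fun b => b (some k)) = μ :=
  Measure.infinitePi_map_eval (μ := fun o : Option ℕ => o.elim π fun _ => μ) (some k)

lemma map_traj (hπ : IsStationaryLaw A μ π) (j : ℕ) :
    (blockLaw μ π).map (fun b => traj A (b none) (fun j => b (some j)) j) = π := by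
  induction j with
  | zero => exact map_blockLaw_none
  | succ j ih =>
    have h1 := map_prod_eval_of_dependsOn (ν := fun o : Option ℕ => o.elim π fun _ => μ)
      (measurable_traj A j) (dependsOn_traj A j) (i := some j) (by simp)
    have h2 := Measure.map_prod_map (blockLaw μ π) μ (measurable_traj A j) measurable_id
    rw [ih, Measure.map_id] at h2
    have h3 : (blockLaw μ π).map (fun b => (traj A (b none) (fun j => b (some j)) j, b (some j))) =
        π.prod μ := h1.trans h2.symm
    have h4 : Measurable fun p : Vec d × Vec d => A p.1 + p.2 := by fun_prop
    calc _ = ((blockLaw μ π).map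
          (fun b => (traj A (b none) (fun j => b (some j)) j, b (some j)))).map
            (fun p => A p.1 + p.2) := by
          rw [Measure.map_map h4 ((measurable_traj A j).prodMk (measurable_pi_apply _))]
          rfl
      _ = π := by rw [h3, hπ.invariant]

lemma memLp_blockNoise (hμ : MemLp (fun x : Vec d => x) 2 μ) (u k : ℕ) :
    MemLp (fun b => blockNoise u b k) 2 (blockLaw μ π) := by
  have := hμ
  rw [← map_blockLaw_some (μ := μ) (π := π) (u + k)] at this
  exact this.comp_of_map (measurable_pi_apply _).aemeasurable

end Law

section BlockExpectations

variable [IsProbabilityMeasure μ] [IsProbabilityMeasure π] {A : Op d} {γ R : ℝ} {u : ℕ}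

lemma measurable_bufH_blockState (hR : 0 < R) (k : ℕ) :
    Measurable fun b : Block d => bufH γ (blockState A R u b) k :=
  measurable_bufH (fun k => measurable_blockState A hR u k) k

lemma measurable_bufZ_block (hR : 0 < R) (k : ℕ) :
    Measurable fun b : Block d => bufZ γ (blockState A R u b) (blockNoise u b) k :=
  measurable_bufZ (fun k => measurable_blockState A hR u k) (fun k => measurable_blockNoise u k) k

lemma memLp_bufZ_block (hR : 0 < R) (hγ : 0 ≤ γ) (hγR : γ * R ≤ 1)
    (hμ : MemLp (fun x : Vec d => x) 2 μ) (k : ℕ) :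
    MemLp (fun b => bufZ γ (blockState A R u b) (blockNoise u b) k) 2 (blockLaw μ π) := by
  have h : MemLp (fun b => 2 * γ * √R * ∑ j ∈ Finset.range k, ‖blockNoise u b j‖) 2
      (blockLaw μ π) :=
    (memLp_finsetSum _ fun j _ => (memLp_blockNoise hμ u j).norm).const_mul _
  refine h.mono' (measurable_bufZ_block hR k).aestronglyMeasurable (ae_of_all _ fun b => ?_)
  exact norm_bufZ_le hγ hγR (norm_blockState_sq_le A hR u b) _

lemma memLp_bufZ_block_apply (hR : 0 < R) (hγ : 0 ≤ γ) (hγR : γ * R ≤ 1)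
    (hμ : MemLp (fun x : Vec d => x) 2 μ) (k : ℕ) (x : Vec d) :
    MemLp (fun b => bufZ γ (blockState A R u b) (blockNoise u b) k x) 2 (blockLaw μ π) :=
  (memLp_bufZ_block hR hγ hγR hμ k).continuousLinearMap_comp
    (ContinuousLinearMap.apply ℝ (Vec d) x)

/-- The gain from reversing the order: the weight of the noise number `u + k`, and all noise
collected before it, use only the initial state and earlier noise. -/
lemma dependsOn_block (k : ℕ) (x : Vec d) :
    DependsOn (fun b : Block d =>
      ((inner ℝ (blockState A R u b k) (bufH γ (blockState A R u b) k x) : ℝ),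
        bufZ γ (blockState A R u b) (blockNoise u b) k x))
      (Finset.insertNone (Finset.range (u + k)) : Finset (Option ℕ)) := by
  intro b b' h
  have h1 : ∀ j ≤ k, blockState A R u b j = blockState A R u b' j := fun j hj =>
    blockState_congr A R u fun o ho => h o (by
      cases o with
      | none => simp
      | some i => simp at ho ⊢; omega)
  have h2 : ∀ j < k, blockNoise u b j = blockNoise u b' j := fun j hj => h _ (by simpa using hj)
  dsimp only
  rw [h1 k le_rfl, bufH_congr fun j hj => h1 j hj.le, bufZ_congr (fun j hj => h1 j hj.le) h2]

lemma measurable_block_pair (hR : 0 < R) (k : ℕ) (x : Vec d) :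
    Measurable (fun b : Block d =>
      ((inner ℝ (blockState A R u b k) (bufH γ (blockState A R u b) k x) : ℝ),
        bufZ γ (blockState A R u b) (blockNoise u b) k x)) := by
  refine Measurable.prodMk ?_ ?_
  · exact (measurable_blockState A hR u k).inner
      ((measurable_bufH_blockState hR k).apply_continuousLinearMap x)
  · exact (measurable_bufZ_block hR k).apply_continuousLinearMap x

/-- The noise of a buffer has mean zero. -/
lemma integral_bufZ_block (hR : 0 < R) (hγ : 0 ≤ γ) (hγR : γ * R ≤ 1)
    (hμ : MemLp (fun x : Vec d => x) 2 μ) (hμ0 : ∫ e, e ∂μ = 0) (k : ℕ) (x : Vec d) :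
    ∫ b, bufZ γ (blockState A R u b) (blockNoise u b) k x ∂blockLaw μ π = 0 := by
  induction k with
  | zero => simp [bufZ]
  | succ k ih =>
    have hint := (memLp_bufZ_block_apply (A := A) (u := u) (π := π) hR hγ hγR hμ (k + 1) x).integrable
      (by norm_num)
    simp_rw [bufZ_succ_apply] at hint ⊢
    have h := integral_dependsOn (ν := fun o : Option ℕ => o.elim π fun _ => μ)
      (measurable_block_pair (A := A) (γ := γ) (u := u) hR k x) (dependsOn_block k x)
      (i := some (u + k)) (by simp) (G := fun p => p.1.2 + (2 * γ * p.1.1) • p.2)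
      (by fun_prop) hint
    refine h.trans (Eq.trans (integral_congr_ae (ae_of_all _ fun b => ?_)) ih)
    dsimp only [Option.elim]
    set a : ℝ := 2 * γ * inner ℝ (blockState A R u b k) (bufH γ (blockState A R u b) k x)
    have hi : Integrable (fun y : Vec d => a • y) μ := (hμ.integrable (by norm_num)).smul a
    rw [integral_add (integrable_const _) hi, integral_smul, hμ0]
    simp

/-- The second moment of the noise of a buffer. -/
lemma integral_norm_sq_bufZ_block (hR : 0 < R) (hγ : 0 ≤ γ) (hγR : γ * R ≤ 1)
    (hμ : MemLp (fun x : Vec d => x) 2 μ) (hμ0 : ∫ e, e ∂μ = 0) (k : ℕ) (x : Vec d) :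
    ∫ b, ‖bufZ γ (blockState A R u b) (blockNoise u b) k x‖ ^ 2 ∂blockLaw μ π =
      4 * γ ^ 2 * (momentMatrix μ).trace * ∫ b, ∑ j ∈ Finset.range k,
        inner ℝ (blockState A R u b j) (bufH γ (blockState A R u b) j x) ^ 2 ∂blockLaw μ π := by
  have ha : ∀ j, Integrable (fun b => (inner ℝ (blockState A R u b j)
      (bufH γ (blockState A R u b) j x) : ℝ) ^ 2) (blockLaw μ π) := by
    intro j
    refine Integrable.of_bound
      (((measurable_block_pair (A := A) (γ := γ) (u := u) hR j x).fst).pow_const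
        2).aestronglyMeasurable (R * ‖x‖ ^ 2) (ae_of_all _ fun b => ?_)
    rw [Real.norm_of_nonneg (sq_nonneg _), ← sq_abs]
    have h1 := norm_blockState_sq_le A hR u b j
    have h2 : ‖bufH γ (blockState A R u b) j x‖ ≤ ‖x‖ := by
      simpa using ContinuousLinearMap.le_of_opNorm_le _
        (norm_bufH_le hγ hγR (norm_blockState_sq_le A hR u b)) x
    calc _ ≤ (‖blockState A R u b j‖ * ‖bufH γ (blockState A R u b) j x‖) ^ 2 := by
          gcongr; exact abs_real_inner_le_norm _ _
      _ = ‖blockState A R u b j‖ ^ 2 * ‖bufH γ (blockState A R u b) j x‖ ^ 2 := by ring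
      _ ≤ _ := by gcongr
  induction k with
  | zero => simp [bufZ]
  | succ k ih =>
    have hint := (memLp_bufZ_block_apply (A := A) (u := u) (π := π) hR hγ hγR hμ
      (k + 1) x).integrable_norm_pow (p := 2) (by norm_num)
    have hint0 := (memLp_bufZ_block_apply (A := A) (u := u) (π := π) hR hγ hγR hμ
      k x).integrable_norm_pow (p := 2) (by norm_num)
    simp_rw [Finset.sum_range_succ]
    rw [integral_add (integrable_finsetSum _ fun j _ => ha j) (ha k), mul_add, ← ih,
      ← integral_const_mul, ← integral_add hint0 ((ha k).const_mul _)]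
    simp_rw [bufZ_succ_apply] at hint ⊢
    have h := integral_dependsOn (ν := fun o : Option ℕ => o.elim π fun _ => μ)
      (measurable_block_pair (A := A) (γ := γ) (u := u) hR k x) (dependsOn_block k x)
      (i := some (u + k)) (by simp) (G := fun p => ‖p.1.2 + (2 * γ * p.1.1) • p.2‖ ^ 2)
      (by fun_prop) hint
    refine h.trans (integral_congr_ae (ae_of_all _ fun b => ?_))
    dsimp only [Option.elim]
    set z := bufZ γ (blockState A R u b) (blockNoise u b) k x
    set a : ℝ := inner ℝ (blockState A R u b k) (bufH γ (blockState A R u b) k x)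
    -- With the past fixed, `z` and `a` are constants and the term linear in the fresh noise
    -- integrates to zero. Contributions of different samples are thus orthogonal.
    have e : ∀ y : Vec d, ‖z + (2 * γ * a) • y‖ ^ 2 =
        ‖z‖ ^ 2 + 4 * γ * a * inner ℝ z y + 4 * γ ^ 2 * a ^ 2 * ‖y‖ ^ 2 := by
      intro y
      rw [norm_add_sq_real, inner_smul_right, norm_smul, mul_pow, Real.norm_eq_abs, sq_abs]
      ring
    simp_rw [e]
    have hi : Integrable (fun y : Vec d => y) μ := hμ.integrable (by norm_num)
    have i1 : Integrable (fun y : Vec d => 4 * γ * a * inner ℝ z y) μ :=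
      (hi.const_inner z).const_mul _
    have i2 : Integrable (fun y : Vec d => ‖z‖ ^ 2 + 4 * γ * a * inner ℝ z y) μ :=
      (integrable_const _).add i1
    rw [integral_add i2 ((integrable_norm_sq hμ).const_mul _), integral_add (integrable_const _) i1,
      integral_const_mul, integral_const_mul, integral_inner hi, hμ0, trace_momentMatrix hμ]
    simp
    ring

end BlockExpectations

end Block

end RER

/-! ### Second moments of the recursion driven by i.i.d. blocks. -/

namespace RER

variable {d : ℕ} {𝓑 : Type*}

/-- The affine recursion `M ↦ M H + Z` driven by a sequence of blocks. -/
noncomputable def chain (H Z : 𝓑 → Op d) (D : Op d) (ω : ℕ → 𝓑) : ℕ → Op d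
  | 0 => D
  | s + 1 => chain H Z D ω s * H (ω s) + Z (ω s)

/-- Superposition: a bias, which is the initial error times a random product, plus noise started
from zero. The two parts are estimated separately. -/
lemma chain_eq (H Z : 𝓑 → Op d) (D : Op d) (ω : ℕ → 𝓑) (s : ℕ) :
    chain H Z D ω s = D * chain H 0 1 ω s + chain H Z 0 ω s := by
  induction s with
  | zero => simp [chain]
  | succ s ih => simp only [chain, ih, Pi.zero_apply, add_zero, add_mul, mul_assoc, add_assoc]

lemma dependsOn_chain (H Z : 𝓑 → Op d) (D : Op d) (s : ℕ) :
    DependsOn (fun ω : ℕ → 𝓑 => chain H Z D ω s) (Finset.range s : Finset ℕ) := by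
  induction s with
  | zero => exact fun _ _ _ => rfl
  | succ s ih =>
    intro ω ω' h
    have h1 : chain H Z D ω s = chain H Z D ω' s :=
      ih fun i hi => h i (by simp at hi ⊢; omega)
    simp only [chain]
    rw [h1, h s (by simp)]

variable [MeasurableSpace 𝓑]

lemma measurable_chain {H Z : 𝓑 → Op d} (hH : Measurable H) (hZ : Measurable Z) (D : Op d) (s : ℕ) :
    Measurable fun ω : ℕ → 𝓑 => chain H Z D ω s := by
  induction s with
  | zero => exact measurable_const
  | succ s ih =>
    exact (ih.mul (hH.comp (measurable_pi_apply s))).add (hZ.comp (measurable_pi_apply s))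

/-- The law of an i.i.d. sequence. -/
noncomputable abbrev seqLaw (β : Measure 𝓑) [IsProbabilityMeasure β] : Measure (ℕ → 𝓑) :=
  Measure.infinitePi fun _ : ℕ => β

/-- Law of the pair (contraction, noise) of a block: the noise is centred and its second moment is
comparable with `v` times the loss of norm of the contraction. -/
structure IsNoisyContraction (β : Measure 𝓑) (H Z : 𝓑 → Op d) (v ε ρ : ℝ) : Prop where
  measurable_H : Measurable H
  measurable_Z : Measurable Z
  norm_H_le : ∀ b, ‖H b‖ ≤ 1
  memLp_Z : MemLp Z 2 β
  integral_Z : ∀ x, ∫ b, Z b x ∂β = 0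
  le_noise : ∀ x, v * (‖x‖ ^ 2 - ∫ b, ‖H b x‖ ^ 2 ∂β) ≤ ∫ b, ‖Z b x‖ ^ 2 ∂β
  noise_le : ∀ x, ∫ b, ‖Z b x‖ ^ 2 ∂β ≤ (1 + ε) * v * (‖x‖ ^ 2 - ∫ b, ‖H b x‖ ^ 2 ∂β)
  contraction : ∀ x, ∫ b, ‖H b x‖ ^ 2 ∂β ≤ (1 - ρ) * ‖x‖ ^ 2
  v_nonneg : 0 ≤ v
  ε_nonneg : 0 ≤ ε
  ρ_pos : 0 < ρ
  ρ_le_one : ρ ≤ 1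

namespace IsNoisyContraction

variable {β : Measure 𝓑} [IsProbabilityMeasure β] {H Z : 𝓑 → Op d} {v ε ρ : ℝ}

lemma norm_chain_le (h : IsNoisyContraction β H Z v ε ρ) (D : Op d) (ω : ℕ → 𝓑) (s : ℕ) :
    ‖chain H Z D ω s‖ ≤ ‖D‖ + ∑ r ∈ Finset.range s, ‖Z (ω r)‖ := by
  induction s with
  | zero => simp [chain]
  | succ s ih =>
    rw [Finset.sum_range_succ, ← add_assoc]
    refine (norm_add_le _ _).trans (add_le_add_left ?_ _)
    refine ((norm_mul_le _ _).trans ?_).trans ih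
    exact mul_le_of_le_one_right (norm_nonneg _) (h.norm_H_le _)

lemma memLp_Z_eval (h : IsNoisyContraction β H Z v ε ρ) (r : ℕ) :
    MemLp (fun ω : ℕ → 𝓑 => Z (ω r)) 2 (seqLaw β) :=
  h.memLp_Z.comp_measurePreserving (measurePreserving_eval_infinitePi (fun _ : ℕ => β) r)

lemma memLp_chain (h : IsNoisyContraction β H Z v ε ρ) (D : Op d) (s : ℕ) :
    MemLp (fun ω => chain H Z D ω s) 2 (seqLaw β) := by
  have h1 : MemLp (fun ω : ℕ → 𝓑 => ∑ r ∈ Finset.range s, ‖Z (ω r)‖) 2 (seqLaw β) :=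
    memLp_finsetSum _ fun r _ => (h.memLp_Z_eval r).norm
  have h2 : MemLp (fun _ : ℕ → 𝓑 => ‖D‖) 2 (seqLaw β) := memLp_const _
  have h3 := (measurable_chain h.measurable_H h.measurable_Z D s).aestronglyMeasurable
    (μ := seqLaw β)
  exact (h2.add h1).mono' h3 (ae_of_all _ fun ω => h.norm_chain_le D ω s)

lemma memLp_chain_apply (h : IsNoisyContraction β H Z v ε ρ) (D : Op d) (s : ℕ) (x : Vec d) :
    MemLp (fun ω => chain H Z D ω s x) 2 (seqLaw β) :=
  (h.memLp_chain D s).continuousLinearMap_comp (ContinuousLinearMap.apply ℝ (Vec d) x)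

lemma integrable_H (h : IsNoisyContraction β H Z v ε ρ) : Integrable H β :=
  Integrable.of_bound h.measurable_H.aestronglyMeasurable 1 (ae_of_all _ h.norm_H_le)

lemma integrable_H_apply (h : IsNoisyContraction β H Z v ε ρ) (x : Vec d) :
    Integrable (fun b => H b x) β :=
  (ContinuousLinearMap.apply ℝ (Vec d) x).integrable_comp h.integrable_H

lemma memLp_Z_apply (h : IsNoisyContraction β H Z v ε ρ) (x : Vec d) :
    MemLp (fun b => Z b x) 2 β :=
  h.memLp_Z.continuousLinearMap_comp (ContinuousLinearMap.apply ℝ (Vec d) x)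

lemma integrable_Z_apply (h : IsNoisyContraction β H Z v ε ρ) (x : Vec d) :
    Integrable (fun b => Z b x) β := (h.memLp_Z_apply x).integrable (by norm_num)

lemma norm_H_apply_le (h : IsNoisyContraction β H Z v ε ρ) (b : 𝓑) (x : Vec d) :
    ‖H b x‖ ≤ ‖x‖ := by
  simpa using (H b).le_of_opNorm_le (h.norm_H_le b) x

lemma integrable_norm_sq_H (h : IsNoisyContraction β H Z v ε ρ) (x : Vec d) :
    Integrable (fun b => ‖H b x‖ ^ 2) β :=
  Integrable.of_bound ((h.measurable_H.apply_continuousLinearMap x).norm.pow_const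
    2).aestronglyMeasurable (‖x‖ ^ 2) (ae_of_all _ fun b => by
      rw [Real.norm_of_nonneg (sq_nonneg _)]
      exact pow_le_pow_left₀ (norm_nonneg _) (h.norm_H_apply_le b x) 2)

/-- Without noise the recursion is a noisy contraction as well. -/
lemma noiseless (h : IsNoisyContraction β H Z v ε ρ) : IsNoisyContraction β H 0 0 0 ρ where
  measurable_H := h.measurable_H
  measurable_Z := measurable_zero
  norm_H_le := h.norm_H_le
  memLp_Z := memLp_const (0 : Op d)
  integral_Z := by simp
  le_noise := by simp
  noise_le := by simp
  contraction := h.contraction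
  v_nonneg := le_rfl
  ε_nonneg := le_rfl
  ρ_pos := h.ρ_pos
  ρ_le_one := h.ρ_le_one

lemma integral_chain_zero (h : IsNoisyContraction β H Z v ε ρ) (s : ℕ) (x : Vec d) :
    ∫ ω, chain H Z 0 ω s x ∂seqLaw β = 0 := by
  induction s generalizing x with
  | zero => simp [chain]
  | succ s ih =>
    have hint : Integrable (fun ω => (chain H Z 0 ω s * H (ω s) + Z (ω s)) x) (seqLaw β) :=
      (h.memLp_chain_apply 0 (s + 1) x).integrable (by norm_num)
    have hG : Measurable fun p : Op d × 𝓑 => (p.1 * H p.2 + Z p.2) x :=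
      ((measurable_fst.mul (h.measurable_H.comp measurable_snd)).add
        (h.measurable_Z.comp measurable_snd)).apply_continuousLinearMap x
    have h1 := integral_dependsOn (ν := fun _ : ℕ => β)
      (measurable_chain h.measurable_H h.measurable_Z 0 s) (dependsOn_chain H Z 0 s) (i := s)
      (by simp) (G := fun p => (p.1 * H p.2 + Z p.2) x) hG.stronglyMeasurable hint
    -- Averaging over the last block replaces `x` by the mean of `H b x`, so the induction has to
    -- run over all vectors.
    refine h1.trans (Eq.trans (integral_congr_ae (ae_of_all _ fun ω => ?_)) (ih (∫ b, H b x ∂β)))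
    have i1 := h.integrable_H_apply x
    have e : ∀ b, (chain H Z 0 ω s * H b + Z b) x = chain H Z 0 ω s (H b x) + Z b x := fun b => rfl
    simp only [e]
    rw [integral_add ((chain H Z 0 ω s).integrable_comp i1) (h.integrable_Z_apply x), h.integral_Z,
      add_zero, ContinuousLinearMap.integral_comp_comm _ i1]

/-- One step of the recursion for the second moment. -/
lemma integral_norm_sq_chain_succ (h : IsNoisyContraction β H Z v ε ρ) (D : Op d)
    (hD : (∀ s x, ∫ ω, chain H Z D ω s x ∂seqLaw β = 0) ∨ Z = 0) (s : ℕ) (x : Vec d) :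
    Integrable (fun b => ∫ ω, ‖chain H Z D ω s (H b x)‖ ^ 2 ∂seqLaw β) β ∧
    ∫ ω, ‖chain H Z D ω (s + 1) x‖ ^ 2 ∂seqLaw β =
      ∫ b, ∫ ω, ‖chain H Z D ω s (H b x)‖ ^ 2 ∂seqLaw β ∂β + ∫ b, ‖Z b x‖ ^ 2 ∂β := by
  have hc := measurable_chain h.measurable_H h.measurable_Z D s
  have hint : Integrable (fun ω => ‖(chain H Z D ω s * H (ω s) + Z (ω s)) x‖ ^ 2) (seqLaw β) :=
    (h.memLp_chain_apply D (s + 1) x).integrable_norm_pow (by norm_num)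
  have hG : Measurable fun p : Op d × 𝓑 => (p.1 * H p.2 + Z p.2) x :=
    ((measurable_fst.mul (h.measurable_H.comp measurable_snd)).add
        (h.measurable_Z.comp measurable_snd)).apply_continuousLinearMap x
  have h1 := integral_dependsOn (ν := fun _ : ℕ => β) hc (dependsOn_chain H Z D s) (i := s)
      (by simp) (G := fun p => ‖(p.1 * H p.2 + Z p.2) x‖ ^ 2)
      (hG.norm.pow_const 2).stronglyMeasurable hint
  have h1' := integrable_dependsOn (ν := fun _ : ℕ => β) hc (dependsOn_chain H Z D s) (i := s)
      (by simp) (G := fun p => ‖(p.1 * H p.2 + Z p.2) x‖ ^ 2)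
      (hG.norm.pow_const 2).stronglyMeasurable hint
  have hcp : Measurable fun p : (ℕ → 𝓑) × 𝓑 => (chain H Z D p.1 s * H p.2) x :=
    ((hc.comp measurable_fst).mul (h.measurable_H.comp measurable_snd)).apply_continuousLinearMap x
  have hZp : Measurable fun p : (ℕ → 𝓑) × 𝓑 => Z p.2 x :=
    (h.measurable_Z.comp measurable_snd).apply_continuousLinearMap x
  have hZx : MemLp (fun b => Z b x) 2 β := h.memLp_Z_apply x
  have hm1 : MemLp (fun p : (ℕ → 𝓑) × 𝓑 => (chain H Z D p.1 s * H p.2) x) 2 ((seqLaw β).prod β) := by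
    have h2 : MemLp (fun p : (ℕ → 𝓑) × 𝓑 => ‖chain H Z D p.1 s‖ * ‖x‖) 2 ((seqLaw β).prod β) :=
      ((h.memLp_chain D s).norm.mul_const ‖x‖).comp_fst β
    refine h2.mono' hcp.aestronglyMeasurable (ae_of_all _ fun p => ?_)
    refine (ContinuousLinearMap.le_opNorm _ _).trans ?_
    gcongr
    exact (norm_mul_le _ _).trans (mul_le_of_le_one_right (norm_nonneg _) (h.norm_H_le _))
  have hm2 : MemLp (fun p : (ℕ → 𝓑) × 𝓑 => Z p.2 x) 2 ((seqLaw β).prod β) := hZx.comp_snd (seqLaw β)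
  have i1 : Integrable (fun p : (ℕ → 𝓑) × 𝓑 => ‖(chain H Z D p.1 s * H p.2) x‖ ^ 2)
      ((seqLaw β).prod β) := hm1.integrable_norm_pow (by norm_num)
  have i2 : Integrable (fun p : (ℕ → 𝓑) × 𝓑 => ‖Z p.2 x‖ ^ 2) ((seqLaw β).prod β) :=
    hm2.integrable_norm_pow (by norm_num)
  have i3 : Integrable (fun p : (ℕ → 𝓑) × 𝓑 =>
      inner ℝ ((chain H Z D p.1 s * H p.2) x) (Z p.2 x)) ((seqLaw β).prod β) := by
    refine (hm1.norm.integrable_mul hm2.norm).mono' (hcp.inner hZp).aestronglyMeasurable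
      (ae_of_all _ fun p => norm_inner_le_norm _ _)
  have h3 : ∫ p : (ℕ → 𝓑) × 𝓑, inner ℝ ((chain H Z D p.1 s * H p.2) x) (Z p.2 x) ∂(seqLaw β).prod β
      = 0 := by
    -- The cross term vanishes for two reasons: the chain is centred and independent of the new
    -- block, or there is no noise. The first serves the noise part, the second the homogeneous
    -- part.
    rcases hD with hD | rfl
    · rw [integral_prod_symm _ i3]
      refine integral_eq_zero_of_ae (ae_of_all _ fun b => ?_)
      have e : ∀ ω : ℕ → 𝓑, inner ℝ ((chain H Z D ω s * H b) x) (Z b x) =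
          inner ℝ (Z b x) (chain H Z D ω s (H b x)) := fun ω => real_inner_comm _ _
      simp only [e, Pi.zero_apply]
      rw [integral_inner ((h.memLp_chain_apply D s _).integrable (by norm_num)), hD,
        inner_zero_right]
    · simp
  have e : ∀ p : (ℕ → 𝓑) × 𝓑, ‖(chain H Z D p.1 s * H p.2 + Z p.2) x‖ ^ 2 =
      ‖(chain H Z D p.1 s * H p.2) x‖ ^ 2 +
        2 * inner ℝ ((chain H Z D p.1 s * H p.2) x) (Z p.2 x) + ‖Z p.2 x‖ ^ 2 := fun p => by
    rw [add_apply, norm_add_sq_real]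
  refine ⟨i1.integral_prod_right, ?_⟩
  have i13 : Integrable (fun p : (ℕ → 𝓑) × 𝓑 => ‖(chain H Z D p.1 s * H p.2) x‖ ^ 2 +
        2 * inner ℝ ((chain H Z D p.1 s * H p.2) x) (Z p.2 x)) ((seqLaw β).prod β) :=
    i1.add (i3.const_mul 2)
  calc _ = ∫ p : (ℕ → 𝓑) × 𝓑, ‖(chain H Z D p.1 s * H p.2 + Z p.2) x‖ ^ 2 ∂(seqLaw β).prod β :=
        h1.trans (integral_prod _ h1').symm
    _ = ∫ p : (ℕ → 𝓑) × 𝓑, ‖(chain H Z D p.1 s * H p.2) x‖ ^ 2 ∂(seqLaw β).prod β +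
        ∫ p : (ℕ → 𝓑) × 𝓑, ‖Z p.2 x‖ ^ 2 ∂(seqLaw β).prod β := by
        rw [integral_congr_ae (ae_of_all _ e), integral_add i13 i2,
          integral_add i1 (i3.const_mul 2), integral_const_mul, h3]
        ring
    _ = _ := by
        rw [integral_prod_symm _ i1, integral_fun_snd (fun b => ‖Z b x‖ ^ 2)]
        simp only [probReal_univ, one_smul]
        rfl

/-- The homogeneous recursion contracts in mean square. -/
lemma integral_norm_sq_homogeneous_le (h : IsNoisyContraction β H Z v ε ρ) (s : ℕ) (x : Vec d) :
    ∫ ω, ‖chain H 0 1 ω s x‖ ^ 2 ∂seqLaw β ≤ (1 - ρ) ^ s * ‖x‖ ^ 2 := by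
  have hρ : 0 ≤ 1 - ρ := by linarith [h.ρ_le_one]
  induction s generalizing x with
  | zero => simp [chain]
  | succ s ih =>
    obtain ⟨hi, he⟩ := h.noiseless.integral_norm_sq_chain_succ 1 (Or.inr rfl) s x
    rw [he]
    calc _ ≤ ∫ b, (1 - ρ) ^ s * ‖H b x‖ ^ 2 ∂β + 0 := by
          refine add_le_add (integral_mono hi ((h.integrable_norm_sq_H x).const_mul _)
            fun b => ih _) (by simp)
      _ ≤ _ := by
          rw [integral_const_mul, add_zero, pow_succ, mul_assoc]
          exact mul_le_mul_of_nonneg_left (h.contraction x) (pow_nonneg hρ s)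

/-- The form `(1 + ε) v ‖x‖²` is preserved as an upper bound: a block adds at most `(1 + ε) v` times
the norm that its contraction removes. -/
lemma integral_norm_sq_noise_le (h : IsNoisyContraction β H Z v ε ρ) (s : ℕ) (x : Vec d) :
    ∫ ω, ‖chain H Z 0 ω s x‖ ^ 2 ∂seqLaw β ≤ (1 + ε) * v * ‖x‖ ^ 2 := by
  have hv := h.v_nonneg
  have hε := h.ε_nonneg
  induction s generalizing x with
  | zero => simp [chain]; positivity
  | succ s ih =>
    obtain ⟨hi, he⟩ := h.integral_norm_sq_chain_succ 0 (Or.inl h.integral_chain_zero) s x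
    rw [he]
    calc _ ≤ ∫ b, (1 + ε) * v * ‖H b x‖ ^ 2 ∂β +
          (1 + ε) * v * (‖x‖ ^ 2 - ∫ b, ‖H b x‖ ^ 2 ∂β) := by
          refine add_le_add (integral_mono hi ((h.integrable_norm_sq_H x).const_mul _)
            fun b => ih _) (h.noise_le x)
      _ = _ := by rw [integral_const_mul]; ring

/-- The matching lower bound. Starting from zero, the missing part of `v ‖x‖²` is what the
homogeneous chain has not yet contracted. -/
lemma le_integral_norm_sq_noise (h : IsNoisyContraction β H Z v ε ρ) (s : ℕ) (x : Vec d) :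
    v * (‖x‖ ^ 2 - ∫ ω, ‖chain H 0 1 ω s x‖ ^ 2 ∂seqLaw β) ≤ ∫ ω, ‖chain H Z 0 ω s x‖ ^ 2 ∂seqLaw β := by
  induction s generalizing x with
  | zero => simp [chain]
  | succ s ih =>
    obtain ⟨hi, he⟩ := h.integral_norm_sq_chain_succ 0 (Or.inl h.integral_chain_zero) s x
    obtain ⟨hi', he'⟩ := h.noiseless.integral_norm_sq_chain_succ 1 (Or.inr rfl) s x
    rw [he, he']
    have h1 : ∫ b, v * (‖H b x‖ ^ 2 - ∫ ω, ‖chain H 0 1 ω s (H b x)‖ ^ 2 ∂seqLaw β) ∂β ≤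
        ∫ b, ∫ ω, ‖chain H Z 0 ω s (H b x)‖ ^ 2 ∂seqLaw β ∂β :=
      integral_mono (((h.integrable_norm_sq_H x).sub hi').const_mul _) hi fun b => ih _
    rw [integral_const_mul, integral_sub (h.integrable_norm_sq_H x) hi'] at h1
    have h2 := h.le_noise x
    simp only [Pi.zero_apply, zero_apply, norm_zero, ne_eq, OfNat.ofNat_ne_zero,
      not_false_eq_true, zero_pow, integral_zero, add_zero]
    linarith

end IsNoisyContraction

end RER

/-! ### Variance and bias of the tail average. -/

namespace RER

variable {d : ℕ} {𝓑 : Type*} [MeasurableSpace 𝓑]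

section Algebra

variable {V : Type*} [NormedAddCommGroup V] [InnerProductSpace ℝ V]

/-- Pairs are grouped by their earlier time, because correlations are computed by averaging over the
later blocks. -/
lemma norm_sq_sum_Ioc (f : ℕ → V) {a t : ℕ} (hat : a ≤ t) :
    ‖∑ s ∈ Finset.Ioc a t, f s‖ ^ 2 =
      ∑ s ∈ Finset.Ioc a t, (‖f s‖ ^ 2 + 2 * ∑ k ∈ Finset.range (t - s),
        inner ℝ (f s) (f (s + (k + 1)))) := by
  induction t, hat using Nat.le_induction with
  | base => simp
  | succ t hat ih =>
    rw [Finset.sum_Ioc_succ_top (by omega), norm_add_sq_real, ih, Finset.sum_Ioc_succ_top (by omega),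
      Nat.sub_self, Finset.range_zero, Finset.sum_empty, mul_zero, add_zero, sum_inner,
      Finset.mul_sum, ← Finset.sum_add_distrib]
    congr 1
    refine Finset.sum_congr rfl fun s hs => ?_
    have hs' := (Finset.mem_Ioc.1 hs).2
    rw [Nat.succ_sub hs', Finset.sum_range_succ, show s + (t - s + 1) = t + 1 by omega]
    ring

lemma one_sub_mul_geom {S : Type*} [Ring S] (T : S) (n : ℕ) :
    (1 - T) * (1 + 2 • ∑ k ∈ Finset.range n, T ^ (k + 1)) = 1 + T - 2 • T ^ (n + 1) := by
  induction n with
  | zero => simp [two_smul]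
  | succ n ih =>
    rw [Finset.sum_range_succ, smul_add, ← add_assoc, mul_add, ih, mul_smul_comm, sub_mul, one_mul,
      ← pow_succ', smul_sub]
    abel

/-- The operator `1 + 2 (T + ⋯ + Tⁿ)` in terms of the inverse of `1 - T`. -/
lemma one_add_two_smul_geom {S : Type*} [Ring S] {T K : S} (hK : K * (1 - T) = 1)
    (hK' : (1 - T) * K = 1) (n : ℕ) :
    1 + 2 • ∑ k ∈ Finset.range n, T ^ (k + 1) = 2 • K - 1 - 2 • (T ^ (n + 1) * K) ∧
    1 + 2 • ∑ k ∈ Finset.range n, T ^ (k + 1) = (1 + T - 2 • T ^ (n + 1)) * K := by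
  have hc : Commute T K := by
    have h1 : K - K * T = 1 := by rw [← hK, mul_sub, mul_one]
    have h2 : K - T * K = 1 := by rw [← hK', sub_mul, one_mul]
    exact (sub_right_injective (h2.trans h1.symm) : T * K = K * T)
  have hc' : Commute (1 + T - 2 • T ^ (n + 1)) K :=
    ((Commute.one_left K).add_left hc).sub_left ((hc.pow_left _).smul_left 2)
  have h2 : 1 + 2 • ∑ k ∈ Finset.range n, T ^ (k + 1) = (1 + T - 2 • T ^ (n + 1)) * K := by
    rw [hc'.eq, ← one_sub_mul_geom, ← mul_assoc, hK, one_mul]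
  refine ⟨?_, h2⟩
  have h3 : T * K = K - 1 := by
    have h2 : K - T * K = 1 := by rw [← hK', sub_mul, one_mul]
    rw [← h2]; abel
  rw [h2, sub_mul, add_mul, one_mul, h3, smul_mul_assoc, two_smul ℕ K]
  abel

end Algebra

namespace IsNoisyContraction

variable {β : Measure 𝓑} [IsProbabilityMeasure β] {H Z : 𝓑 → Op d} {v ε ρ : ℝ}

lemma integrable_inner_chain (h : IsNoisyContraction β H Z v ε ρ) (s s' : ℕ) (x y : Vec d) :
    Integrable (fun ω => inner ℝ (chain H Z 0 ω s x) (chain H Z 0 ω s' y)) (seqLaw β) := by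
  have hm : ∀ s x, Measurable fun ω => chain H Z 0 ω s x := fun s x =>
    (measurable_chain h.measurable_H h.measurable_Z 0 s).apply_continuousLinearMap x
  exact ((h.memLp_chain_apply 0 s x).norm.integrable_mul (h.memLp_chain_apply 0 s' y).norm).mono'
    ((hm s x).inner (hm s' y)).aestronglyMeasurable (ae_of_all _ fun ω => norm_inner_le_norm _ _)

/-- Correlations of the noise part decay with the mean contraction. -/
lemma integral_inner_chain_add (h : IsNoisyContraction β H Z v ε ρ) (s k : ℕ) (x y : Vec d) :
    ∫ ω, inner ℝ (chain H Z 0 ω s x) (chain H Z 0 ω (s + k) y) ∂seqLaw β =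
      ∫ ω, inner ℝ (chain H Z 0 ω s x) (chain H Z 0 ω s (((∫ b, H b ∂β) ^ k) y)) ∂seqLaw β := by
  induction k generalizing y with
  | zero => simp
  | succ k ih =>
    rw [pow_succ, ← add_assoc]
    have hm : ∀ s, Measurable fun ω => chain H Z 0 ω s := fun s =>
      measurable_chain h.measurable_H h.measurable_Z 0 s
    have hf : Measurable fun ω => (chain H Z 0 ω s x, chain H Z 0 ω (s + k)) :=
      ((hm s).apply_continuousLinearMap x).prodMk (hm (s + k))
    have hdep : DependsOn (fun ω : ℕ → 𝓑 => (chain H Z 0 ω s x, chain H Z 0 ω (s + k)))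
        (Finset.range (s + k) : Finset ℕ) := by
      intro ω ω' hω
      have h1 := dependsOn_chain H Z 0 (s + k) hω
      have h2 : chain H Z 0 ω s = chain H Z 0 ω' s :=
        dependsOn_chain H Z 0 s fun i hi => hω i (by simp at hi ⊢; omega)
      dsimp only at h1 ⊢
      rw [h1, h2]
    have hG : Measurable fun p : (Vec d × Op d) × 𝓑 =>
        inner ℝ p.1.1 ((p.1.2 * H p.2 + Z p.2) y) :=
      (measurable_fst.comp measurable_fst).inner
        ((((measurable_snd.comp measurable_fst).mul (h.measurable_H.comp measurable_snd)).add
          (h.measurable_Z.comp measurable_snd)).apply_continuousLinearMap y)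
    have h1 := integral_dependsOn (ν := fun _ : ℕ => β) hf hdep (i := s + k)
      (by simp) (G := fun p => inner ℝ p.1.1 ((p.1.2 * H p.2 + Z p.2) y)) hG.stronglyMeasurable
      (h.integrable_inner_chain s (s + k + 1) x y)
    have e1 : ((∫ b, H b ∂β) ^ k * ∫ b, H b ∂β) y =
        ((∫ b, H b ∂β) ^ k) ((∫ b, H b ∂β) y) := rfl
    rw [e1, ← ih]
    refine h1.trans (integral_congr_ae (ae_of_all _ fun ω => ?_))
    dsimp only
    have e2 : ∀ b, inner ℝ (chain H Z 0 ω s x) ((chain H Z 0 ω (s + k) * H b + Z b) y) =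
        inner ℝ (chain H Z 0 ω s x) (chain H Z 0 ω (s + k) (H b y)) +
          inner ℝ (chain H Z 0 ω s x) (Z b y) := fun b => by
      rw [← inner_add_right]; rfl
    have i1 := (chain H Z 0 ω (s + k)).integrable_comp (h.integrable_H_apply y)
    have i2 := h.integrable_Z_apply y
    simp only [e2]
    rw [integral_add (i1.const_inner _) (i2.const_inner _), integral_inner i1, integral_inner i2,
      h.integral_Z, inner_zero_right, add_zero,
      ContinuousLinearMap.integral_comp_comm _ (h.integrable_H_apply y),
      ContinuousLinearMap.integral_apply h.integrable_H]

/-- By Jensen `‖(E H) x‖² ≤ E‖H x‖² ≤ (1 - ρ) ‖x‖²`, and `1 - ρ ≤ (1 - ρ/2)²`. -/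
lemma norm_mean_le (h : IsNoisyContraction β H Z v ε ρ) : ‖∫ b, H b ∂β‖ ≤ 1 - ρ / 2 := by
  have hρ := h.ρ_le_one
  refine ContinuousLinearMap.opNorm_le_bound _ (by linarith) fun x => ?_
  refine le_of_sq_le_sq ?_ (mul_nonneg (by linarith) (norm_nonneg x))
  set m := (∫ b, H b ∂β) x with hm
  have hmi : m = ∫ b, H b x ∂β := ContinuousLinearMap.integral_apply h.integrable_H x
  have h1 : ‖m‖ ^ 2 ≤ ∫ b, ‖H b x‖ ^ 2 ∂β := by
    have h0 : 0 ≤ ∫ b, ‖H b x - m‖ ^ 2 ∂β := integral_nonneg fun _ => sq_nonneg _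
    have e : ∀ b, ‖H b x - m‖ ^ 2 = ‖H b x‖ ^ 2 - 2 * inner ℝ m (H b x) + ‖m‖ ^ 2 := fun b => by
      rw [norm_sub_sq_real, real_inner_comm]
    have i1 : Integrable (fun b => 2 * inner ℝ m (H b x)) β :=
      ((h.integrable_H_apply x).const_inner m).const_mul 2
    have i2 : Integrable (fun b => ‖H b x‖ ^ 2 - 2 * inner ℝ m (H b x)) β :=
      (h.integrable_norm_sq_H x).sub i1
    simp only [e] at h0
    rw [integral_add i2 (integrable_const _), integral_sub (h.integrable_norm_sq_H x) i1,
      integral_const_mul, integral_inner (h.integrable_H_apply x), ← hmi,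
      real_inner_self_eq_norm_sq] at h0
    simp only [integral_const, probReal_univ, one_smul] at h0
    linarith
  have h2 := h.contraction x
  rw [mul_pow]
  nlinarith [sq_nonneg ρ, sq_nonneg ‖x‖, mul_nonneg (sq_nonneg ρ) (sq_nonneg ‖x‖)]

/-- The stationary correlations are nearly isotropic. -/
lemma integral_inner_chain_le (h : IsNoisyContraction β H Z v ε ρ) (s : ℕ) {x : Vec d}
    (hx : ‖x‖ = 1) (y : Vec d) :
    ∫ ω, inner ℝ (chain H Z 0 ω s x) (chain H Z 0 ω s y) ∂seqLaw β ≤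
      v * (inner ℝ x y + (ε + (1 - ρ) ^ s) * ‖y‖) := by
  have hρ : 0 ≤ (1 - ρ) ^ s := pow_nonneg (by linarith [h.ρ_le_one]) s
  have hv := h.v_nonneg
  have hε := h.ε_nonneg
  -- Two-sided closeness of the quadratic form to `v ‖z‖²`; the lower side pays the transient `(1 -
  -- ρ) ^ s`.
  have hq : ∀ z, |∫ ω, ‖chain H Z 0 ω s z‖ ^ 2 ∂seqLaw β - v * ‖z‖ ^ 2| ≤
      v * (ε + (1 - ρ) ^ s) * ‖z‖ ^ 2 := by
    intro z
    have h1 := h.integral_norm_sq_noise_le s z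
    have h2 := h.le_integral_norm_sq_noise s z
    have h3 := mul_le_mul_of_nonneg_left (h.integral_norm_sq_homogeneous_le s z) hv
    have h4 : 0 ≤ v * ε * ‖z‖ ^ 2 := by positivity
    have h5 : 0 ≤ v * (1 - ρ) ^ s * ‖z‖ ^ 2 := by positivity
    rw [abs_le]
    constructor <;> nlinarith
  rcases eq_or_ne y 0 with rfl | hy
  · simp
  have hy0 : 0 < ‖y‖ := norm_pos_iff.2 hy
  set w := ‖y‖⁻¹ • y with hw
  have hw1 : ‖w‖ = 1 := by rw [hw, norm_smul, norm_inv, norm_norm, inv_mul_cancel₀ hy0.ne']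
  have hyw : y = ‖y‖ • w := by rw [hw, smul_smul, mul_inv_cancel₀ hy0.ne', one_smul]
  -- Polarisation with the unit vectors `x` and `w`: by the parallelogram law the two error terms
  -- sum to a constant, `4` times the relative error times `v`.
  have e1 : ∀ ω, inner ℝ (chain H Z 0 ω s x) (chain H Z 0 ω s y) =
      ‖y‖ * (‖chain H Z 0 ω s (x + w)‖ ^ 2 - ‖chain H Z 0 ω s (x - w)‖ ^ 2) / 4 := by
    intro ω
    conv_lhs => rw [hyw]
    rw [map_smul, inner_smul_right, map_add, map_sub, norm_add_sq_real, norm_sub_sq_real]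
    ring
  have e2 : inner ℝ x y = ‖y‖ * (‖x + w‖ ^ 2 - ‖x - w‖ ^ 2) / 4 := by
    conv_lhs => rw [hyw]
    rw [inner_smul_right, norm_add_sq_real, norm_sub_sq_real]
    ring
  have i : ∀ z, Integrable (fun ω => ‖chain H Z 0 ω s z‖ ^ 2) (seqLaw β) := fun z =>
    (h.memLp_chain_apply 0 s z).integrable_norm_pow (by norm_num)
  have e3 : ‖x + w‖ ^ 2 + ‖x - w‖ ^ 2 = 4 := by
    have := parallelogram_law_with_norm ℝ x w
    rw [hx, hw1] at this
    nlinarith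
  simp_rw [e1]
  rw [integral_div, integral_const_mul, integral_sub (i _) (i _), e2]
  have h1 := (abs_le.1 (hq (x + w))).2
  have h2 := (abs_le.1 (hq (x - w))).1
  have h3 : (∫ ω, ‖chain H Z 0 ω s (x + w)‖ ^ 2 ∂seqLaw β -
      ∫ ω, ‖chain H Z 0 ω s (x - w)‖ ^ 2 ∂seqLaw β) ≤
      v * (‖x + w‖ ^ 2 - ‖x - w‖ ^ 2) + 4 * (v * (ε + (1 - ρ) ^ s)) := by
    have h5 : v * (ε + (1 - ρ) ^ s) * ‖x + w‖ ^ 2 + v * (ε + (1 - ρ) ^ s) * ‖x - w‖ ^ 2 =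
        4 * (v * (ε + (1 - ρ) ^ s)) := by rw [← mul_add, e3]; ring
    linarith
  have h4 := mul_le_mul_of_nonneg_left h3 hy0.le
  linarith

/-- Since `⟨x, H x⟩ ≤ (‖x‖² + ‖H x‖²) / 2`, half of the mean loss of squared norm bounds `⟨x, (1 - E
H) x⟩` from below, although the mean need not be symmetric. -/
lemma coercive_of_contraction (h : IsNoisyContraction β H Z v ε ρ) {q : Vec d → ℝ} {κ₁ : ℝ}
    (hq : ∀ x, 2 * κ₁ * q x ≤ ‖x‖ ^ 2 - ∫ b, ‖H b x‖ ^ 2 ∂β) (x : Vec d) :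
    κ₁ * q x ≤ inner ℝ x ((1 - ∫ b, H b ∂β) x) := by
  have h1 : inner ℝ x ((∫ b, H b ∂β) x) ≤ (‖x‖ ^ 2 + ∫ b, ‖H b x‖ ^ 2 ∂β) / 2 := by
    have i1 : Integrable (fun b => ‖x‖ ^ 2 + ‖H b x‖ ^ 2) β :=
      (integrable_const _).add (h.integrable_norm_sq_H x)
    have e : ‖x‖ ^ 2 + ∫ b, ‖H b x‖ ^ 2 ∂β = ∫ b, (‖x‖ ^ 2 + ‖H b x‖ ^ 2) ∂β := by
      rw [integral_add (integrable_const _) (h.integrable_norm_sq_H x)]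
      simp
    rw [ContinuousLinearMap.integral_apply h.integrable_H, ← integral_inner (h.integrable_H_apply x),
      e, ← integral_div]
    refine integral_mono ((h.integrable_H_apply x).const_inner x) (i1.div_const 2) fun b => ?_
    have := real_inner_le_norm x (H b x)
    dsimp only
    nlinarith [sq_nonneg (‖x‖ - ‖H b x‖)]
  have h2 := hq x
  rw [sub_apply, inner_sub_right, one_apply_eq_self, real_inner_self_eq_norm_sq]
  linarith

lemma sum_pow_le_of_le_one_sub {r θ : ℝ} (hr : 0 < r) (hθ : 0 ≤ θ) (hθr : θ ≤ 1 - r) (n : ℕ) :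
    ∑ k ∈ Finset.range n, θ ^ k ≤ 1 / r := by
  have h1 : θ < 1 := by linarith
  calc _ ≤ ∑' k, θ ^ k := Summable.sum_le_tsum _ (fun _ _ => by positivity)
        (summable_geometric_of_lt_one hθ h1)
    _ = (1 - θ)⁻¹ := tsum_geometric_of_lt_one hθ h1
    _ ≤ 1 / r := by
        rw [one_div]
        exact inv_anti₀ hr (by linarith)

lemma sum_Ioc_eq_sum_range (f : ℕ → ℝ) (a t : ℕ) :
    ∑ s ∈ Finset.Ioc a t, f s = ∑ k ∈ Finset.range (t - a), f (a + 1 + k) := by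
  have h : Finset.Ioc a t = Finset.Ico (a + 1) (t + 1) := by
    ext s
    rw [Finset.mem_Ioc, Finset.mem_Ico]
    omega
  rw [h, Finset.sum_Ico_eq_sum_range, Nat.add_sub_add_right]

/-- The variance of the tail-averaged noise. -/
lemma integral_average_noise_le (h : IsNoisyContraction β H Z v ε ρ)
    (e : OrthonormalBasis (Fin d) ℝ (Vec d)) (g : Fin d → ℝ) {gmin gmax κ₁ : ℝ} (hmin : 0 < gmin)
    (hg : ∀ i, gmin ≤ g i) (hg' : ∀ i, g i ≤ gmax) (hκ : 0 < κ₁)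
    (hq : ∀ x, 2 * κ₁ * ∑ i, g i * inner ℝ (e i) x ^ 2 ≤ ‖x‖ ^ 2 - ∫ b, ‖H b x‖ ^ 2 ∂β)
    {a t : ℕ} (hat : a < t) :
    ∫ ω, ∑ i, g i * ‖(((t : ℝ) - a)⁻¹ • ∑ s ∈ Finset.Ioc a t, chain H Z 0 ω s) (e i)‖ ^ 2
        ∂seqLaw β ≤
      v * d / κ₁ * (2 / ((t : ℝ) - a) + 4 * √(gmax / gmin) * ε / ((t : ℝ) - a) +
        8 * √(gmax / gmin) / (ρ * ((t : ℝ) - a) ^ 2)) := by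
  set Hb := ∫ b, H b ∂β with hHb
  obtain ⟨K, hK, hK', hK1, hK2⟩ := exists_inverse_of_coercive e g hmin hg hg' hκ (1 - Hb)
    (h.coercive_of_contraction hq)
  set κ := √(gmax / gmin) with hκdef
  have hκ0 : 0 ≤ κ := Real.sqrt_nonneg _
  have hv := h.v_nonneg
  have hε := h.ε_nonneg
  have hρ := h.ρ_pos
  have hρ1 := h.ρ_le_one
  have hm0 : (0 : ℝ) < t - a := by
    have : (a : ℝ) < t := by exact_mod_cast hat
    linarith
  set m : ℝ := t - a with hm
  have hθ := h.norm_mean_le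
  rw [← hHb] at hθ
  have hθ1 : ‖Hb‖ ≤ 1 := by linarith
  have hg0 : ∀ i, 0 ≤ g i := fun i => hmin.le.trans (hg i)
  -- the contribution of one pair of a time and a direction
  have key : ∀ s ∈ Finset.Ioc a t, ∀ i, g i * ∫ ω, (‖chain H Z 0 ω s (e i)‖ ^ 2 +
      2 * ∑ k ∈ Finset.range (t - s), inner ℝ (chain H Z 0 ω s (e i))
        (chain H Z 0 ω (s + (k + 1)) (e i))) ∂seqLaw β ≤
      v / κ₁ * (2 + 2 * κ * ‖Hb‖ ^ (t - s + 1) + 4 * κ * (ε + (1 - ρ) ^ s)) := by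
    intro s hs i
    set n := t - s
    -- Later iterates enter through powers of the mean contraction, so all correlations of time `s`
    -- with the future amount to one operator `M` acting at time `s`.
    set M : Op d := 1 + 2 • ∑ k ∈ Finset.range n, Hb ^ (k + 1) with hM
    obtain ⟨hM1, hM2⟩ := one_add_two_smul_geom hK hK' n
    rw [← hM] at hM1 hM2
    have e1 : ∫ ω, (‖chain H Z 0 ω s (e i)‖ ^ 2 +
        2 * ∑ k ∈ Finset.range n, inner ℝ (chain H Z 0 ω s (e i))
          (chain H Z 0 ω (s + (k + 1)) (e i))) ∂seqLaw β =
        ∫ ω, inner ℝ (chain H Z 0 ω s (e i)) (chain H Z 0 ω s (M (e i))) ∂seqLaw β := by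
      have i1 := fun k => h.integrable_inner_chain s (s + (k + 1)) (e i) (e i)
      have i2 := fun k => h.integrable_inner_chain s s (e i) ((Hb ^ (k + 1)) (e i))
      have e2 : ∀ ω : ℕ → 𝓑, inner ℝ (chain H Z 0 ω s (e i)) (chain H Z 0 ω s (M (e i))) =
          ‖chain H Z 0 ω s (e i)‖ ^ 2 + 2 * ∑ k ∈ Finset.range n, inner ℝ (chain H Z 0 ω s (e i))
            (chain H Z 0 ω s ((Hb ^ (k + 1)) (e i))) := by
        intro ω
        simp only [hM, two_smul, add_apply, sum_apply, one_apply_eq_self, map_add, map_sum,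
          inner_add_right, inner_sum, real_inner_self_eq_norm_sq]
        ring
      have i0 : Integrable (fun ω => ‖chain H Z 0 ω s (e i)‖ ^ 2) (seqLaw β) :=
        (h.memLp_chain_apply 0 s (e i)).integrable_norm_pow (by norm_num)
      simp_rw [e2]
      rw [integral_add i0 ((integrable_finsetSum _ fun k _ => i1 k).const_mul 2),
        integral_add i0 ((integrable_finsetSum _ fun k _ => i2 k).const_mul 2),
        integral_const_mul, integral_const_mul, integral_finsetSum _ fun k _ => i1 k,
        integral_finsetSum _ fun k _ => i2 k]
      simp_rw [h.integral_inner_chain_add]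
      rfl
    -- The diagonal entry uses the form `2K - 1 - 2 Hbⁿ⁺¹ K`. Its main part `2K` is bounded without
    -- a condition number, `-1` is dropped, and the last part is summable over `s`.
    have h1 : g i * inner ℝ (e i) (M (e i)) ≤ (2 + 2 * κ * ‖Hb‖ ^ (n + 1)) / κ₁ := by
      have e3 : M (e i) = (2 : ℝ) • K (e i) - e i - (2 : ℝ) • (Hb ^ (n + 1)) (K (e i)) := by
        rw [hM1]
        simp only [two_smul, sub_apply, add_apply, one_apply_eq_self]
        rfl
      have h2 : |inner ℝ (e i) ((Hb ^ (n + 1)) (K (e i)))| ≤ ‖Hb‖ ^ (n + 1) * ‖K (e i)‖ := by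
        refine (abs_real_inner_le_norm _ _).trans ?_
        rw [e.orthonormal.1 i, one_mul]
        exact ((Hb ^ (n + 1)).le_opNorm _).trans (by gcongr; exact norm_pow_op_le _ _)
      have h3 := mul_le_mul_of_nonneg_left (neg_le_of_abs_le h2) (hg0 i)
      have h4 := mul_le_mul_of_nonneg_left (hK2 i) (pow_nonneg (norm_nonneg Hb) (n + 1))
      rw [e3, inner_sub_right, inner_sub_right, inner_smul_right, inner_smul_right,
        real_inner_self_eq_norm_sq, e.orthonormal.1 i]
      have h5 := hK1 i
      have h6 := hg0 i
      have e4 : (2 + 2 * κ * ‖Hb‖ ^ (n + 1)) / κ₁ = 2 * (1 / κ₁) + 2 * (‖Hb‖ ^ (n + 1) * (κ / κ₁)) := by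
        ring
      rw [e4]
      nlinarith
    -- The norm uses the other form `(1 + Hb - 2 Hbⁿ⁺¹) K`, whose first factor has norm at most `4`.
    -- The factor `κ` is harmless here because the anisotropy multiplies it.
    have h2 : g i * ‖M (e i)‖ ≤ 4 * κ / κ₁ := by
      have h3 : ‖M (e i)‖ ≤ 4 * ‖K (e i)‖ := by
        have e3 : M (e i) = K (e i) + Hb (K (e i)) - (2 : ℝ) • (Hb ^ (n + 1)) (K (e i)) := by
          rw [hM2, two_smul, two_smul]; rfl
        have h4 : ‖Hb (K (e i))‖ ≤ ‖K (e i)‖ := by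
          simpa using Hb.le_of_opNorm_le hθ1 (K (e i))
        have h5 : ‖(Hb ^ (n + 1)) (K (e i))‖ ≤ ‖K (e i)‖ := by
          simpa using (Hb ^ (n + 1)).le_of_opNorm_le
            ((norm_pow_op_le _ _).trans (pow_le_one₀ (norm_nonneg _) hθ1)) (K (e i))
        have h6 : ‖(2 : ℝ) • (Hb ^ (n + 1)) (K (e i))‖ ≤ 2 * ‖K (e i)‖ := by
          rw [norm_smul, Real.norm_of_nonneg zero_le_two]; gcongr
        rw [e3]
        have h7 := norm_sub_le (K (e i) + Hb (K (e i))) ((2 : ℝ) • (Hb ^ (n + 1)) (K (e i)))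
        have h8 := norm_add_le (K (e i)) (Hb (K (e i)))
        linarith
      calc _ ≤ g i * (4 * ‖K (e i)‖) := mul_le_mul_of_nonneg_left h3 (hg0 i)
        _ = 4 * (g i * ‖K (e i)‖) := by ring
        _ ≤ 4 * (κ / κ₁) := by gcongr; exact hK2 i
        _ = _ := by ring
    rw [e1]
    have hpow : 0 ≤ (1 - ρ) ^ s := pow_nonneg (by linarith) s
    calc _ ≤ g i * (v * (inner ℝ (e i) (M (e i)) + (ε + (1 - ρ) ^ s) * ‖M (e i)‖)) :=
          mul_le_mul_of_nonneg_left
            (h.integral_inner_chain_le s (e.orthonormal.1 i) (M (e i))) (hg0 i)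
      _ = v * (g i * inner ℝ (e i) (M (e i)) + (ε + (1 - ρ) ^ s) * (g i * ‖M (e i)‖)) := by ring
      _ ≤ v * ((2 + 2 * κ * ‖Hb‖ ^ (n + 1)) / κ₁ + (ε + (1 - ρ) ^ s) * (4 * κ / κ₁)) := by
          gcongr
      _ = _ := by ring
  have e0 : ∀ ω : ℕ → 𝓑, ∑ i, g i * ‖(m⁻¹ • ∑ s ∈ Finset.Ioc a t, chain H Z 0 ω s) (e i)‖ ^ 2 =
      (m⁻¹) ^ 2 * ∑ s ∈ Finset.Ioc a t, ∑ i, g i * (‖chain H Z 0 ω s (e i)‖ ^ 2 +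
        2 * ∑ k ∈ Finset.range (t - s), inner ℝ (chain H Z 0 ω s (e i))
          (chain H Z 0 ω (s + (k + 1)) (e i))) := by
    intro ω
    rw [Finset.sum_comm, Finset.mul_sum]
    refine Finset.sum_congr rfl fun i _ => ?_
    rw [smul_apply, norm_smul, mul_pow, sum_apply, norm_sq_sum_Ioc _ hat.le, Real.norm_eq_abs,
      sq_abs, ← Finset.mul_sum]
    ring
  have i0 : ∀ s i, Integrable (fun ω => ‖chain H Z 0 ω s (e i)‖ ^ 2 +
        2 * ∑ k ∈ Finset.range (t - s), inner ℝ (chain H Z 0 ω s (e i))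
          (chain H Z 0 ω (s + (k + 1)) (e i))) (seqLaw β) := fun s i =>
    ((h.memLp_chain_apply 0 s (e i)).integrable_norm_pow (by norm_num)).add
      ((integrable_finsetSum _ fun k _ => h.integrable_inner_chain s (s + (k + 1)) (e i)
        (e i)).const_mul 2)
  simp_rw [e0]
  rw [integral_const_mul, integral_finsetSum _ fun s _ => integrable_finsetSum _ fun i _ =>
    (i0 s i).const_mul _]
  have hsum : ∑ s ∈ Finset.Ioc a t, ∫ ω, ∑ i, g i * (‖chain H Z 0 ω s (e i)‖ ^ 2 +
        2 * ∑ k ∈ Finset.range (t - s), inner ℝ (chain H Z 0 ω s (e i))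
          (chain H Z 0 ω (s + (k + 1)) (e i))) ∂seqLaw β ≤
      v * d / κ₁ * (2 * m + 2 * κ * (2 / ρ) + 4 * κ * (ε * m + 1 / ρ)) := by
    have hcard : ∑ _s ∈ Finset.Ioc a t, (1 : ℝ) = m := by
      simp [hm, Nat.cast_sub hat.le]
    -- Reversing the summation turns the distance to the end time `t` into the exponent of a
    -- geometric series with ratio at most `1 - ρ/2`.
    have hg1 : ∑ s ∈ Finset.Ioc a t, ‖Hb‖ ^ (t - s + 1) ≤ 2 / ρ := by
      have hr := sum_pow_le_of_le_one_sub (half_pos hρ) (norm_nonneg Hb) hθ (t - a)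
      rw [one_div_div] at hr
      refine le_trans ?_ hr
      rw [sum_Ioc_eq_sum_range, ← Finset.sum_range_reflect]
      refine Finset.sum_le_sum fun k hk => ?_
      have hk' := Finset.mem_range.1 hk
      exact pow_le_pow_of_le_one (norm_nonneg _) hθ1 (by omega)
    have hg2 : ∑ s ∈ Finset.Ioc a t, (1 - ρ) ^ s ≤ 1 / ρ := by
      refine le_trans ?_ (sum_pow_le_of_le_one_sub hρ (by linarith) le_rfl (t - a))
      rw [sum_Ioc_eq_sum_range]
      refine Finset.sum_le_sum fun k hk => ?_
      exact pow_le_pow_of_le_one (by linarith) (by linarith) (by omega)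
    calc _ ≤ ∑ s ∈ Finset.Ioc a t, ∑ _i : Fin d,
          v / κ₁ * (2 + 2 * κ * ‖Hb‖ ^ (t - s + 1) + 4 * κ * (ε + (1 - ρ) ^ s)) := by
          refine Finset.sum_le_sum fun s hs => ?_
          rw [integral_finsetSum _ fun i _ => (i0 s i).const_mul _]
          refine Finset.sum_le_sum fun i _ => ?_
          rw [integral_const_mul]
          exact key s hs i
      _ = v * d / κ₁ * (2 * ∑ _s ∈ Finset.Ioc a t, (1 : ℝ) +
            2 * κ * ∑ s ∈ Finset.Ioc a t, ‖Hb‖ ^ (t - s + 1) +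
            4 * κ * (ε * ∑ _s ∈ Finset.Ioc a t, (1 : ℝ) + ∑ s ∈ Finset.Ioc a t, (1 - ρ) ^ s)) := by
          have e3 : ∀ s ∈ Finset.Ioc a t, ∑ _i : Fin d,
              v / κ₁ * (2 + 2 * κ * ‖Hb‖ ^ (t - s + 1) + 4 * κ * (ε + (1 - ρ) ^ s)) =
              v * d / κ₁ * (2 + 4 * κ * ε) * 1 + (v * d / κ₁ * (2 * κ) * ‖Hb‖ ^ (t - s + 1) +
                v * d / κ₁ * (4 * κ) * (1 - ρ) ^ s) := fun s _ => by
            rw [Finset.sum_const, Finset.card_univ, Fintype.card_fin, nsmul_eq_mul]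
            ring
          rw [Finset.sum_congr rfl e3, Finset.sum_add_distrib, Finset.sum_add_distrib,
            ← Finset.mul_sum, ← Finset.mul_sum, ← Finset.mul_sum]
          ring
      _ ≤ _ := by
          rw [hcard]
          gcongr
  calc _ ≤ (m⁻¹) ^ 2 * (v * d / κ₁ * (2 * m + 2 * κ * (2 / ρ) + 4 * κ * (ε * m + 1 / ρ))) :=
        mul_le_mul_of_nonneg_left hsum (sq_nonneg _)
    _ = _ := by field_simp; ring

/-- The bias of the tail average. -/
lemma integral_average_bias_le (h : IsNoisyContraction β H Z v ε ρ)
    (e : OrthonormalBasis (Fin d) ℝ (Vec d)) (g : Fin d → ℝ) (hg0 : ∀ i, 0 ≤ g i)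
    (D : Op d) {a t : ℕ} (hat : a < t) :
    ∫ ω, ∑ i, g i * ‖(((t : ℝ) - a)⁻¹ • ∑ s ∈ Finset.Ioc a t, D * chain H 0 1 ω s) (e i)‖ ^ 2
        ∂seqLaw β ≤
      ‖D‖ ^ 2 * (∑ i, g i) * ((1 - ρ) ^ a / (ρ * ((t : ℝ) - a))) := by
  have hρ := h.ρ_pos
  have hρ1 := h.ρ_le_one
  have hm0 : (0 : ℝ) < t - a := by
    have : (a : ℝ) < t := by exact_mod_cast hat
    linarith
  set m : ℝ := t - a with hm
  have hcard : ((Finset.Ioc a t).card : ℝ) = m := by simp [hm, Nat.cast_sub hat.le]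
  have i1 : ∀ s i, Integrable (fun ω => ‖chain H 0 1 ω s (e i)‖ ^ 2) (seqLaw β) := fun s i =>
    (h.noiseless.memLp_chain_apply 1 s (e i)).integrable_norm_pow (by norm_num)
  have h1 : ∀ (ω : ℕ → 𝓑) i,
      ‖(m⁻¹ • ∑ s ∈ Finset.Ioc a t, D * chain H 0 1 ω s) (e i)‖ ^ 2 ≤
      m⁻¹ * ∑ s ∈ Finset.Ioc a t, ‖D‖ ^ 2 * ‖chain H 0 1 ω s (e i)‖ ^ 2 := by
    intro ω i
    rw [smul_apply, norm_smul, mul_pow, sum_apply, Real.norm_eq_abs, sq_abs]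
    -- Cauchy–Schwarz over the `m` averaged times suffices: squared biases form a geometric series,
    -- leaving a single factor `1 / m`.
    have h2 : ‖∑ s ∈ Finset.Ioc a t, (D * chain H 0 1 ω s) (e i)‖ ^ 2 ≤
        m * ∑ s ∈ Finset.Ioc a t, ‖D‖ ^ 2 * ‖chain H 0 1 ω s (e i)‖ ^ 2 := by
      calc _ ≤ (∑ s ∈ Finset.Ioc a t, ‖(D * chain H 0 1 ω s) (e i)‖) ^ 2 := by
            gcongr; exact norm_sum_le _ _
        _ ≤ m * ∑ s ∈ Finset.Ioc a t, ‖(D * chain H 0 1 ω s) (e i)‖ ^ 2 := by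
            rw [← hcard]; exact sq_sum_le_card_mul_sum_sq
        _ ≤ _ := by
            gcongr with s hs
            rw [← mul_pow]
            gcongr
            exact D.le_opNorm _
    calc _ ≤ m⁻¹ ^ 2 * (m * ∑ s ∈ Finset.Ioc a t, ‖D‖ ^ 2 * ‖chain H 0 1 ω s (e i)‖ ^ 2) :=
          mul_le_mul_of_nonneg_left h2 (sq_nonneg _)
      _ = _ := by field_simp
  have hg2 : ∑ s ∈ Finset.Ioc a t, (1 - ρ) ^ s ≤ (1 - ρ) ^ a * (1 / ρ) := by
    refine le_trans ?_ (mul_le_mul_of_nonneg_left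
      (sum_pow_le_of_le_one_sub hρ (by linarith) le_rfl (t - a)) (pow_nonneg (by linarith) a))
    rw [sum_Ioc_eq_sum_range, Finset.mul_sum]
    refine Finset.sum_le_sum fun k hk => ?_
    rw [← pow_add]
    exact pow_le_pow_of_le_one (by linarith) (by linarith) (by omega)
  calc _ ≤ ∫ ω, ∑ i, g i * (m⁻¹ * ∑ s ∈ Finset.Ioc a t, ‖D‖ ^ 2 * ‖chain H 0 1 ω s (e i)‖ ^ 2)
        ∂seqLaw β := by
        refine integral_mono_of_nonneg (ae_of_all _ fun ω => Finset.sum_nonneg fun i _ =>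
          mul_nonneg (hg0 i) (sq_nonneg _)) ?_ (ae_of_all _ fun ω => Finset.sum_le_sum fun i _ =>
          mul_le_mul_of_nonneg_left (h1 ω i) (hg0 i))
        exact integrable_finsetSum _ fun i _ => ((integrable_finsetSum _ fun s _ =>
          (i1 s i).const_mul _).const_mul _).const_mul _
    _ = ∑ i, g i * (m⁻¹ * ∑ s ∈ Finset.Ioc a t, ‖D‖ ^ 2 *
          ∫ ω, ‖chain H 0 1 ω s (e i)‖ ^ 2 ∂seqLaw β) := by
        rw [integral_finsetSum _ fun i _ => ((integrable_finsetSum _ fun s _ =>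
          (i1 s i).const_mul _).const_mul _).const_mul _]
        refine Finset.sum_congr rfl fun i _ => ?_
        rw [integral_const_mul, integral_const_mul,
          integral_finsetSum _ fun s _ => (i1 s i).const_mul _]
        simp_rw [integral_const_mul]
    _ ≤ ∑ i, g i * (m⁻¹ * ∑ s ∈ Finset.Ioc a t, ‖D‖ ^ 2 * (1 - ρ) ^ s) := by
        refine Finset.sum_le_sum fun i _ => mul_le_mul_of_nonneg_left ?_ (hg0 i)
        gcongr with s hs
        simpa [e.orthonormal.1 i] using h.integral_norm_sq_homogeneous_le s (e i)
    _ ≤ ∑ i, g i * (m⁻¹ * (‖D‖ ^ 2 * ((1 - ρ) ^ a * (1 / ρ)))) := by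
        refine Finset.sum_le_sum fun i _ => mul_le_mul_of_nonneg_left ?_ (hg0 i)
        rw [← Finset.mul_sum]
        gcongr
    _ = _ := by
        rw [← Finset.sum_mul]
        field_simp

end IsNoisyContraction

end RER

/-! ### Checking the contraction model on a truncated block. -/

namespace RER

variable {d : ℕ} {C : ℝ} {A : Op d} {μ π : Measure (Vec d)}

lemma sigmaMin_mul_norm_sq_le (hπ : MemLp (fun x : Vec d => x) 2 π) (x : Vec d) :
    sigmaMin (momentMatrix π) * ‖x‖ ^ 2 ≤ ∫ z, inner ℝ z x ^ 2 ∂π := by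
  obtain ⟨e, g, h1, -, -, h4, -⟩ := exists_eigenbasis hπ
  rw [h4, ← e.sum_sq_inner_right x, Finset.mul_sum]
  gcongr with i
  exact h1 i

lemma integrable_inner_clip_sq [IsProbabilityMeasure π] {r : ℝ} (hr : 0 < r) (x : Vec d) :
    Integrable (fun z => inner ℝ (clip r z) x ^ 2) π := by
  have hc := continuous_clip (d := d) hr
  refine Integrable.of_bound (C := (r * ‖x‖) ^ 2) (by fun_prop) (ae_of_all _ fun z => ?_)
  rw [norm_pow]
  gcongr
  exact (norm_inner_le_norm _ _).trans (by gcongr; exact norm_clip_le hr z)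

/-- Radial truncation at a high level keeps half of the second moments. -/
lemma SubGaussianLaw.half_le_integral_inner_clip_sq (h : SubGaussianLaw C π) (hd : 0 < d) {l : ℝ}
    (hl : 0 < l) (hlC : l * C ≤ 1 / 4) {r : ℝ} (hr : 0 < r)
    (htr : 4 / l * (momentMatrix π).trace * Real.exp (-(l * r / 2)) ≤
      sigmaMin (momentMatrix π) / 2) (x : Vec d) :
    1 / 2 * ∫ z, inner ℝ z x ^ 2 ∂π ≤
      ∫ z, inner ℝ (clip (√(r * (momentMatrix π).trace)) z) x ^ 2 ∂π := by
  have := h.isProb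
  have hRpos : 0 < r * (momentMatrix π).trace := mul_pos hr (h.trace_pos hd)
  set R := r * (momentMatrix π).trace
  set ψ : Vec d → ℝ := {z : Vec d | R < ‖z‖ ^ 2}.indicator (fun z => ‖z‖ ^ 2)
  have hm : MeasurableSet {z : Vec d | R < ‖z‖ ^ 2} :=
    measurableSet_lt measurable_const (by fun_prop)
  have hψ : Integrable ψ π := (integrable_norm_sq h.memLp).indicator hm
  have hc := integrable_inner_clip_sq (π := π) (Real.sqrt_pos.2 hRpos) x
  -- Truncation changes only vectors with `‖z‖² > R`, so the loss is at most the tail energy, which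
  -- `htr` makes at most half of the smallest second moment.
  have h1 : ∀ z, inner ℝ z x ^ 2 ≤ inner ℝ (clip (√R) z) x ^ 2 + ψ z * ‖x‖ ^ 2 := by
    intro z
    by_cases hz : R < ‖z‖ ^ 2
    · have : ψ z = ‖z‖ ^ 2 := Set.indicator_of_mem (by exact hz) _
      rw [this, ← mul_pow]
      have h2 : inner ℝ z x ^ 2 ≤ (‖z‖ * ‖x‖) ^ 2 := by
        rw [← sq_abs]
        exact pow_le_pow_left₀ (abs_nonneg _) (abs_real_inner_le_norm z x) 2
      linarith [sq_nonneg (inner ℝ (clip (√R) z) x)]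
    · have : ψ z = 0 := Set.indicator_of_notMem (by exact hz) _
      rw [this, clip_of_norm_le (Real.sqrt_pos.2 hRpos) (Real.le_sqrt_of_sq_le (not_lt.1 hz))]
      simp
  have hi : Integrable (fun z : Vec d => inner ℝ z x ^ 2) π := by
    simpa only [real_inner_comm] using (memLp_inner h.memLp x).integrable_sq
  have h2 : ∫ z, inner ℝ z x ^ 2 ∂π ≤
      ∫ z, inner ℝ (clip (√R) z) x ^ 2 ∂π + (∫ z, ψ z ∂π) * ‖x‖ ^ 2 := by
    rw [← integral_mul_const, ← integral_add hc (hψ.mul_const _)]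
    exact integral_mono hi (hc.add (hψ.mul_const _)) h1
  have h3 := mul_le_mul_of_nonneg_right
    ((h.integral_indicator_norm_sq_le hd hl hlC r).trans htr) (sq_nonneg ‖x‖)
  have h4 := sigmaMin_mul_norm_sq_le h.memLp x
  linarith

section Block

variable {γ R : ℝ} {u B : ℕ}

lemma integral_inner_blockState_sq [IsProbabilityMeasure μ] (hπ : IsStationaryLaw A μ π)
    (hR : 0 < R) (k : ℕ) (x : Vec d) :
    ∫ b, inner ℝ (blockState A R u b k) x ^ 2 ∂blockLaw μ π =
      ∫ z, inner ℝ (clip (√R) z) x ^ 2 ∂π := by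
  have := hπ.isProb
  have hc := continuous_clip (d := d) (Real.sqrt_pos.2 hR)
  have h := integral_map (μ := blockLaw μ π) (measurable_traj A (u + k)).aemeasurable
    (f := fun z => inner ℝ (clip (√R) z) x ^ 2) (by fun_prop)
  rw [map_traj hπ (u + k)] at h
  exact h.symm

lemma integrable_norm_sq_bufH_block [IsProbabilityMeasure μ] [IsProbabilityMeasure π] (hR : 0 < R)
    (hγ : 0 ≤ γ) (hγR : γ * R ≤ 1) (x : Vec d) :
    Integrable (fun b => ‖bufH γ (blockState A R u b) B x‖ ^ 2) (blockLaw μ π) := by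
  refine Integrable.of_bound (C := ‖x‖ ^ 2)
    (((measurable_bufH_blockState hR B).apply_continuousLinearMap x).norm.pow_const
      2).aestronglyMeasurable (ae_of_all _ fun b => ?_)
  rw [norm_pow, norm_norm]
  gcongr
  simpa using (bufH γ (blockState A R u b) B).le_of_opNorm_le
    (norm_bufH_le hγ hγR (norm_blockState_sq_le A hR u b)) x

lemma integrable_sum_inner_bufH_sq [IsProbabilityMeasure μ] [IsProbabilityMeasure π] (hR : 0 < R)
    (hγ : 0 ≤ γ) (hγR : γ * R ≤ 1) (x : Vec d) :
    Integrable (fun b => ∑ k ∈ Finset.range B,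
      (inner ℝ (blockState A R u b k) (bufH γ (blockState A R u b) k x) : ℝ) ^ 2)
      (blockLaw μ π) := by
  refine integrable_finsetSum _ fun k _ => ?_
  refine Integrable.of_bound (C := (√R * ‖x‖) ^ 2)
    (((measurable_blockState A hR u k).inner ((measurable_bufH_blockState hR
      k).apply_continuousLinearMap x)).pow_const 2).aestronglyMeasurable (ae_of_all _ fun b => ?_)
  rw [norm_pow]
  gcongr
  refine (norm_inner_le_norm _ _).trans ?_
  gcongr
  · exact norm_clip_le (Real.sqrt_pos.2 hR) _
  · simpa using (bufH γ (blockState A R u b) k).le_of_opNorm_le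
      (norm_bufH_le hγ hγR (norm_blockState_sq_le A hR u b)) x

/-- Mean loss of norm in one buffer. -/
lemma le_norm_sq_sub_integral_bufH_block (hμ : IsProbabilityMeasure μ)
    (hπ : IsStationaryLaw A μ π) (hR : 0 < R) (hγ : 0 ≤ γ) (hγR : γ * R ≤ 1 / 4)
    (hγB : γ * R * B ≤ 1 / 4) {q : ℝ} (x : Vec d)
    (hq : 1 / 2 * q ≤ ∫ z, inner ℝ (clip (√R) z) x ^ 2 ∂π) :
    2 * (3 / 10 * γ * B) * q ≤
      ‖x‖ ^ 2 - ∫ b, ‖bufH γ (blockState A R u b) B x‖ ^ 2 ∂blockLaw μ π := by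
  have := hπ.isProb
  have i1 := integrable_norm_sq_bufH_block (A := A) (μ := μ) (π := π) (u := u) (B := B) hR hγ
    (by linarith) x
  have hc := continuous_clip (d := d) (Real.sqrt_pos.2 hR)
  have i2 : ∀ k, Integrable (fun b => (inner ℝ (blockState A R u b k) x : ℝ) ^ 2)
      (blockLaw μ π) := by
    intro k
    refine Integrable.of_bound (C := (√R * ‖x‖) ^ 2)
      (((measurable_blockState A hR u k).inner_const).pow_const 2).aestronglyMeasurable
      (ae_of_all _ fun b => ?_)
    rw [norm_pow]
    gcongr
    refine (norm_inner_le_norm _ _).trans ?_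
    gcongr
    exact norm_clip_le (Real.sqrt_pos.2 hR) _
  have h1 : ∫ b, 6 / 5 * γ * ∑ k ∈ Finset.range B, inner ℝ (blockState A R u b k) x ^ 2
      ∂blockLaw μ π ≤ ∫ b, (‖x‖ ^ 2 - ‖bufH γ (blockState A R u b) B x‖ ^ 2) ∂blockLaw μ π :=
    integral_mono ((integrable_finsetSum _ fun k _ => i2 k).const_mul _)
      ((integrable_const _).sub i1)
      fun b => sum_inner_sq_le hγ (norm_blockState_sq_le A hR u b) hγB hγR x
  rw [integral_const_mul, integral_finsetSum _ fun k _ => i2 k,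
    integral_sub (integrable_const _) i1] at h1
  simp only [integral_inner_blockState_sq hπ hR, Finset.sum_const, Finset.card_range, nsmul_eq_mul,
    integral_const, probReal_univ, one_smul] at h1
  refine le_trans ?_ h1
  have h2 := mul_le_mul_of_nonneg_left hq (show 0 ≤ 6 / 5 * γ * B by positivity)
  linarith

lemma isNoisyContraction_block (hC : 0 < C) (hd : 0 < d) (hμ : IsNoiseLaw C μ) (hA : ‖A‖ < 1)
    (hπ : IsStationaryLaw A μ π) (hB : 0 < B) (hR : 0 < R) (hγ : 0 < γ) (hγB : γ * R * B ≤ 1 / 4)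
    (hclip : ∀ x, 1 / 2 * ∫ z, inner ℝ z x ^ 2 ∂π ≤ ∫ z, inner ℝ (clip (√R) z) x ^ 2 ∂π) :
    IsNoisyContraction (blockLaw μ π) (fun b => bufH γ (blockState A R u b) B)
      (fun b => bufZ γ (blockState A R u b) (blockNoise u b) B)
      (γ * (momentMatrix μ).trace) (1 / (3 * B))
      (6 / 10 * γ * B * sigmaMin (momentMatrix π)) := by
  have := hμ.isProb
  have := hπ.isProb
  have hμs := IsNoiseLaw.subGaussianLaw hμ hC
  have hπs := IsStationaryLaw.subGaussianLaw hC hμ hA hπ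
  have hB1 : (1 : ℝ) ≤ B := by exact_mod_cast hB
  have hγR0 : 0 < γ * R := mul_pos hγ hR
  have hγR : γ * R ≤ 1 / 4 := (le_mul_of_one_le_right hγR0.le hB1).trans hγB
  have hσ := hπs.sigmaMin_pos hd
  have htr := hμs.trace_pos hd
  set w : Block d → ℕ → Vec d := fun b => blockState A R u b with hw
  have hwR : ∀ b k, ‖w b k‖ ^ 2 ≤ R := norm_blockState_sq_le A hR u
  have iH := fun x => integrable_norm_sq_bufH_block (A := A) (μ := μ) (π := π) (u := u) (B := B)
    hR hγ.le (by linarith) x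
  have iS := fun x => integrable_sum_inner_bufH_sq (A := A) (μ := μ) (π := π) (u := u) (B := B)
    hR hγ.le (by linarith) x
  have hsub : ∀ x, ‖x‖ ^ 2 - ∫ b, ‖bufH γ (w b) B x‖ ^ 2 ∂blockLaw μ π =
      ∫ b, (‖x‖ ^ 2 - ‖bufH γ (w b) B x‖ ^ 2) ∂blockLaw μ π := fun x => by
    rw [integral_sub (integrable_const _) (iH x)]; simp [hw]
  have hZ := fun x => integral_norm_sq_bufZ_block (A := A) (u := u) (π := π) hR hγ.le
    (by linarith) hμs.memLp hμ.mean_zero B x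
  have hcon : ∀ x, ∫ b, ‖bufH γ (w b) B x‖ ^ 2 ∂blockLaw μ π ≤
      (1 - 6 / 10 * γ * B * sigmaMin (momentMatrix π)) * ‖x‖ ^ 2 := by
    intro x
    have h1 := le_norm_sq_sub_integral_bufH_block hμ.isProb hπ hR hγ.le hγR hγB (u := u) x
      (hclip x)
    have h2 := mul_le_mul_of_nonneg_left (sigmaMin_mul_norm_sq_le hπs.memLp x)
      (show 0 ≤ 6 / 10 * γ * B by positivity)
    simp only [hw]
    linarith
  refine ⟨measurable_bufH_blockState hR B, measurable_bufZ_block hR B,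
    fun b => norm_bufH_le hγ.le (by linarith) (hwR b), memLp_bufZ_block hR hγ.le (by linarith)
      hμs.memLp B, integral_bufZ_block hR hγ.le (by linarith) hμs.memLp hμ.mean_zero B,
    fun x => ?_, fun x => ?_, hcon, by positivity, by positivity, by positivity, ?_⟩
  · rw [hZ, hsub]
    have h1 := integral_mono ((integrable_const _).sub (iH x)) ((iS x).const_mul (4 * γ))
      fun b => norm_sq_sub_bufH_le (w := w b) (B := B) hγ.le x
    rw [integral_const_mul] at h1
    have h2 := mul_le_mul_of_nonneg_left h1 (show 0 ≤ γ * (momentMatrix μ).trace by positivity)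
    calc _ ≤ _ := h2
      _ = _ := by ring
  · rw [hZ, hsub]
    have h1 := integral_mono ((iS x).const_mul (4 * γ * (1 - γ * R)))
      ((integrable_const _).sub (iH x)) fun b => le_norm_sq_sub_bufH (B := B) hγ.le (hwR b) x
    rw [integral_const_mul] at h1
    set I := ∫ b, ∑ j ∈ Finset.range B, inner ℝ (w b j) (bufH γ (w b) j x) ^ 2 ∂blockLaw μ π
    have hI : 0 ≤ I := integral_nonneg fun b => Finset.sum_nonneg fun _ _ => sq_nonneg _
    have h2 := mul_le_mul_of_nonneg_left h1
      (show 0 ≤ (1 + 1 / (3 * (B : ℝ))) * (γ * (momentMatrix μ).trace) by positivity)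
    refine le_trans ?_ h2
    -- Origin of `ε = 1 / (3B)`: it compensates the factor `1 - γ R` with `γ R ≤ 1 / (4B)`, and
    -- equality is possible at `B = 1`.
    have h3 : 1 ≤ (1 + 1 / (3 * (B : ℝ))) * (1 - γ * R) := by
      have h4 : γ * R ≤ 1 / (4 * B) := by
        rw [le_div_iff₀ (by positivity)]; linarith
      have h5 : 1 ≤ (1 + 1 / (3 * (B : ℝ))) * (1 - 1 / (4 * B)) := by
        have : (1 + 1 / (3 * (B : ℝ))) * (1 - 1 / (4 * B)) - 1 = (B - 1) / (12 * (B : ℝ) ^ 2) := by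
          field_simp; ring
        have : 0 ≤ (B - 1) / (12 * (B : ℝ) ^ 2) := div_nonneg (by linarith) (by positivity)
        linarith
      exact h5.trans (by gcongr)
    have h6 := mul_le_mul_of_nonneg_left h3
      (show 0 ≤ 4 * γ ^ 2 * (momentMatrix μ).trace * I by positivity)
    calc _ = 4 * γ ^ 2 * (momentMatrix μ).trace * I * 1 := by ring
      _ ≤ _ := h6
      _ = _ := by ring
  · have h1 := hcon (EuclideanSpace.single ⟨0, hd⟩ (1 : ℝ))
    have h2 : 0 ≤ ∫ b, ‖bufH γ (w b) B (EuclideanSpace.single ⟨0, hd⟩ (1 : ℝ))‖ ^ 2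
      ∂blockLaw μ π := integral_nonneg fun _ => sq_nonneg _
    simp only [PiLp.norm_single, norm_one, one_pow, mul_one] at h1
    linarith

end Block

end RER

namespace RER

variable {d : ℕ} {A : Op d} {μ π : Measure (Vec d)}

/-! ### Reduction to a canonical probability space. -/

section Transfer

variable {Ω Ω' : Type*} [MeasurableSpace Ω] [MeasurableSpace Ω'] {P : Measure Ω} {P' : Measure Ω'}
  [IsProbabilityMeasure P] [IsProbabilityMeasure P'] {T : ℕ} {X η : ℕ → Ω → Vec d}
  {X' η' : ℕ → Ω' → Vec d}

lemma IsStationaryVAR.map_eq [SigmaFinite μ] (h : IsStationaryVAR A μ π P T X η) :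
    P.map (fun ω => (X 0 ω, fun τ : Fin T => η τ ω)) = π.prod (Measure.pi fun _ => μ) := by
  have hm : ∀ τ : Fin T, Measurable (η τ) := fun τ => h.measurable_noise τ τ.2
  rw [(indepFun_iff_map_prod_eq_prod_map_map h.measurable_init.aemeasurable
      (measurable_pi_lambda _ hm).aemeasurable).1 h.indep_init, h.law_init,
    (iIndepFun_iff_map_fun_eq_pi_map fun τ => (hm τ).aemeasurable).1 h.indep_noise]
  congr
  funext τ
  exact h.law_noise τ τ.2

/-- The trajectory as a function of the initial state and the noise. -/
noncomputable def path (A : Op d) (T : ℕ) (z : Vec d × (Fin T → Vec d)) (τ : ℕ) : Vec d :=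
  traj A z.1 (fun j => if h : j < T then z.2 ⟨j, h⟩ else 0) τ

lemma measurable_path (A : Op d) (T τ : ℕ) : Measurable fun z => path A T z τ := by
  induction τ with
  | zero => exact measurable_fst
  | succ τ ih =>
    refine (A.continuous.measurable.comp ih).add ?_
    dsimp only
    split_ifs with h
    · exact (measurable_pi_apply _).comp measurable_snd
    · exact measurable_const

lemma IsStationaryVAR.eq_path (h : IsStationaryVAR A μ π P T X η) {τ : ℕ} (hτ : τ ≤ T) (ω : Ω) :
    X τ ω = path A T (X 0 ω, fun τ : Fin T => η τ ω) τ := by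
  induction τ with
  | zero => rfl
  | succ τ ih =>
    rw [h.step τ hτ, ih (by omega)]
    change _ = A (path A T _ τ) + if h : τ < T then η τ ω else 0
    rw [dif_pos (show τ < T from hτ)]

/-- The trajectory up to `T` is a fixed function of the initial state and the noise, whose joint law
is the product of `π` and copies of `μ` on either space. -/
lemma IsStationaryVAR.transfer [SigmaFinite μ] (h : IsStationaryVAR A μ π P T X η)
    (h' : IsStationaryVAR A μ π P' T X' η') {f : (ℕ → Vec d) → ℝ} (hf : Measurable f)
    (hdep : ∀ x y : ℕ → Vec d, (∀ τ ≤ T, x τ = y τ) → f x = f y)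
    (hint : Integrable (fun ω => f fun τ => X' τ ω) P') :
    Integrable (fun ω => f fun τ => X τ ω) P ∧
      ∫ ω, f (fun τ => X τ ω) ∂P = ∫ ω, f (fun τ => X' τ ω) ∂P' := by
  have hF : Measurable fun z => f (path A T z) :=
    hf.comp (measurable_pi_lambda _ (measurable_path A T))
  have e1 : (fun ω => f fun τ => X τ ω) =
      (fun z => f (path A T z)) ∘ fun ω => (X 0 ω, fun τ : Fin T => η τ ω) :=
    funext fun ω => hdep _ _ fun τ hτ => IsStationaryVAR.eq_path h hτ ω
  have e2 : (fun ω => f fun τ => X' τ ω) =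
      (fun z => f (path A T z)) ∘ fun ω => (X' 0 ω, fun τ : Fin T => η' τ ω) :=
    funext fun ω => hdep _ _ fun τ hτ => IsStationaryVAR.eq_path h' hτ ω
  have m1 : Measurable fun ω => (X 0 ω, fun τ : Fin T => η τ ω) :=
    h.measurable_init.prodMk (measurable_pi_lambda _ fun τ => h.measurable_noise τ τ.2)
  have m2 : Measurable fun ω => (X' 0 ω, fun τ : Fin T => η' τ ω) :=
    h'.measurable_init.prodMk (measurable_pi_lambda _ fun τ => h'.measurable_noise τ τ.2)
  rw [e2, ← integrable_map_measure hF.aestronglyMeasurable m2.aemeasurable,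
    IsStationaryVAR.map_eq h'] at hint
  constructor
  · rwa [e1, ← integrable_map_measure hF.aestronglyMeasurable m1.aemeasurable,
      IsStationaryVAR.map_eq h]
  · rw [e1, e2]
    simp only [Function.comp_def]
    rw [← integral_map m1.aemeasurable hF.aestronglyMeasurable,
      ← integral_map m2.aemeasurable hF.aestronglyMeasurable, IsStationaryVAR.map_eq h,
      IsStationaryVAR.map_eq h']

end Transfer

/-! ### Measurability and locality of the algorithm. -/

section Measurability

variable {R γ : ℝ} {B u a t : ℕ} {A₀ : Op d}

lemma bufferPass_congr {x y : ℕ → Vec d} {s S : ℕ} (M : Op d)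
    (h : ∀ τ ≤ s + S, x τ = y τ) (i : ℕ) :
    bufferPass γ x s S M i = bufferPass γ y s S M i := by
  induction i with
  | zero => rfl
  | succ i ih => rw [bufferPass, bufferPass, ih, h _ (by omega), h _ (by omega)]

lemma rerIterate_congr {x y : ℕ → Vec d} (h : ∀ τ ≤ t * (B + u), x τ = y τ) :
    rerIterate γ B u A₀ x t = rerIterate γ B u A₀ y t := by
  induction t with
  | zero => rfl
  | succ t ih =>
    have e : (t + 1) * (B + u) = t * (B + u) + (B + u) := by ring
    rw [e] at h
    rw [rerIterate, rerIterate, ih fun τ hτ => h τ (by omega), bufferPass_congr _ h]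

lemma rerOutput_congr {x y : ℕ → Vec d} (h : ∀ τ ≤ t * (B + u), x τ = y τ) :
    rerOutput R γ B u a t A₀ x = rerOutput R γ B u a t A₀ y := by
  have h1 : (∀ τ < t * (B + u), ‖x τ‖ ^ 2 ≤ R) ↔ ∀ τ < t * (B + u), ‖y τ‖ ^ 2 ≤ R :=
    forall₂_congr fun τ hτ => by rw [h τ hτ.le]
  have h2 : ∑ s ∈ Finset.Ioc a t, rerIterate γ B u A₀ x s =
      ∑ s ∈ Finset.Ioc a t, rerIterate γ B u A₀ y s :=
    Finset.sum_congr rfl fun s hs => rerIterate_congr fun τ hτ => h τ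
      (hτ.trans (Nat.mul_le_mul_right _ (Finset.mem_Ioc.1 hs).2))
  simp only [rerOutput, h1, h2]

lemma measurable_bufferPass {𝓧 : Type*} [MeasurableSpace 𝓧] {x : 𝓧 → ℕ → Vec d} {M : 𝓧 → Op d}
    (hx : ∀ τ, Measurable fun ω => x ω τ) (hM : Measurable M) (s S i : ℕ) :
    Measurable fun ω => bufferPass γ (x ω) s S (M ω) i := by
  induction i with
  | zero => exact hM
  | succ i ih =>
    have h2 : Continuous fun p : Op d × Vec d × Vec d => p.1 p.2.1 - p.2.2 :=
      (continuous_fst.clm_apply (continuous_fst.comp continuous_snd)).sub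
        (continuous_snd.comp continuous_snd)
    have h3 : Continuous fun p : Op d × Vec d × Vec d =>
        InnerProductSpace.rankOne ℝ (p.1 p.2.1 - p.2.2) p.2.1 :=
      ((InnerProductSpace.rankOne ℝ).continuous.comp h2).clm_apply
        (continuous_fst.comp continuous_snd)
    have h4 : Continuous fun p : Op d × Vec d × Vec d => sgdStep γ p.1 p.2.1 p.2.2 := by
      unfold sgdStep
      exact continuous_fst.sub (h3.const_smul (2 * γ))
    exact h4.measurable.comp (ih.prodMk ((hx (s + S - 1 - i)).prodMk (hx (s + S - i))))

lemma measurable_rerIterate (t : ℕ) :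
    Measurable fun x : ℕ → Vec d => rerIterate γ B u A₀ x t := by
  induction t with
  | zero => exact measurable_const
  | succ t ih => exact measurable_bufferPass (fun τ => measurable_pi_apply τ) ih _ _ _

lemma measurableSet_bounded : MeasurableSet {x : ℕ → Vec d | ∀ τ < t, ‖x τ‖ ^ 2 ≤ R} := by
  have e : {x : ℕ → Vec d | ∀ τ < t, ‖x τ‖ ^ 2 ≤ R} =
      ⋂ τ, ⋂ _ : τ < t, {x : ℕ → Vec d | ‖x τ‖ ^ 2 ≤ R} := by ext; simp
  rw [e]
  exact MeasurableSet.iInter fun τ => MeasurableSet.iInter fun _ =>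
    measurableSet_le ((measurable_pi_apply τ).norm.pow_const 2) measurable_const

lemma measurable_rerOutput :
    Measurable fun x : ℕ → Vec d => rerOutput R γ B u a t A₀ x := by
  unfold rerOutput
  refine Measurable.ite measurableSet_bounded ?_ measurable_const
  exact (continuous_const_smul (((t : ℝ) - a)⁻¹)).measurable.comp
    (Finset.measurable_sum _ fun s _ => measurable_rerIterate s)

end Measurability

/-! ### The canonical process built from i.i.d. blocks. -/

section Canonical

variable [IsProbabilityMeasure μ] [IsProbabilityMeasure π]

/-- The noise of the canonical process with buffers of length `S`. -/
def canonNoise (S : ℕ) (τ : ℕ) (ω : ℕ → Block d) : Vec d := ω (τ / S) (some (τ % S))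

/-- The canonical process with buffers of length `S`. -/
noncomputable def canonState (A : Op d) (S : ℕ) (τ : ℕ) (ω : ℕ → Block d) : Vec d :=
  traj A (ω 0 none) (fun j => canonNoise S j ω) τ

lemma iIndepFun_coord : iIndepFun (fun (p : ℕ × Option ℕ) (ω : ℕ → Block d) => ω p.1 p.2)
    (seqLaw (blockLaw μ π)) :=
  iIndepFun_uncurry_infinitePi' (X := fun _ _ x => x)
    (fun (_ : ℕ) (o : Option ℕ) => (o.elim π fun _ => μ : Measure (Vec d)))
    (fun _ _ => measurable_id)

lemma map_coord (i : ℕ) (o : Option ℕ) :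
    (seqLaw (blockLaw μ π)).map (fun ω => ω i o) = (o.elim π fun _ => μ : Measure (Vec d)) := by
  have h1 := (measurePreserving_eval_infinitePi (fun _ : ℕ => blockLaw μ π) i)
  have h2 := (measurePreserving_eval_infinitePi
    (fun o : Option ℕ => (o.elim π fun _ => μ : Measure (Vec d))) o)
  exact (h2.comp h1).map_eq

lemma measurable_coord (i : ℕ) (o : Option ℕ) : Measurable fun ω : ℕ → Block d => ω i o :=
  (measurable_pi_apply o).comp (measurable_pi_apply i)

/-- The process reads distinct independent coordinates: `(0, none)` at the start and `(τ / S, some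
(τ % S))` at time `τ`. The coordinates `(s, none)` with `s ≥ 1` stay unused and serve as independent
restarts. For `S = 0` everything lies in block `0`, and injectivity still holds. -/
lemma isStationaryVAR_canon (S T : ℕ) :
    IsStationaryVAR A μ π (seqLaw (blockLaw μ π)) T (canonState A S) (canonNoise S) := by
  set f : Option (Fin T) → ℕ × Option ℕ := fun o =>
    o.elim (0, none) fun τ => (τ / S, some (τ % S)) with hf
  have hinj : Function.Injective f := by
    intro o o' h
    rcases o with _ | τ <;> rcases o' with _ | τ' <;> simp [hf] at h ⊢
    · have h1 := Nat.div_add_mod (τ : ℕ) S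
      have h2 := Nat.div_add_mod (τ' : ℕ) S
      rw [h.1, h.2] at h1
      exact Fin.ext (h1.symm.trans h2)
  have hind : iIndepFun (fun (o : Option (Fin T)) (ω : ℕ → Block d) => ω (f o).1 (f o).2)
      (seqLaw (blockLaw μ π)) := iIndepFun_coord.precomp hinj
  have hind' := hind.indepFun_finset {none} (Finset.univ.erase none) (by simp)
    fun o => measurable_coord _ _
  refine ⟨measurable_coord 0 none, map_coord 0 none, fun τ _ => measurable_coord _ _,
    fun τ _ => map_coord _ _, hind.precomp (Option.some_injective _), ?_, fun τ _ ω => rfl⟩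
  exact hind'.comp (φ := fun x => x ⟨none, by simp⟩)
    (ψ := fun x (τ : Fin T) => x ⟨some τ, by simp⟩)
    (show Measurable fun x : (({none} : Finset (Option (Fin T))) → Vec d) => x ⟨none, by simp⟩ from
      measurable_pi_apply _) (measurable_pi_lambda _ fun τ => measurable_pi_apply _)

/-- Inside the buffer `s` the canonical process is the trajectory started from its state at time
`s S`. -/
lemma canonState_add (A : Op d) {S : ℕ} (s : ℕ) {k : ℕ} (hk : k ≤ S) (ω : ℕ → Block d) :
    canonState A S (s * S + k) ω =
      traj A (canonState A S (s * S) ω) (fun j => ω s (some j)) k := by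
  rw [canonState, traj_add]
  refine traj_congr A rfl fun j hj => ?_
  have hS : 0 < S := by omega
  have hjS : j < S := by omega
  rw [canonNoise, mul_comm s S, Nat.mul_add_div hS, Nat.div_eq_of_lt hjS, add_zero,
    Nat.mul_add_mod, Nat.mod_eq_of_lt hjS]

lemma IsStationaryVAR.map_eq_map_path {Ω : Type*} [MeasurableSpace Ω] {P : Measure Ω}
    [IsProbabilityMeasure P] {T : ℕ} {X η : ℕ → Ω → Vec d} (h : IsStationaryVAR A μ π P T X η)
    {τ : ℕ} (hτ : τ ≤ T) :
    P.map (X τ) = (π.prod (Measure.pi fun _ => μ)).map fun z => path A T z τ := by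
  have m : Measurable fun ω => (X 0 ω, fun τ : Fin T => η τ ω) :=
    h.measurable_init.prodMk (measurable_pi_lambda _ fun τ => h.measurable_noise τ τ.2)
  rw [← IsStationaryVAR.map_eq h, Measure.map_map (measurable_path A T τ) m]
  congr 1
  exact funext fun ω => IsStationaryVAR.eq_path h hτ ω

/-- Every state of a stationary trajectory has the stationary law. -/
lemma IsStationaryVAR.map_state {Ω : Type*} [MeasurableSpace Ω] {P : Measure Ω}
    [IsProbabilityMeasure P] {T : ℕ} {X η : ℕ → Ω → Vec d} (h : IsStationaryVAR A μ π P T X η)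
    (hπ : IsStationaryLaw A μ π) {τ : ℕ} (hτ : τ ≤ T) : P.map (X τ) = π := by
  rw [IsStationaryVAR.map_eq_map_path h hτ,
    ← IsStationaryVAR.map_eq_map_path (isStationaryVAR_canon (A := A) (π := π) (μ := μ) τ T) hτ]
  -- With buffer length `τ`, time `τ` is the end of the first buffer, so the state is a trajectory
  -- of the single block `ω 0`.
  have e : canonState A τ τ =
      (fun b : Block d => traj A (b none) (fun j => b (some j)) τ) ∘ fun ω => ω 0 := by
    funext ω
    have := canonState_add A 0 le_rfl (S := τ) ω
    simpa [show canonState A τ 0 ω = ω 0 none from rfl] using this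
  rw [e, ← Measure.map_map (measurable_traj A τ) (measurable_pi_apply 0),
    Measure.infinitePi_map_eval, map_traj hπ]

lemma measurable_canonState (A : Op d) (S τ : ℕ) : Measurable (canonState A S τ) := by
  induction τ with
  | zero => exact measurable_coord 0 none
  | succ τ ih => exact (A.continuous.measurable.comp ih).add (measurable_coord _ _)

end Canonical

end RER

/-! ### Coupling the true buffers with independently restarted ones. -/

namespace RER

variable {d : ℕ} {A : Op d} {μ π : Measure (Vec d)} {γ R : ℝ} {u B : ℕ}

/-- The contraction of one buffer. -/
noncomputable def blockH (A : Op d) (γ R : ℝ) (u B : ℕ) (b : Block d) : Op d :=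
  bufH γ (blockState A R u b) B

/-- The noise of one buffer. -/
noncomputable def blockZ (A : Op d) (γ R : ℝ) (u B : ℕ) (b : Block d) : Op d :=
  bufZ γ (blockState A R u b) (blockNoise u b) B

/-- The blocks of the canonical process: as `ω`, but started from the current state. -/
noncomputable def blocks (A : Op d) (S : ℕ) (ω : ℕ → Block d) (s : ℕ) : Block d
  | none => canonState A S (s * S) ω
  | some j => ω s (some j)

section Deterministic

lemma norm_pow_add_le (hA : ‖A‖ ≤ 1) (u k : ℕ) : ‖A ^ (u + k)‖ ≤ ‖A ^ u‖ := by
  rw [pow_add]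
  exact (norm_mul_le _ _).trans (mul_le_of_le_one_right (norm_nonneg _)
    ((norm_pow_op_le A k).trans (pow_le_one₀ (norm_nonneg _) hA)))

/-- The noise cancels in the difference, which is propagated by `A ^ (u + k)`; truncation costs the
factor `2`. -/
lemma norm_blockState_sub_le (hA : ‖A‖ ≤ 1) (hR : 0 < R) {b b' : Block d}
    (h : ∀ j, b' (some j) = b (some j)) (k : ℕ) :
    ‖blockState A R u b' k - blockState A R u b k‖ ≤ 2 * (‖A ^ u‖ * ‖b' none - b none‖) := by
  refine (norm_clip_sub_le (Real.sqrt_pos.2 hR) _ _).trans ?_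
  simp only [h, traj_sub]
  gcongr
  exact ((A ^ (u + k)).le_opNorm _).trans (by gcongr; exact norm_pow_add_le hA u k)

lemma norm_chain_block_le (hR : 0 < R) (hγ : 0 ≤ γ) (hγR : γ * R ≤ 1) (D : Op d)
    (ω : ℕ → Block d) (s : ℕ) :
    ‖chain (blockH A γ R u B) (blockZ A γ R u B) D ω s‖ ≤ ‖D‖ + 2 * γ * √R *
      ∑ r ∈ Finset.range s, ∑ k ∈ Finset.range B, ‖blockNoise u (ω r) k‖ := by
  induction s with
  | zero => simp [chain]
  | succ s ih =>
    rw [Finset.sum_range_succ, mul_add, ← add_assoc]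
    refine (norm_add_le _ _).trans (add_le_add (((norm_mul_le _ _).trans ?_).trans ih)
      (norm_bufZ_le hγ hγR (norm_blockState_sq_le A hR u _) _))
    exact mul_le_of_le_one_right (norm_nonneg _)
      (norm_bufH_le hγ hγR (norm_blockState_sq_le A hR u _))

/-- Two chains with the same noise and different restarts stay close. -/
lemma norm_chain_block_sub_le (hA : ‖A‖ ≤ 1) (hR : 0 < R) (hγ : 0 ≤ γ) (hγR : γ * R ≤ 1)
    (hγB : γ * R * B ≤ 1 / 4) (D : Op d) {ω ω' : ℕ → Block d}
    (h : ∀ r j, ω' r (some j) = ω r (some j)) {s t : ℕ} (hst : s ≤ t) {V : ℝ}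
    (hV : V = ‖D‖ + 2 * γ * √R *
      ∑ r ∈ Finset.range t, ∑ k ∈ Finset.range B, ‖blockNoise u (ω r) k‖) :
    ‖chain (blockH A γ R u B) (blockZ A γ R u B) D ω' s -
        chain (blockH A γ R u B) (blockZ A γ R u B) D ω s‖ * √R ≤
      6 * ‖A ^ u‖ * V * ∑ r ∈ Finset.range s, ‖ω' r none - ω r none‖ := by
  have hsR := Real.sqrt_pos.2 hR
  have hW0 : ∀ r, 0 ≤ ∑ k ∈ Finset.range B, ‖blockNoise u (ω r) k‖ := fun r =>
    Finset.sum_nonneg fun _ _ => norm_nonneg _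
  have hV0 : 0 ≤ V := by
    rw [hV]
    have := Finset.sum_nonneg fun r (_ : r ∈ Finset.range t) => hW0 r
    positivity
  induction s with
  | zero => simp [chain]
  | succ s ih =>
    have ih := ih (by omega)
    set c' := chain (blockH A γ R u B) (blockZ A γ R u B) D ω' s
    set c := chain (blockH A γ R u B) (blockZ A γ R u B) D ω s with hc
    set W := ∑ k ∈ Finset.range B, ‖blockNoise u (ω s) k‖ with hW
    set δ := 2 * (‖A ^ u‖ * ‖ω' s none - ω s none‖) with hδ
    have hδ0 : 0 ≤ δ := by positivity
    have hcV : ‖c‖ ≤ V := by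
      rw [hV]
      refine (norm_chain_block_le hR hγ hγR D ω s).trans ?_
      gcongr
      omega
    have hWV : 2 * γ * √R * W ≤ V := by
      rw [hV]
      have h1 : W ≤ ∑ r ∈ Finset.range t, ∑ k ∈ Finset.range B, ‖blockNoise u (ω r) k‖ :=
        Finset.single_le_sum (f := fun r => ∑ k ∈ Finset.range B, ‖blockNoise u (ω r) k‖)
          (fun r _ => hW0 r) (Finset.mem_range.2 (by omega))
      have h2 : 2 * γ * √R * W ≤ 2 * γ * √R *
        ∑ r ∈ Finset.range t, ∑ k ∈ Finset.range B, ‖blockNoise u (ω r) k‖ := by gcongr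
      linarith [norm_nonneg D]
    have hw := norm_blockState_sq_le A hR u (ω s)
    have hw' := norm_blockState_sq_le A hR u (ω' s)
    have hd : ∀ k, ‖blockState A R u (ω' s) k - blockState A R u (ω s) k‖ ≤ δ :=
      norm_blockState_sub_le hA hR (h s)
    have hH : ‖blockH A γ R u B (ω' s) - blockH A γ R u B (ω s)‖ ≤ 4 * γ * √R * B * δ :=
      norm_bufH_sub_le hγ hγR hw' hw hd
    have hZ : ‖blockZ A γ R u B (ω' s) - blockZ A γ R u B (ω s)‖ ≤ 4 * γ * δ * W := by
      have e : blockNoise u (ω' s) = blockNoise u (ω s) := funext fun k => h s _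
      unfold blockZ
      rw [e]
      exact norm_bufZ_sub_le hγ hγR hw' hw hd hγB _
    have hH1 : ‖blockH A γ R u B (ω' s)‖ ≤ 1 := norm_bufH_le hγ hγR hw'
    have e : chain (blockH A γ R u B) (blockZ A γ R u B) D ω' (s + 1) -
        chain (blockH A γ R u B) (blockZ A γ R u B) D ω (s + 1) =
        (c' - c) * blockH A γ R u B (ω' s) +
          c * (blockH A γ R u B (ω' s) - blockH A γ R u B (ω s)) +
          (blockZ A γ R u B (ω' s) - blockZ A γ R u B (ω s)) := by
      rw [chain, chain, sub_mul, mul_sub]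
      abel
    have h1 : ‖chain (blockH A γ R u B) (blockZ A γ R u B) D ω' (s + 1) -
        chain (blockH A γ R u B) (blockZ A γ R u B) D ω (s + 1)‖ ≤
        ‖c' - c‖ + V * (4 * γ * √R * B * δ) + 4 * γ * δ * W := by
      rw [e]
      refine (norm_add₃_le).trans (add_le_add (add_le_add ?_ ?_) hZ)
      · exact (norm_mul_le _ _).trans (mul_le_of_le_one_right (norm_nonneg _) hH1)
      · exact (norm_mul_le _ _).trans (by gcongr)
    have h2 : √R * √R = R := Real.mul_self_sqrt hR.le
    rw [Finset.sum_range_succ, mul_add]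
    -- The number `V` dominates both the iterate and the noise of one block. The new errors total at
    -- most `V δ + 2 V δ`, and `δ` contains a factor `2`; hence the `6`.
    calc _ ≤ (‖c' - c‖ + V * (4 * γ * √R * B * δ) + 4 * γ * δ * W) * √R := by gcongr
      _ = ‖c' - c‖ * √R + V * δ * (4 * (γ * (√R * √R) * B)) + 2 * δ * (2 * γ * √R * W) := by ring
      _ ≤ 6 * ‖A ^ u‖ * V * ∑ r ∈ Finset.range s, ‖ω' r none - ω r none‖ + V * δ * (4 * (1 / 4)) +
          2 * δ * V := by
          rw [h2]
          gcongr
      _ = _ := by rw [hδ]; ring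

/-- One factor of the square is bounded trivially by `2V`, the other by the coupling. So only second
moments of the restarts are needed, at the price of a single power of `‖A ^ u‖`. The weight `t`
balances `V⁴`, of order `t⁴`, against a squared sum of `t` restart errors. -/
lemma norm_sq_chain_block_sub_le (hA : ‖A‖ ≤ 1) (hR : 0 < R) (hγ : 0 ≤ γ) (hγR : γ * R ≤ 1)
    (hγB : γ * R * B ≤ 1 / 4) (D : Op d) {ω ω' : ℕ → Block d}
    (h : ∀ r j, ω' r (some j) = ω r (some j)) {s t : ℕ} (hst : s ≤ t) (ht : 0 < t) {V : ℝ}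
    (hV : V = ‖D‖ + 2 * γ * √R *
      ∑ r ∈ Finset.range t, ∑ k ∈ Finset.range B, ‖blockNoise u (ω r) k‖) :
    ‖chain (blockH A γ R u B) (blockZ A γ R u B) D ω' s -
        chain (blockH A γ R u B) (blockZ A γ R u B) D ω s‖ ^ 2 ≤
      ‖A ^ u‖ * (6 * (V ^ 4 / t +
        t * (∑ r ∈ Finset.range t, ‖ω' r none - ω r none‖) ^ 2 / R)) := by
  have hsR := Real.sqrt_pos.2 hR
  have ht0 : (0 : ℝ) < t := by exact_mod_cast ht
  set Δ := ‖chain (blockH A γ R u B) (blockZ A γ R u B) D ω' s -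
        chain (blockH A γ R u B) (blockZ A γ R u B) D ω s‖ with hΔ
  set Q := ∑ r ∈ Finset.range t, ‖ω' r none - ω r none‖ with hQ
  have hW : ∀ ω : ℕ → Block d, ∑ r ∈ Finset.range s, ∑ k ∈ Finset.range B, ‖blockNoise u (ω r) k‖ ≤
      ∑ r ∈ Finset.range t, ∑ k ∈ Finset.range B, ‖blockNoise u (ω r) k‖ := by
    intro ω
    exact Finset.sum_le_sum_of_subset_of_nonneg (Finset.range_mono hst)
      fun r _ _ => Finset.sum_nonneg fun _ _ => norm_nonneg _
  have hV0 : 0 ≤ V := by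
    rw [hV]
    have h0 : 0 ≤ ∑ r ∈ Finset.range t, ∑ k ∈ Finset.range B, ‖blockNoise u (ω r) k‖ :=
      Finset.sum_nonneg fun _ _ => Finset.sum_nonneg fun _ _ => norm_nonneg _
    exact add_nonneg (norm_nonneg _) (mul_nonneg (by positivity) h0)
  have h1 : Δ * √R ≤ 6 * ‖A ^ u‖ * V * Q := by
    refine (norm_chain_block_sub_le hA hR hγ hγR hγB D h hst hV).trans ?_
    gcongr
    exact Finset.sum_le_sum_of_subset_of_nonneg (Finset.range_mono hst) fun _ _ _ => norm_nonneg _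
  have hb : ∀ ω'' : ℕ → Block d, (∀ r j, ω'' r (some j) = ω r (some j)) →
      ‖chain (blockH A γ R u B) (blockZ A γ R u B) D ω'' s‖ ≤ V := by
    intro ω'' h''
    have e : ∀ r k, blockNoise u (ω'' r) k = blockNoise u (ω r) k := fun r k => h'' r _
    refine (norm_chain_block_le hR hγ hγR D ω'' s).trans ?_
    simp only [e]
    rw [hV]
    gcongr
  have h2 : Δ ≤ 2 * V := by
    calc Δ ≤ _ := norm_sub_le _ _
      _ ≤ V + V := add_le_add (hb ω' h) (hb ω fun _ _ => rfl)
      _ = 2 * V := (two_mul V).symm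
  have h3 : Δ ≤ 6 * ‖A ^ u‖ * V * (Q / √R) := by
    rw [← mul_div_assoc, le_div_iff₀ hsR]
    exact h1
  have hΔ0 : 0 ≤ Δ := norm_nonneg _
  have hAM : 2 * V ^ 2 * (Q / √R) ≤ V ^ 4 / t + t * Q ^ 2 / R := by
    have h4 : 0 ≤ (V ^ 2 / t - Q / √R) ^ 2 * t := by positivity
    have h5 : (V ^ 2 / t - Q / √R) ^ 2 * t = V ^ 4 / t + t * (Q ^ 2 / √R ^ 2) - 2 * V ^ 2 * (Q / √R) := by
      field_simp
      ring
    rw [Real.sq_sqrt hR.le] at h5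
    have h6 : t * (Q ^ 2 / R) = t * Q ^ 2 / R := by ring
    linarith
  calc Δ ^ 2 = Δ * Δ := sq _
    _ ≤ 2 * V * (6 * ‖A ^ u‖ * V * (Q / √R)) := by gcongr
    _ = ‖A ^ u‖ * (6 * (2 * V ^ 2 * (Q / √R))) := by ring
    _ ≤ _ := by gcongr

end Deterministic

section Moments

variable [IsProbabilityMeasure μ] [IsProbabilityMeasure π]

lemma sum_pow_four_le {ι : Type*} (s : Finset ι) (f : ι → ℝ) :
    (∑ i ∈ s, f i) ^ 4 ≤ (s.card : ℝ) ^ 3 * ∑ i ∈ s, f i ^ 4 := by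
  have h1 := sq_sum_le_card_mul_sum_sq (s := s) (f := f)
  have h2 := sq_sum_le_card_mul_sum_sq (s := s) (f := fun i => f i ^ 2)
  calc (∑ i ∈ s, f i) ^ 4 = ((∑ i ∈ s, f i) ^ 2) ^ 2 := by ring
    _ ≤ (s.card * ∑ i ∈ s, f i ^ 2) ^ 2 := by gcongr
    _ = (s.card : ℝ) ^ 2 * (∑ i ∈ s, f i ^ 2) ^ 2 := by ring
    _ ≤ (s.card : ℝ) ^ 2 * (s.card * ∑ i ∈ s, (f i ^ 2) ^ 2) := by gcongr
    _ = _ := by simp only [← pow_mul]; ring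

lemma add_pow_four_le (x y : ℝ) : (x + y) ^ 4 ≤ 8 * x ^ 4 + 8 * y ^ 4 := by
  have h1 : (x + y) ^ 2 ≤ 2 * (x ^ 2 + y ^ 2) := by nlinarith [sq_nonneg (x - y)]
  calc (x + y) ^ 4 = ((x + y) ^ 2) ^ 2 := by ring
    _ ≤ (2 * (x ^ 2 + y ^ 2)) ^ 2 := by gcongr
    _ ≤ _ := by nlinarith [sq_nonneg (x ^ 2 - y ^ 2)]

lemma map_coord_some (i k : ℕ) :
    (seqLaw (blockLaw μ π)).map (fun ω => ω i (some k)) = μ := map_coord i (some k)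

lemma map_coord_none (i : ℕ) :
    (seqLaw (blockLaw μ π)).map (fun ω => ω i none) = π := map_coord i none

variable {C : ℝ}

/-- The coupling with independent blocks. -/
lemma exists_coupling_bound (hC : 0 < C) (hd : 0 < d) (hμ : IsNoiseLaw C μ) (hA : ‖A‖ < 1)
    (hπ : IsStationaryLaw A μ π) (hB : 0 < B) (hR : 0 < R) (hγ : 0 ≤ γ)
    (hγB : γ * R * B ≤ 1 / 4) {q : ℝ} (hq : (momentMatrix π).trace ≤ q * R) (D : Op d) {t : ℕ}
    (ht : 0 < t) :
    ∃ Φ : (ℕ → Block d) → ℝ, Integrable Φ (seqLaw (blockLaw μ π)) ∧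
      (∀ ω, ∀ s ≤ t, ‖chain (blockH A γ R u B) (blockZ A γ R u B) D (blocks A (B + u) ω) s -
        chain (blockH A γ R u B) (blockZ A γ R u B) D ω s‖ ^ 2 ≤ ‖A ^ u‖ * Φ ω) ∧
      ∫ ω, Φ ω ∂seqLaw (blockLaw μ π) ≤ 48 * (‖D‖ ^ 4 + 4 * C ^ 2 * q ^ 2 + q) * t ^ 3 := by
  have hμs := IsNoiseLaw.subGaussianLaw hμ hC
  have hπs := IsStationaryLaw.subGaussianLaw hC hμ hA hπ
  have ht1 : (1 : ℝ) ≤ t := by exact_mod_cast ht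
  have hB1 : (1 : ℝ) ≤ B := by exact_mod_cast hB
  have hγR0 : 0 ≤ γ * R := mul_nonneg hγ hR.le
  have hγR : γ * R ≤ 1 := by
    have := (le_mul_of_one_le_right hγR0 hB1).trans hγB
    linarith
  have htrG := hπs.trace_pos hd
  have hq0 : 0 < q := by
    by_contra! hneg
    nlinarith
  set ν := seqLaw (blockLaw μ π) with hν
  set I : Finset (ℕ × ℕ) := Finset.range t ×ˢ Finset.range B with hI
  -- `F` dominates `V⁴` and `Q` dominates the squared restart error. Both are sums of moments of
  -- single coordinates or states, so dependence between restarts and noise plays no role.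
  set F : (ℕ → Block d) → ℝ := fun ω => 8 * ‖D‖ ^ 4 + 8 * ((2 * γ * √R) ^ 4 *
    ((t * B : ℝ) ^ 3 * ∑ p ∈ I, ‖ω p.1 (some (u + p.2))‖ ^ 4)) with hF
  set Q : (ℕ → Block d) → ℝ := fun ω => t * ∑ r ∈ Finset.range t,
    (2 * ‖canonState A (B + u) (r * (B + u)) ω‖ ^ 2 + 2 * ‖ω r none‖ ^ 2) with hQ
  have i1 : ∀ p : ℕ × ℕ, Integrable (fun ω : ℕ → Block d => ‖ω p.1 (some (u + p.2))‖ ^ 4) ν := by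
    intro p
    have h := hμs.integrable_norm_pow_four hd hC
    rw [← map_coord_some (μ := μ) (π := π) p.1 (u + p.2)] at h
    exact h.comp_measurable (measurable_coord _ _)
  have e1 : ∀ p : ℕ × ℕ, ∫ ω : ℕ → Block d, ‖ω p.1 (some (u + p.2))‖ ^ 4 ∂ν = fourthMoment μ := by
    intro p
    have h := integral_map (μ := ν) (measurable_coord (d := d) p.1 (some (u + p.2))).aemeasurable
      (f := fun x => ‖x‖ ^ 4) (by fun_prop)
    rw [hν, map_coord_some (μ := μ) (π := π) p.1 (u + p.2)] at h
    exact h.symm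
  have hlaw : ∀ τ, ν.map (canonState A (B + u) τ) = π := fun τ =>
    IsStationaryVAR.map_state (isStationaryVAR_canon (B + u) τ) hπ le_rfl
  have i2 : ∀ τ, Integrable (fun ω => ‖canonState A (B + u) τ ω‖ ^ 2) ν := by
    intro τ
    have h := integrable_norm_sq hπs.memLp
    rw [← hlaw τ] at h
    exact h.comp_measurable (measurable_canonState A (B + u) τ)
  have e2 : ∀ τ, ∫ ω, ‖canonState A (B + u) τ ω‖ ^ 2 ∂ν = (momentMatrix π).trace := by
    intro τ
    have h := integral_map (μ := ν) (measurable_canonState A (B + u) τ).aemeasurable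
      (f := fun x => ‖x‖ ^ 2) (by fun_prop)
    rw [hlaw τ, ← trace_momentMatrix hπs.memLp] at h
    exact h.symm
  have i3 : ∀ r, Integrable (fun ω : ℕ → Block d => ‖ω r none‖ ^ 2) ν := by
    intro r
    have h := integrable_norm_sq hπs.memLp
    rw [← map_coord_none (μ := μ) (π := π) r] at h
    exact h.comp_measurable (measurable_coord _ _)
  have e3 : ∀ r, ∫ ω : ℕ → Block d, ‖ω r none‖ ^ 2 ∂ν = (momentMatrix π).trace := by
    intro r
    have h := integral_map (μ := ν) (measurable_coord (d := d) r none).aemeasurable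
      (f := fun x => ‖x‖ ^ 2) (by fun_prop)
    rw [hν, map_coord_none (μ := μ) (π := π) r] at h
    rw [trace_momentMatrix hπs.memLp]
    exact h.symm
  have iF : Integrable F ν := (integrable_const _).add
    (((integrable_finsetSum _ fun p _ => i1 p).const_mul _ |>.const_mul _).const_mul _)
  have iQ0 : ∀ r, Integrable (fun ω : ℕ → Block d =>
      2 * ‖canonState A (B + u) (r * (B + u)) ω‖ ^ 2 + 2 * ‖ω r none‖ ^ 2) ν := fun r =>
    ((i2 _).const_mul 2).add ((i3 r).const_mul 2)
  have iQ : Integrable Q ν := (integrable_finsetSum _ fun r _ => iQ0 r).const_mul _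
  refine ⟨fun ω => 6 * (F ω / t + t * Q ω / R),
    ((iF.div_const _).add ((iQ.const_mul _).div_const _)).const_mul _, fun ω s hs => ?_, ?_⟩
  · refine (norm_sq_chain_block_sub_le hA.le hR hγ hγR hγB D (ω := ω) (ω' := blocks A (B + u) ω)
      (fun _ _ => rfl) hs ht rfl).trans ?_
    have hF1 : (‖D‖ + 2 * γ * √R * ∑ r ∈ Finset.range t, ∑ k ∈ Finset.range B,
        ‖blockNoise u (ω r) k‖) ^ 4 ≤ F ω := by
      refine (add_pow_four_le _ _).trans ?_
      rw [mul_pow, ← Finset.sum_product' (f := fun r k => ‖blockNoise u (ω r) k‖)]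
      simp only [hF]
      gcongr
      refine (sum_pow_four_le _ _).trans_eq ?_
      rw [Finset.card_product, Finset.card_range, Finset.card_range, Nat.cast_mul]
      rfl
    have hQ1 : (∑ r ∈ Finset.range t, ‖blocks A (B + u) ω r none - ω r none‖) ^ 2 ≤ Q ω := by
      refine (sq_sum_le_card_mul_sum_sq).trans ?_
      rw [Finset.card_range]
      simp only [hQ]
      gcongr with r hr
      change ‖canonState A (B + u) (r * (B + u)) ω - ω r none‖ ^ 2 ≤ _
      have h1 := norm_sub_le (canonState A (B + u) (r * (B + u)) ω) (ω r none)
      have h2 := pow_le_pow_left₀ (norm_nonneg _) h1 2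
      nlinarith [sq_nonneg (‖canonState A (B + u) (r * (B + u)) ω‖ - ‖ω r none‖)]
    change _ ≤ ‖A ^ u‖ * (6 * (F ω / t + t * Q ω / R))
    gcongr
  · have e4 : ∫ ω, F ω ∂ν = 8 * ‖D‖ ^ 4 + 8 * ((2 * γ * √R) ^ 4 *
        ((t * B : ℝ) ^ 3 * ((t * B : ℝ) * fourthMoment μ))) := by
      rw [hF, integral_add (integrable_const _) (((integrable_finsetSum _ fun p _ =>
        i1 p).const_mul _ |>.const_mul _).const_mul _)]
      simp only [integral_const_mul]
      rw [integral_finsetSum _ fun p _ => i1 p]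
      simp only [e1, Finset.sum_const, hI, Finset.card_product, Finset.card_range, nsmul_eq_mul,
        integral_const, probReal_univ, one_smul, Nat.cast_mul]
    have e5 : ∫ ω, Q ω ∂ν = t * (t * (4 * (momentMatrix π).trace)) := by
      rw [hQ, integral_const_mul, integral_finsetSum _ fun r _ => iQ0 r]
      have e6 : ∀ r, ∫ ω : ℕ → Block d, (2 * ‖canonState A (B + u) (r * (B + u)) ω‖ ^ 2 +
          2 * ‖ω r none‖ ^ 2) ∂ν = 4 * (momentMatrix π).trace := fun r => by
        rw [integral_add ((i2 _).const_mul 2) ((i3 r).const_mul 2), integral_const_mul,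
          integral_const_mul, e2, e3]
        ring
      simp only [e6, Finset.sum_const, Finset.card_range, nsmul_eq_mul]
    rw [integral_const_mul, integral_add (iF.div_const _) ((iQ.const_mul _).div_const _),
      integral_div, integral_div, integral_const_mul, e4, e5]
    have h4 : fourthMoment μ ≤ 64 * C ^ 2 * (q * R) ^ 2 := by
      refine (hμs.fourthMoment_le hd hC).trans ?_
      have h0 := (hμs.trace_pos hd).le
      have := (trace_noise_le_trace_stationary hC hμ hA hπ).trans hq
      gcongr
    have h5 : (2 * γ * √R) ^ 4 * ((t * B : ℝ) ^ 3 * ((t * B : ℝ) * fourthMoment μ)) ≤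
        4 * C ^ 2 * q ^ 2 * t ^ 4 := by
      have e7 : (2 * γ * √R) ^ 4 = 16 * γ ^ 4 * R ^ 2 := by
        have : √R ^ 4 = R ^ 2 := by
          rw [show √R ^ 4 = (√R ^ 2) ^ 2 by ring, Real.sq_sqrt hR.le]
        rw [mul_pow, this]; ring
      rw [e7]
      calc _ ≤ 16 * γ ^ 4 * R ^ 2 * ((t * B : ℝ) ^ 3 * ((t * B : ℝ) *
            (64 * C ^ 2 * (q * R) ^ 2))) := by gcongr
        _ = 1024 * C ^ 2 * q ^ 2 * t ^ 4 * (γ * R * B) ^ 4 := by ring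
        _ ≤ 1024 * C ^ 2 * q ^ 2 * t ^ 4 * (1 / 4) ^ 4 := by gcongr
        _ = _ := by ring
    have h6 : ‖D‖ ^ 4 ≤ ‖D‖ ^ 4 * (t : ℝ) ^ 4 := le_mul_of_one_le_right (by positivity)
      (one_le_pow₀ ht1)
    have h7 : (8 * ‖D‖ ^ 4 + 8 * ((2 * γ * √R) ^ 4 *
        ((t * B : ℝ) ^ 3 * ((t * B : ℝ) * fourthMoment μ)))) / t ≤
        (8 * ‖D‖ ^ 4 + 32 * C ^ 2 * q ^ 2) * t ^ 3 := by
      rw [div_le_iff₀ (by positivity)]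
      nlinarith
    have h8 : t * (t * (t * (4 * (momentMatrix π).trace))) / R ≤ 4 * q * (t : ℝ) ^ 3 := by
      rw [div_le_iff₀ hR]
      have := mul_le_mul_of_nonneg_left hq (show (0 : ℝ) ≤ 4 * t ^ 3 by positivity)
      nlinarith
    have h9 : 0 ≤ q * (t : ℝ) ^ 3 := by positivity
    nlinarith

end Moments

end RER

/-! ### The excess loss on the canonical space. -/

namespace RER

variable {d : ℕ} {A A₀ : Op d} {μ π : Measure (Vec d)} {γ R : ℝ} {u B a t : ℕ}

/-- On bounded trajectories the iterates follow the truncated chain. -/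
lemma rerIterate_eq_chain (hR : 0 < R) (ω : ℕ → Block d)
    (hω : ∀ τ < t * (B + u), ‖canonState A (B + u) τ ω‖ ^ 2 ≤ R) {s : ℕ} (hs : s ≤ t) :
    rerIterate γ B u A₀ (fun τ => canonState A (B + u) τ ω) s =
      A + chain (blockH A γ R u B) (blockZ A γ R u B) (A₀ - A) (blocks A (B + u) ω) s := by
  induction s with
  | zero => simp [rerIterate, chain]
  | succ s ih =>
    have e : ∀ k ≤ B, canonState A (B + u) (s * (B + u) + u + k) ω =
        traj A (blocks A (B + u) ω s none) (fun j => blocks A (B + u) ω s (some j)) (u + k) := by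
      intro k hk
      rw [add_assoc, canonState_add A s (by omega)]
      rfl
    rw [rerIterate, ih (by omega), bufferPass_eq γ A _ _ _
      (blockState A R u (blocks A (B + u) ω s)) (blockNoise u (blocks A (B + u) ω s)),
      add_sub_cancel_left]
    · rfl
    · intro k hk
      rw [blockState, ← e k hk.le]
      refine clip_of_norm_le (Real.sqrt_pos.2 hR) (Real.le_sqrt_of_sq_le (hω _ ?_))
      calc s * (B + u) + u + k < (s + 1) * (B + u) := by rw [add_mul]; omega
        _ ≤ t * (B + u) := Nat.mul_le_mul_right _ hs
    · intro k hk
      rw [add_assoc, e (k + 1) hk, e k hk.le]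
      rfl

section WeightedNorm

/-- The squared norm `∑ gᵢ ‖M eᵢ‖²` of an operator. -/
noncomputable def wnorm (e : OrthonormalBasis (Fin d) ℝ (Vec d)) (g : Fin d → ℝ) (M : Op d) : ℝ :=
  ∑ i, g i * ‖M (e i)‖ ^ 2

variable {e : OrthonormalBasis (Fin d) ℝ (Vec d)} {g : Fin d → ℝ}

lemma wnorm_nonneg (hg : ∀ i, 0 ≤ g i) (M : Op d) : 0 ≤ wnorm e g M :=
  Finset.sum_nonneg fun i _ => mul_nonneg (hg i) (sq_nonneg _)

lemma wnorm_le (hg : ∀ i, 0 ≤ g i) (M : Op d) : wnorm e g M ≤ ‖M‖ ^ 2 * ∑ i, g i := by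
  rw [wnorm, Finset.mul_sum]
  refine Finset.sum_le_sum fun i _ => ?_
  rw [mul_comm]
  have : ‖M (e i)‖ ≤ ‖M‖ := by simpa [e.orthonormal.1 i] using M.le_opNorm (e i)
  exact mul_le_mul_of_nonneg_right (pow_le_pow_left₀ (norm_nonneg _) this 2) (hg i)

lemma wnorm_add_add_le (hg : ∀ i, 0 ≤ g i) (M M' M'' : Op d) :
    wnorm e g (M + M' + M'') ≤ 3 * wnorm e g M + 3 * wnorm e g M' + 3 * wnorm e g M'' := by
  simp only [wnorm, Finset.mul_sum, ← Finset.sum_add_distrib]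
  refine Finset.sum_le_sum fun i _ => ?_
  have h1 : ‖(M + M' + M'') (e i)‖ ≤ ‖M (e i)‖ + ‖M' (e i)‖ + ‖M'' (e i)‖ := norm_add₃_le
  have h2 := pow_le_pow_left₀ (norm_nonneg _) h1 2
  have h3 : (‖M (e i)‖ + ‖M' (e i)‖ + ‖M'' (e i)‖) ^ 2 ≤
      3 * ‖M (e i)‖ ^ 2 + 3 * ‖M' (e i)‖ ^ 2 + 3 * ‖M'' (e i)‖ ^ 2 := by
    nlinarith [sq_nonneg (‖M (e i)‖ - ‖M' (e i)‖), sq_nonneg (‖M' (e i)‖ - ‖M'' (e i)‖),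
      sq_nonneg (‖M (e i)‖ - ‖M'' (e i)‖)]
  have h4 := mul_le_mul_of_nonneg_left (h2.trans h3) (hg i)
  linarith

lemma measurable_wnorm : Measurable (wnorm e g : Op d → ℝ) := by
  refine Finset.measurable_sum _ fun i _ => Measurable.const_mul ?_ _
  exact (((measurable_id (α := Op d)).apply_continuousLinearMap (e i)).norm).pow_const 2

lemma integrable_wnorm (hg : ∀ i, 0 ≤ g i) {Ω : Type*} [MeasurableSpace Ω] {P : Measure Ω}
    {f : Ω → Op d} (hfm : Measurable f) (hf : MemLp f 2 P) :
    Integrable (fun ω => wnorm e g (f ω)) P := by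
  refine ((hf.integrable_norm_pow (by norm_num)).mul_const (∑ i, g i)).mono'
    (measurable_wnorm.comp hfm).aestronglyMeasurable (ae_of_all _ fun ω => ?_)
  rw [Real.norm_of_nonneg (wnorm_nonneg hg _)]
  exact wnorm_le hg _

end WeightedNorm

lemma norm_average_le {f : ℕ → Op d} {c : ℝ} (hat : a < t)
    (hf : ∀ s ≤ t, ‖f s‖ ≤ c) : ‖((t : ℝ) - a)⁻¹ • ∑ s ∈ Finset.Ioc a t, f s‖ ≤ c := by
  have hm0 : (0 : ℝ) < t - a := by
    have : (a : ℝ) < t := by exact_mod_cast hat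
    linarith
  have hcard : ((Finset.Ioc a t).card : ℝ) = (t : ℝ) - a := by simp [Nat.cast_sub hat.le]
  rw [norm_smul, norm_inv, Real.norm_of_nonneg hm0.le, inv_mul_le_iff₀ hm0, ← hcard]
  refine (norm_sum_le _ _).trans ((Finset.sum_le_card_nsmul _ _ c fun s hs =>
    hf s (Finset.mem_Ioc.1 hs).2).trans_eq ?_)
  rw [nsmul_eq_mul]

lemma memLp_smul_sum {E Ω : Type*} [NormedAddCommGroup E] [NormedSpace ℝ E] [MeasurableSpace Ω]
    {P : Measure Ω} (c : ℝ) (I : Finset ℕ) {f : ℕ → Ω → E} (hf : ∀ s, MemLp (f s) 2 P) :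
    MemLp (fun ω => c • ∑ s ∈ I, f s ω) 2 P :=
  (memLp_finsetSum I fun s _ => hf s).const_smul c

variable {C : ℝ}

/-- The excess loss on the canonical space. -/
lemma canonical_bound [IsProbabilityMeasure μ] [IsProbabilityMeasure π] (hC : 0 < C) (hd : 0 < d) (hμ : IsNoiseLaw C μ) (hA : ‖A‖ < 1)
    (hπ : IsStationaryLaw A μ π) (hB : 0 < B) (hR : 0 < R) (hγ : 0 < γ)
    (hγB : γ * R * B ≤ 1 / 4) {q : ℝ} (hq : (momentMatrix π).trace ≤ q * R)
    (hclip : ∀ x, 1 / 2 * ∫ z, inner ℝ z x ^ 2 ∂π ≤ ∫ z, inner ℝ (clip (√R) z) x ^ 2 ∂π)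
    (hat : a < t) {p : ℝ} (hp : π.real {z | R < ‖z‖ ^ 2} ≤ p) :
    Integrable (fun ω => predLoss A μ π
      (rerOutput R γ B u a t A₀ fun τ => canonState A (B + u) τ ω)) (seqLaw (blockLaw μ π)) ∧
    ∫ ω, predLoss A μ π (rerOutput R γ B u a t A₀ fun τ => canonState A (B + u) τ ω)
        ∂seqLaw (blockLaw μ π) - (momentMatrix μ).trace ≤
      3 * (γ * (momentMatrix μ).trace * d / (3 / 10 * γ * B) * (2 / ((t : ℝ) - a) +
        4 * √(condNumber (momentMatrix π)) * (1 / (3 * B)) / ((t : ℝ) - a) +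
        8 * √(condNumber (momentMatrix π)) /
          (6 / 10 * γ * B * sigmaMin (momentMatrix π) * ((t : ℝ) - a) ^ 2))) +
      3 * (‖A₀ - A‖ ^ 2 * (momentMatrix π).trace *
        ((1 - 6 / 10 * γ * B * sigmaMin (momentMatrix π)) ^ a /
          (6 / 10 * γ * B * sigmaMin (momentMatrix π) * ((t : ℝ) - a)))) +
      3 * ((momentMatrix π).trace * (‖A ^ u‖ *
        (48 * (‖A₀ - A‖ ^ 4 + 4 * C ^ 2 * q ^ 2 + q) * t ^ 3))) +
      (momentMatrix π).trace * ((t * (B + u) : ℕ) * p) := by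
  have hμs := IsNoiseLaw.subGaussianLaw hμ hC
  have hπs := IsStationaryLaw.subGaussianLaw hC hμ hA hπ
  have h := isNoisyContraction_block (u := u) hC hd hμ hA hπ hB hR hγ hγB hclip
  change IsNoisyContraction (blockLaw μ π) (blockH A γ R u B) (blockZ A γ R u B) _ _ _ at h
  obtain ⟨e, g, hgl, hgu, hgs, hgq, hgN⟩ := exists_eigenbasis hπs.memLp
  have hσ := hπs.sigmaMin_pos hd
  have htr := hπs.trace_pos hd
  have hg0 : ∀ i, 0 ≤ g i := fun i => hσ.le.trans (hgl i)
  have hB1 : (1 : ℝ) ≤ B := by exact_mod_cast hB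
  have hγR : γ * R ≤ 1 / 4 := (le_mul_of_one_le_right (by positivity) hB1).trans hγB
  have hq1 : ∀ x, 2 * (3 / 10 * γ * B) * ∑ i, g i * inner ℝ (e i) x ^ 2 ≤
      ‖x‖ ^ 2 - ∫ b, ‖blockH A γ R u B b x‖ ^ 2 ∂blockLaw μ π := by
    intro x
    rw [← hgq]
    exact le_norm_sq_sub_integral_bufH_block hμ.isProb hπ hR hγ.le hγR hγB x (hclip x)
  set ν := seqLaw (blockLaw μ π) with hν
  set c : ℝ := ((t : ℝ) - a)⁻¹ with hc
  obtain ⟨Φ, hΦi, hΦ, hΦle⟩ := exists_coupling_bound (u := u) hC hd hμ hA hπ hB hR hγ.le hγB hq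
    (A₀ - A) (t := t) (by omega)
  set H := blockH A γ R u B with hH
  set Z := blockZ A γ R u B with hZ
  set bias : (ℕ → Block d) → Op d := fun ω =>
    c • ∑ s ∈ Finset.Ioc a t, (A₀ - A) * chain H 0 1 ω s with hbias
  set noise : (ℕ → Block d) → Op d := fun ω =>
    c • ∑ s ∈ Finset.Ioc a t, chain H Z 0 ω s with hnoise
  set diff : (ℕ → Block d) → Op d := fun ω => c • ∑ s ∈ Finset.Ioc a t,
    (chain H Z (A₀ - A) (blocks A (B + u) ω) s - chain H Z (A₀ - A) ω s) with hdiff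
  have hnoise_int := h.integral_average_noise_le e g hσ hgl hgu (κ₁ := 3 / 10 * γ * B)
    (by positivity) hq1 hat
  have hbias_int := h.integral_average_bias_le e g hg0 (A₀ - A) hat
  rw [hgs] at hbias_int
  change ∫ ω, wnorm e g (noise ω) ∂ν ≤ _ at hnoise_int
  change ∫ ω, wnorm e g (bias ω) ∂ν ≤ _ at hbias_int
  -- measurability and integrability
  have mc := fun s => measurable_chain h.measurable_H h.measurable_Z 0 s
  have mu := fun s => measurable_chain h.noiseless.measurable_H h.noiseless.measurable_Z 1 s
  have mnoise : Measurable noise := (continuous_const_smul c).measurable.comp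
    (Finset.measurable_sum _ fun s _ => mc s)
  have mbias : Measurable bias := (continuous_const_smul c).measurable.comp
    (Finset.measurable_sum _ fun s _ => measurable_const.mul (mu s))
  have inoise : Integrable (fun ω => wnorm e g (noise ω)) ν := by
    refine integrable_wnorm hg0 mnoise ?_
    exact memLp_smul_sum c _ fun s => h.memLp_chain 0 s
  have ibias : Integrable (fun ω => wnorm e g (bias ω)) ν := by
    refine integrable_wnorm hg0 mbias ?_
    refine memLp_smul_sum c _ fun s => ?_
    refine ((h.noiseless.memLp_chain 1 s).norm.const_mul ‖A₀ - A‖).mono'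
      (measurable_const.mul (mu s)).aestronglyMeasurable (ae_of_all _ fun ω => norm_mul_le _ _)
  -- The coupling error is replaced pointwise by the integrable `Φ`, so `diff` itself never has to
  -- be integrated.
  have hdiff_le : ∀ ω, wnorm e g (diff ω) ≤ (momentMatrix π).trace * (‖A ^ u‖ * Φ ω) := by
    intro ω
    refine (wnorm_le hg0 _).trans ?_
    rw [hgs, mul_comm]
    refine mul_le_mul_of_nonneg_left ?_ htr.le
    have h1 : 0 ≤ ‖A ^ u‖ * Φ ω := (sq_nonneg _).trans (hΦ ω 0 (Nat.zero_le _))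
    rw [← Real.sq_sqrt h1]
    refine pow_le_pow_left₀ (norm_nonneg _) (norm_average_le hat fun s hs => ?_) 2
    exact Real.le_sqrt_of_sq_le (hΦ ω s hs)
  -- the bad event
  set bad : Set (ℕ → Block d) :=
    ⋃ τ ∈ Finset.range (t * (B + u)), canonState A (B + u) τ ⁻¹' {z | R < ‖z‖ ^ 2} with hbad
  have hms : MeasurableSet {z : Vec d | R < ‖z‖ ^ 2} :=
    measurableSet_lt measurable_const (by fun_prop)
  have mbad : MeasurableSet bad := Finset.measurableSet_biUnion _ fun τ _ =>
    measurable_canonState A (B + u) τ hms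
  have hbad_le : ν.real bad ≤ (t * (B + u) : ℕ) * p := by
    refine (measureReal_biUnion_finset_le _ _).trans ((Finset.sum_le_card_nsmul _ _ p
      fun τ _ => ?_).trans_eq (by rw [Finset.card_range, nsmul_eq_mul]))
    rw [← map_measureReal_apply (measurable_canonState A (B + u) τ) hms,
      IsStationaryVAR.map_state (isStationaryVAR_canon (B + u) τ) hπ le_rfl]
    exact hp
  have htb : 0 ≤ (momentMatrix π).trace * ν.real bad := mul_nonneg htr.le measureReal_nonneg
  set out : (ℕ → Block d) → Op d := fun ω =>
    rerOutput R γ B u a t A₀ fun τ => canonState A (B + u) τ ω with hout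
  have mout : Measurable out := measurable_rerOutput.comp
    (measurable_pi_lambda _ fun τ => measurable_canonState A (B + u) τ)
  have hm0 : (0 : ℝ) < t - a := by
    have : (a : ℝ) < t := by exact_mod_cast hat
    linarith
  have hpt : ∀ ω, wnorm e g (out ω - A) ≤ 3 * wnorm e g (noise ω) + 3 * wnorm e g (bias ω) +
      3 * ((momentMatrix π).trace * (‖A ^ u‖ * Φ ω)) +
        bad.indicator (fun _ => (momentMatrix π).trace) ω := by
    intro ω
    have hn := wnorm_nonneg hg0 (e := e) (noise ω)
    have hb := wnorm_nonneg hg0 (e := e) (bias ω)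
    have hdf := (wnorm_nonneg hg0 (e := e) (diff ω)).trans (hdiff_le ω)
    by_cases hω : ω ∈ bad
    · rw [Set.indicator_of_mem hω]
      have h1 : ¬ ∀ τ < t * (B + u), ‖canonState A (B + u) τ ω‖ ^ 2 ≤ R := by
        simp only [hbad, Set.mem_iUnion, Finset.mem_range, Set.mem_preimage, Set.mem_ofPred_eq] at hω
        obtain ⟨τ, hτ, h2⟩ := hω
        exact fun h3 => absurd (h3 τ hτ) (not_le.2 h2)
      have h2 : out ω = 0 := by simp only [hout, rerOutput, if_neg h1]
      -- The reset to zero leaves the error `-A`, of norm below one, so a bad event costs at most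
      -- `tr(G)`.
      have h3 : wnorm e g (out ω - A) ≤ (momentMatrix π).trace := by
        refine (wnorm_le hg0 _).trans ?_
        rw [h2, zero_sub, norm_neg, hgs]
        exact mul_le_of_le_one_left htr.le (pow_le_one₀ (norm_nonneg _) hA.le)
      linarith
    · rw [Set.indicator_of_notMem hω, add_zero]
      have h1 : ∀ τ < t * (B + u), ‖canonState A (B + u) τ ω‖ ^ 2 ≤ R := by
        intro τ hτ
        by_contra h3
        refine hω ?_
        simp only [hbad, Set.mem_iUnion, Finset.mem_range, Set.mem_preimage, Set.mem_ofPred_eq]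
        exact ⟨τ, hτ, not_le.1 h3⟩
      have h2 : out ω - A = noise ω + bias ω + diff ω := by
        have h3 : ∀ s ∈ Finset.Ioc a t,
            rerIterate γ B u A₀ (fun τ => canonState A (B + u) τ ω) s = A + (chain H Z 0 ω s +
              (A₀ - A) * chain H 0 1 ω s + (chain H Z (A₀ - A) (blocks A (B + u) ω) s -
                chain H Z (A₀ - A) ω s)) := by
          intro s hs
          rw [rerIterate_eq_chain hR ω h1 (Finset.mem_Ioc.1 hs).2,
            chain_eq H Z (A₀ - A) ω s]
          abel
        simp only [hout, rerOutput, if_pos h1, Finset.sum_congr rfl h3, Finset.sum_add_distrib,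
          Finset.sum_const, Nat.card_Ioc, smul_add, hnoise, hbias, hdiff]
        have h4 : (((t : ℝ) - a)⁻¹) • ((t - a) • A) = A := by
          rw [← Nat.cast_smul_eq_nsmul ℝ, smul_smul, Nat.cast_sub hat.le, inv_mul_cancel₀ hm0.ne',
            one_smul]
        rw [h4]
        abel
      rw [h2]
      have h3 := wnorm_add_add_le (e := e) hg0 (noise ω) (bias ω) (diff ω)
      linarith [hdiff_le ω]
  have inb : Integrable (fun ω => 3 * wnorm e g (noise ω) + 3 * wnorm e g (bias ω)) ν :=
    (inoise.const_mul 3).add (ibias.const_mul 3)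
  have iΦ : Integrable (fun ω => 3 * ((momentMatrix π).trace * (‖A ^ u‖ * Φ ω))) ν :=
    ((hΦi.const_mul _).const_mul _).const_mul 3
  have ibd : Integrable (fun ω => 3 * wnorm e g (noise ω) + 3 * wnorm e g (bias ω) +
      3 * ((momentMatrix π).trace * (‖A ^ u‖ * Φ ω))) ν :=
    inb.add iΦ
  have iind : Integrable (bad.indicator (fun _ => (momentMatrix π).trace)) ν :=
    (integrable_const _).indicator mbad
  have iout : Integrable (fun ω => wnorm e g (out ω - A)) ν := by
    refine (ibd.add iind).mono' (measurable_wnorm.comp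
      (mout.sub measurable_const)).aestronglyMeasurable (ae_of_all _ fun ω => ?_)
    rw [Real.norm_of_nonneg (wnorm_nonneg hg0 _)]
    exact hpt ω
  have hloss : ∀ ω, predLoss A μ π (out ω) = (momentMatrix μ).trace + wnorm e g (out ω - A) :=
    fun ω => by rw [predLoss_eq hC hμ hA hπ, hgN, wnorm]
  have hloss' : (fun ω => predLoss A μ π (out ω)) = fun ω =>
    (momentMatrix μ).trace + wnorm e g (out ω - A) := funext hloss
  rw [hloss']
  refine ⟨(integrable_const _).add iout, ?_⟩
  rw [integral_add (integrable_const _) iout]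
  simp only [integral_const, probReal_univ, one_smul, add_sub_cancel_left]
  have hle := integral_mono iout (ibd.add iind) hpt
  refine hle.trans ?_
  have e1 : ∫ ω, (3 * wnorm e g (noise ω) + 3 * wnorm e g (bias ω) +
      3 * ((momentMatrix π).trace * (‖A ^ u‖ * Φ ω)) +
        bad.indicator (fun _ => (momentMatrix π).trace) ω) ∂ν =
      3 * ∫ ω, wnorm e g (noise ω) ∂ν + 3 * ∫ ω, wnorm e g (bias ω) ∂ν +
      3 * ((momentMatrix π).trace * (‖A ^ u‖ * ∫ ω, Φ ω ∂ν)) +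
        (momentMatrix π).trace * ν.real bad := by
    rw [integral_add ibd iind, integral_add inb iΦ, integral_add (inoise.const_mul 3)
      (ibias.const_mul 3), integral_const_mul, integral_const_mul, integral_const_mul,
      integral_const_mul, integral_const_mul, integral_indicator_const _ mbad, smul_eq_mul,
      mul_comm (ν.real bad)]
  refine (le_of_eq e1).trans ?_
  have hA0 := norm_nonneg (A ^ u)
  gcongr
  exact hnoise_int

end RER

namespace RER

/-! ### Numerical form of the four error terms. -/

section Numeric

lemma rpow_three_halves {κ : ℝ} (hκ : 0 < κ) : κ ^ (3 / 2 : ℝ) = κ * √κ := by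
  rw [Real.sqrt_eq_rpow, show (3 / 2 : ℝ) = 1 + 1 / 2 by norm_num, Real.rpow_add hκ, Real.rpow_one]

variable {trS trG σ κ sS d m B L c CR R γ : ℝ}

/-- The constant `20` is `3 · 2 / (3/10)`. The transient carries `1 / (γ σ)`, that is `tr(G) / σ ≤ d
κ` up to constants and `L`, which raises `√κ` to `κ^(3/2)`. -/
lemma noise_term_le (hd : 0 < d) (hm : 0 < m) (hB : 0 < B) (hL : 0 < L) (hc : 0 < c) (hCR : 0 < CR)
    (htrS : 0 < trS) (htrG : 0 < trG) (hσ : 0 < σ) (hκ : 0 < κ) (hS : trS ≤ d * sS)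
    (hG : trG ≤ d * κ * σ) (hR : R = CR * trG * L) (hγ : γ = c / (4 * R * B)) :
    3 * (γ * trS * d / (3 / 10 * γ * B) * (2 / m + 4 * √κ * (1 / (3 * B)) / m +
        8 * √κ / (6 / 10 * γ * B * σ * m ^ 2))) ≤
      20 * (d * trS / (B * m) + d ^ 2 * sS / (B * m) * (√κ / B)) +
        600 * CR / c * (d ^ 2 * sS / (B ^ 2 * m ^ 2) * (κ ^ (3 / 2 : ℝ) * (d * B * L))) := by
  have hRpos : 0 < R := by rw [hR]; positivity
  have hγpos : 0 < γ := by rw [hγ]; positivity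
  have hsS : 0 < sS := by
    by_contra! h
    nlinarith
  have hsκ := Real.sqrt_pos.2 hκ
  rw [rpow_three_halves hκ]
  have e1 : 3 * (γ * trS * d / (3 / 10 * γ * B) * (2 / m + 4 * √κ * (1 / (3 * B)) / m +
        8 * √κ / (6 / 10 * γ * B * σ * m ^ 2))) =
      20 * (d * trS / (B * m)) + 40 / 3 * (trS * d * √κ / (B ^ 2 * m)) +
        1600 / 3 * (CR / c) * (trS * (trG / σ) * (d * √κ * L / (B * m ^ 2))) := by
    rw [hγ, hR]
    field_simp
    ring
  have h2 : 40 / 3 * (trS * d * √κ / (B ^ 2 * m)) ≤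
      20 * (d ^ 2 * sS / (B * m) * (√κ / B)) := by
    calc _ ≤ 20 * (d * sS * d * √κ / (B ^ 2 * m)) := by gcongr; norm_num
      _ = _ := by field_simp
  have hGσ : trG / σ ≤ d * κ := by rwa [div_le_iff₀ hσ]
  have h3 : 1600 / 3 * (CR / c) * (trS * (trG / σ) * (d * √κ * L / (B * m ^ 2))) ≤
      600 * CR / c * (d ^ 2 * sS / (B ^ 2 * m ^ 2) * (κ * √κ * (d * B * L))) := by
    calc _ ≤ 600 * (CR / c) * ((d * sS) * (d * κ) * (d * √κ * L / (B * m ^ 2))) := by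
          gcongr; norm_num
      _ = _ := by field_simp
  rw [e1]
  linarith

/-- The contraction rate is at least `ρ₀ = 3c / (20 C_R d κ L)`, whence `b₂ = 3c / (20 C_R)`; the
prefactor `20 C_R / c` is `3 / ρ₀` without `d κ L`. -/
lemma bias_term_le {D : ℝ} {a : ℕ} (hd : 0 < d) (hm : 0 < m) (hB : 0 < B) (hL : 0 < L) (hc : 0 < c)
    (hCR : 0 < CR) (htrG : 0 < trG) (hσ : 0 < σ) (hκ : 0 < κ)
    (hG : trG ≤ d * κ * σ) (hR : R = CR * trG * L) (hγ : γ = c / (4 * R * B))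
    (hρ1 : 6 / 10 * γ * B * σ ≤ 1) :
    3 * (D ^ 2 * trG * ((1 - 6 / 10 * γ * B * σ) ^ a / (6 / 10 * γ * B * σ * m))) ≤
      20 * CR / c * (1 * (d * κ * L / m) *
        Real.exp (-(3 / 20 * c / CR * (a / (d * κ * L)))) * trG * D ^ 2) := by
  have hRpos : 0 < R := by rw [hR]; positivity
  have hγpos : 0 < γ := by rw [hγ]; positivity
  set ρ := 6 / 10 * γ * B * σ with hρ
  set ρ₀ := 3 / 20 * c / (CR * (d * κ * L)) with hρ₀
  have hρ₀pos : 0 < ρ₀ := by positivity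
  have h1 : ρ₀ ≤ ρ := by
    have e : ρ = 3 / 20 * c * σ / (CR * trG * L) := by
      rw [hρ, hγ, hR]; field_simp; ring
    rw [e, hρ₀, div_le_div_iff₀ (by positivity) (by positivity)]
    calc 3 / 20 * c * (CR * trG * L) ≤ 3 / 20 * c * (CR * (d * κ * σ) * L) := by gcongr
      _ = _ := by ring
  have h2 : (1 - ρ) ^ a ≤ Real.exp (-(3 / 20 * c / CR * (a / (d * κ * L)))) := by
    calc (1 - ρ) ^ a ≤ Real.exp (-ρ₀) ^ a := by
          refine pow_le_pow_left₀ (by linarith) ?_ a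
          have := Real.add_one_le_exp (-ρ₀)
          linarith
      _ = _ := by
          rw [← Real.exp_nat_mul]
          congr 1
          rw [hρ₀]
          field_simp
  calc _ ≤ 3 * (D ^ 2 * trG * (Real.exp (-(3 / 20 * c / CR * (a / (d * κ * L)))) / (ρ₀ * m))) := by
        gcongr
    _ = _ := by rw [hρ₀]; field_simp

lemma exp_neg_mul_log_le {T x y : ℝ} (hT : 1 ≤ T) (hxy : y ≤ x) :
    Real.exp (-(x * Real.log T)) ≤ (T ^ y)⁻¹ := by
  rw [Real.exp_neg, mul_comm, ← Real.rpow_def_of_pos (by linarith)]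
  exact inv_anti₀ (Real.rpow_pos_of_pos (by linarith) _) (Real.rpow_le_rpow_of_exponent_le hT hxy)

/-- The target has `d σ_max(Σ)` where a union bound gives `tr(G)`. Over at most `T` steps `tr(G)` is
at most `T d σ_max(Σ)` plus a remnant of size `w tr(G)`; the two parts go into the two summands. -/
lemma bad_term_le {T n w l α : ℝ} (hT : 1 < T) (hL : L = Real.log T) (hB : 1 ≤ B) (hBT : B ≤ T)
    (hnT : n ≤ T) (hn : 0 ≤ n) (hCR : 0 < CR) (htrG : 0 < trG) (hw : 0 ≤ w) (hsS : 0 ≤ d * sS)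
    (hα : 0 < α) (hl : 3 + α ≤ l * CR) (hG : trG ≤ T * (d * sS) + w * trG)
    (hR : R = CR * trG * L) :
    trG * (n * (2 * Real.exp (-(l * (CR * L))))) ≤
      (2 + 2 * CR) * ((T ^ 3 / B ^ 3 * w + d * sS / R * (T ^ 2 / B ^ 2) * (1 / T ^ (α / 2))) *
        trG) := by
  have hT0 : 0 < T := by linarith
  have hL0 : 0 < L := by rw [hL]; exact Real.log_pos hT
  have hLT : L ≤ T := by
    rw [hL]
    linarith [Real.log_le_sub_one_of_pos hT0]
  set p := T ^ (α / 2) with hp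
  have hp0 : 0 < p := Real.rpow_pos_of_pos hT0 _
  have hp1 : 1 ≤ p := Real.one_le_rpow hT.le (by linarith)
  have hexp : Real.exp (-(l * (CR * L))) ≤ (T ^ 3 * p)⁻¹ := by
    have h1 := exp_neg_mul_log_le hT.le (show 3 + α / 2 ≤ l * CR by linarith)
    rw [Real.rpow_add hT0] at h1
    rw [hL, ← mul_assoc]
    exact_mod_cast h1
  have hB0 : 0 < B := by linarith
  have hTB : 1 ≤ T ^ 3 / B ^ 3 := by
    rw [one_le_div (by positivity)]
    gcongr
  calc trG * (n * (2 * Real.exp (-(l * (CR * L)))))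
      ≤ (T * (d * sS) + w * trG) * (T * (2 * (T ^ 3 * p)⁻¹)) := by gcongr
    _ = 2 * (d * sS * (1 / (T * p))) + 2 * (1 / (T ^ 2 * p)) * (1 * w * trG) := by
        field_simp
    _ ≤ 2 * (d * sS * (T ^ 2 / (B ^ 2 * L * p))) + 2 * 1 * (T ^ 3 / B ^ 3 * w * trG) := by
        have h1 : 1 / (T * p) ≤ T ^ 2 / (B ^ 2 * L * p) := by
          rw [div_le_div_iff₀ (by positivity) (by positivity)]
          calc 1 * (B ^ 2 * L * p) ≤ T ^ 2 * T * p := by rw [one_mul]; gcongr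
            _ = _ := by ring
        have h2 : 1 / (T ^ 2 * p) ≤ 1 := by
          rw [div_le_one (by positivity)]
          exact one_le_mul_of_one_le_of_one_le (one_le_pow₀ hT.le) hp1
        gcongr
    _ = 2 * CR * (d * sS / R * (T ^ 2 / B ^ 2) * (1 / p) * trG) + 2 * (T ^ 3 / B ^ 3 * w * trG) := by
        rw [hR]
        field_simp
    _ ≤ _ := by
        have h1 : 0 ≤ d * sS / R * (T ^ 2 / B ^ 2) * (1 / p) * trG := by
          have : 0 < R := by rw [hR]; positivity
          positivity
        have h2 : 0 ≤ T ^ 3 / B ^ 3 * w * trG := by positivity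
        nlinarith

lemma collect_terms_le {s₁ s₂ s₃ s₄ x y₁ y₂ y₃ y₄ z₁ z₂ z₃ z₄ : ℝ} (h₁ : s₁ ≤ x + y₁ * z₁)
    (h₂ : s₂ ≤ y₂ * z₂) (h₃ : s₃ ≤ y₃ * z₃) (h₄ : s₄ ≤ y₄ * (z₃ + z₄)) (hy₁ : 0 ≤ y₁)
    (hy₂ : 0 ≤ y₂) (hy₃ : 0 ≤ y₃) (hy₄ : 0 ≤ y₄) (hz₁ : 0 ≤ z₁) (hz₂ : 0 ≤ z₂) (hz₃ : 0 ≤ z₃)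
    (hz₄ : 0 ≤ z₄) : s₁ + s₂ + s₃ + s₄ ≤ x + (y₁ + y₂ + y₃ + y₄) * (z₁ + z₂ + (z₃ + z₄)) := by
  have e : (y₁ + y₂ + y₃ + y₄) * (z₁ + z₂ + (z₃ + z₄)) = y₁ * z₁ + y₂ * z₂ + y₃ * z₃ +
      y₄ * (z₃ + z₄) + ((y₂ + y₃ + y₄) * z₁ + (y₁ + y₃ + y₄) * z₂ + (y₁ + y₂) * z₃ +
      (y₁ + y₂ + y₃) * z₄) := by ring
  have : 0 ≤ (y₂ + y₃ + y₄) * z₁ + (y₁ + y₃ + y₄) * z₂ + (y₁ + y₂) * z₃ +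
      (y₁ + y₂ + y₃) * z₄ := by positivity
  rw [e]
  linarith

end Numeric

variable {d : ℕ}

set_option maxHeartbeats 1000000 in
/-- The non-asymptotic bound with explicit constants. -/
theorem nonasymptotic_bound {C α CR c K : ℝ} (hC : 0 < C) (hα : 0 < α)
    (hCR : 2 + 4 * C * (3 + α) ≤ CR) (hc : 0 < c) (hc1 : c < 1) (hK : 0 ≤ K) (A A₀ : Op d)
    (μ π : Measure (Vec d)) (hd : 0 < d) (hA : ‖A‖ < 1) (hA₀ : ‖A₀‖ ≤ K) (hμ : IsNoiseLaw C μ)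
    (hπ : IsStationaryLaw A μ π) (Sig G : Matrix (Fin d) (Fin d) ℝ) (hSig : Sig = momentMatrix μ)
    (hG : G = momentMatrix π) {Ω : Type*} [MeasurableSpace Ω] (P : Measure Ω)
    [IsProbabilityMeasure P] (T : ℕ) (X η : ℕ → Ω → Vec d) (hX : IsStationaryVAR A μ π P T X η)
    (B u a t : ℕ) (hB : 0 < B) (hat : a < t) (htT : t ≤ T / (B + u)) (R γ : ℝ)
    (hR : R = CR * G.trace * Real.log T) (hγ : γ = c / (4 * R * B))
    (hT : (T : ℝ) ^ (α / 2) > (1 + 32 * C) * (√(fourthMoment π) / sigmaMin G)) :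
    Integrable
      (fun ω => predLoss A μ π (rerOutput R γ B u a t A₀ (fun τ => X τ ω))) P ∧
    (∫ ω, predLoss A μ π (rerOutput R γ B u a t A₀ (fun τ => X τ ω)) ∂P) - Sig.trace ≤
      20 * (d * Sig.trace / (B * ((t : ℝ) - a)) +
          d ^ 2 * sigmaMax Sig / (B * ((t : ℝ) - a)) * (√(condNumber G) / B)) +
      (600 * CR / c + 20 * CR / c + 144 * ((K + 1) ^ 4 + 4 * C ^ 2 + 1) + (2 + 2 * CR)) *
        (d ^ 2 * sigmaMax Sig / ((B : ℝ) ^ 2 * ((t : ℝ) - a) ^ 2) *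
            (condNumber G ^ (3 / 2 : ℝ) * (d * B * Real.log T)) +
          biasCoeff 1 (3 / 20 * c / CR) d (condNumber G) T a t * G.trace * ‖A₀ - A‖ ^ 2 +
          ((T : ℝ) ^ 3 / (B : ℝ) ^ 3 * ‖A ^ u‖ +
            d * sigmaMax Sig / R * ((T : ℝ) ^ 2 / (B : ℝ) ^ 2) *
              (1 / (T : ℝ) ^ (α / 2))) * G.trace) := by
  have hμp := hμ.isProb
  have hπp := hπ.isProb
  have hμs := IsNoiseLaw.subGaussianLaw hμ hC
  have hπs := IsStationaryLaw.subGaussianLaw hC hμ hA hπ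
  have hσ := hπs.sigmaMin_pos hd
  have htrG := hπs.trace_pos hd
  have htrS := hμs.trace_pos hd
  have hM4 := hπs.trace_le_sqrt_fourthMoment hd hC
  have hσtr := hπs.sigmaMin_le_trace hd
  rw [← hG] at hσ htrG hM4 hσtr
  rw [← hSig] at htrS
  have hd1 : (1 : ℝ) ≤ d := by exact_mod_cast hd
  have hB1 : (1 : ℝ) ≤ B := by exact_mod_cast hB
  have hCR0 : 0 < CR := by nlinarith [mul_pos hC hα]
  have hM40 : 0 < √(fourthMoment π) := htrG.trans_le hM4
  -- the horizon is at least two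
  have hT1 : 1 < (T : ℝ) := by
    have h1 : 1 ≤ √(fourthMoment π) / sigmaMin G := by
      rw [one_le_div hσ]; linarith
    have h2 : 1 < (T : ℝ) ^ (α / 2) := by nlinarith
    by_contra! h3
    exact absurd (Real.rpow_le_one (Nat.cast_nonneg T) h3 (by positivity)) (not_le.2 h2)
  have hT2 : 2 ≤ T := by
    have : 1 < T := by exact_mod_cast hT1
    omega
  have hL : 0 < Real.log T := Real.log_pos hT1
  have hL2 : 1 / 2 ≤ Real.log T := by
    have h1 : Real.log 2 ≤ Real.log T := Real.log_le_log (by norm_num) (by exact_mod_cast hT2)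
    have := Real.log_two_gt_d9
    linarith
  have hRpos : 0 < R := by rw [hR]; positivity
  have hγpos : 0 < γ := by rw [hγ]; positivity
  have hγB : γ * R * B ≤ 1 / 4 := by
    have : γ * R * B = c / 4 := by rw [hγ]; field_simp
    linarith
  -- With this exponent, `C_R ≥ 4 C (3 + α)` gives `l C_R ≥ 3 + α`. Tails are then at most `T^(-(3 +
  -- α/2))`, and half of the exponent still gives `T^(-α/2)`.
  set l := 1 / (4 * C) with hl
  have hl0 : 0 < l := by positivity
  have hlC : l * C ≤ 1 / 4 := le_of_eq (by rw [hl]; field_simp)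
  have hlCR : 3 + α ≤ l * CR := by
    rw [hl, one_div_mul_eq_div, le_div_iff₀ (by positivity)]
    nlinarith
  have hRr : R = CR * Real.log T * (momentMatrix π).trace := by rw [hR, hG]; ring
  -- The origin of `c₁ = 1 + 32 C`: the tail energy is at most `16 C / (1 + 32 C)` times `σ_min(G)`,
  -- which is below one half of it.
  have hclip : ∀ x, 1 / 2 * ∫ z, inner ℝ z x ^ 2 ∂π ≤ ∫ z, inner ℝ (clip (√R) z) x ^ 2 ∂π := by
    intro x
    rw [hRr]
    refine hπs.half_le_integral_inner_clip_sq hd hl0 hlC (by positivity) ?_ x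
    rw [← hG]
    have h1 : Real.exp (-(l * (CR * Real.log T) / 2)) ≤ ((T : ℝ) ^ (α / 2))⁻¹ := by
      have := exp_neg_mul_log_le hT1.le (show α / 2 ≤ l * CR / 2 by linarith)
      rwa [show l * (CR * Real.log T) / 2 = l * CR / 2 * Real.log T by ring]
    have h2 : ((T : ℝ) ^ (α / 2))⁻¹ ≤ sigmaMin G / ((1 + 32 * C) * √(fourthMoment π)) := by
      rw [← inv_div ((1 + 32 * C) * √(fourthMoment π)) (sigmaMin G)]
      refine inv_anti₀ (by positivity) ?_
      rw [mul_div_assoc]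
      exact hT.le
    calc 4 / l * G.trace * Real.exp (-(l * (CR * Real.log T) / 2)) ≤
          4 / l * √(fourthMoment π) * (sigmaMin G / ((1 + 32 * C) * √(fourthMoment π))) := by
          gcongr
          exact h1.trans h2
      _ = 16 * C / (1 + 32 * C) * sigmaMin G := by rw [hl]; field_simp; norm_num
      _ ≤ 1 / 2 * sigmaMin G := by
          refine mul_le_mul_of_nonneg_right ?_ hσ.le
          rw [div_le_div_iff₀ (by positivity) (by norm_num)]
          linarith
      _ = sigmaMin G / 2 := by ring
  -- `q` is the ratio `tr(G) / R`. The summand `2` in the bound on `C_R` and `log T ≥ 1/2` keep it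
  -- at most one.
  set q := 1 / (CR * Real.log T) with hq
  have hq0 : 0 < q := by positivity
  have hq1 : q ≤ 1 := by
    rw [hq, div_le_one (by positivity)]
    have : 2 ≤ CR := by nlinarith [mul_pos hC hα]
    nlinarith
  have hqR : (momentMatrix π).trace ≤ q * R := by
    rw [hq, hR, hG]
    exact le_of_eq (by field_simp)
  have hp : π.real {z | R < ‖z‖ ^ 2} ≤ 2 * Real.exp (-(l * (CR * Real.log T))) := by
    rw [hRr]
    exact hπs.measureReal_norm_sq_gt_le hd hl0 hlC _
  have hS0 : 0 < B + u := by omega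
  have htS : t * (B + u) ≤ T := (Nat.le_div_iff_mul_le hS0).1 htT
  have ht1 : 1 ≤ t := by omega
  have hBuT : B + u ≤ T := (Nat.le_mul_of_pos_left _ ht1).trans htS
  obtain ⟨hint, hle⟩ := canonical_bound (A₀ := A₀) (u := u) hC hd hμ hA hπ hB hRpos hγpos hγB hqR
    hclip hat hp
  have hmeas : Measurable fun x : ℕ → Vec d => predLoss A μ π (rerOutput R γ B u a t A₀ x) := by
    obtain ⟨e, g, -, -, -, -, hgN⟩ := exists_eigenbasis hπs.memLp
    have : (fun x : ℕ → Vec d => predLoss A μ π (rerOutput R γ B u a t A₀ x)) = fun x =>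
        (momentMatrix μ).trace + wnorm e g (rerOutput R γ B u a t A₀ x - A) := by
      funext x
      rw [predLoss_eq hC hμ hA hπ, hgN, wnorm]
    rw [this]
    exact (measurable_wnorm.comp (measurable_rerOutput.sub measurable_const)).const_add _
  have htrans := IsStationaryVAR.transfer hX (isStationaryVAR_canon (A := A) (B + u) T) hmeas
    (fun x y hxy => by rw [rerOutput_congr fun τ hτ => hxy τ (hτ.trans htS)]) hint
  refine ⟨htrans.1, ?_⟩
  rw [htrans.2]
  rw [← hSig, ← hG] at hle
  refine hle.trans ?_
  have hm : (0 : ℝ) < t - a := by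
    have : (a : ℝ) < t := by exact_mod_cast hat
    linarith
  have hκdef : condNumber G * sigmaMin G = sigmaMax G := by
    rw [condNumber, div_mul_cancel₀ _ hσ.ne']
  have hσM : 0 < sigmaMax G := hσ.trans_le (sigmaMin_le_sigmaMax G)
  have hκ : 0 < condNumber G := div_pos hσM hσ
  have hGle : G.trace ≤ d * condNumber G * sigmaMin G := by
    rw [mul_assoc, hκdef]
    exact trace_le_card_mul_sigmaMax G
  have hSle : Sig.trace ≤ d * sigmaMax Sig := trace_le_card_mul_sigmaMax Sig
  have hdS : 0 < d * sigmaMax Sig := htrS.trans_le hSle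
  have hsS : 0 ≤ sigmaMax Sig := sigmaMax_nonneg Sig
  have hρ1 : 6 / 10 * γ * B * sigmaMin G ≤ 1 := by
    have := (isNoisyContraction_block (u := u) hC hd hμ hA hπ hB hRpos hγpos hγB hclip).ρ_le_one
    rwa [← hG] at this
  have hd0 : (0 : ℝ) < d := by linarith
  have hB0 : (0 : ℝ) < B := by linarith
  have hN := noise_term_le hd0 hm hB0 hL hc hCR0 htrS htrG hσ hκ hSle hGle hR hγ
  have hBi := bias_term_le (D := ‖A₀ - A‖) (a := a) hd0 hm hB0 hL hc hCR0 htrG hσ hκ hGle hR hγ hρ1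
  have hBT : (B : ℝ) ≤ T := by exact_mod_cast (Nat.le_add_right B u).trans hBuT
  -- The Lyapunov sum is cut after `u ≤ T` steps, so its remnant carries `‖A ^ u‖² ≤ ‖A ^ u‖`,
  -- already present in the bound.
  have hBad := bad_term_le (n := ((t * (B + u) : ℕ) : ℝ)) (l := l) hT1 rfl hB1 hBT
    (by exact_mod_cast htS) (Nat.cast_nonneg _) hCR0 htrG (norm_nonneg (A ^ u)) hdS.le hα hlCR (by
      have h1 := trace_stationary_le hC hμ hA hπ u
      rw [← hSig, ← hG] at h1
      have h2 : ‖A ^ u‖ ≤ 1 := (norm_pow_op_le A u).trans (pow_le_one₀ (norm_nonneg _) hA.le)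
      have h3 : ‖A ^ u‖ ^ 2 ≤ ‖A ^ u‖ := by
        rw [sq]; exact mul_le_of_le_one_left (norm_nonneg _) h2
      have h4 : (u : ℝ) ≤ T := by exact_mod_cast (Nat.le_add_left u B).trans hBuT
      refine h1.trans ?_
      gcongr) hR
  have hD : ‖A₀ - A‖ ^ 4 ≤ (K + 1) ^ 4 := by
    gcongr
    exact (norm_sub_le _ _).trans (add_le_add hA₀ hA.le)
  have hCo : 3 * (G.trace * (‖A ^ u‖ * (48 * (‖A₀ - A‖ ^ 4 + 4 * C ^ 2 * q ^ 2 + q) * t ^ 3))) ≤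
      144 * ((K + 1) ^ 4 + 4 * C ^ 2 + 1) * (((T : ℝ) ^ 3 / (B : ℝ) ^ 3 * ‖A ^ u‖) * G.trace) := by
    have h1 : (t : ℝ) ≤ T / B := by
      rw [le_div_iff₀ hB0]
      exact_mod_cast (Nat.mul_le_mul_left t (Nat.le_add_right B u)).trans htS
    have h2 : (t : ℝ) ^ 3 ≤ (T : ℝ) ^ 3 / (B : ℝ) ^ 3 := by
      rw [← div_pow]; gcongr
    have h3 : q ^ 2 ≤ 1 := pow_le_one₀ hq0.le hq1
    have h4 : ‖A₀ - A‖ ^ 4 + 4 * C ^ 2 * q ^ 2 + q ≤ (K + 1) ^ 4 + 4 * C ^ 2 * 1 + 1 := by gcongr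
    calc _ ≤ 3 * (G.trace * (‖A ^ u‖ * (48 * ((K + 1) ^ 4 + 4 * C ^ 2 * 1 + 1) *
          ((T : ℝ) ^ 3 / (B : ℝ) ^ 3)))) := by gcongr
      _ = _ := by ring
  -- collect the terms
  have hβ : biasCoeff 1 (3 / 20 * c / CR) d (condNumber G) T a t * G.trace * ‖A₀ - A‖ ^ 2 =
      1 * (d * condNumber G * Real.log T / ((t : ℝ) - a)) *
        Real.exp (-(3 / 20 * c / CR * (a / (d * condNumber G * Real.log T)))) * G.trace *
          ‖A₀ - A‖ ^ 2 := rfl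
  rw [← hβ] at hBi
  have n1 : 0 ≤ d ^ 2 * sigmaMax Sig / ((B : ℝ) ^ 2 * ((t : ℝ) - a) ^ 2) *
            (condNumber G ^ (3 / 2 : ℝ) * (d * B * Real.log T)) := by positivity
  have n2 : 0 ≤ biasCoeff 1 (3 / 20 * c / CR) d (condNumber G) T a t * G.trace * ‖A₀ - A‖ ^ 2 := by
    rw [hβ]; positivity
  have n3 : 0 ≤ ((T : ℝ) ^ 3 / (B : ℝ) ^ 3 * ‖A ^ u‖) * G.trace := by positivity
  have n4 : 0 ≤ d * sigmaMax Sig / R * ((T : ℝ) ^ 2 / (B : ℝ) ^ 2) *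
              (1 / (T : ℝ) ^ (α / 2)) * G.trace := by positivity
  rw [add_mul _ _ G.trace] at hBad ⊢
  exact collect_terms_le hN hBi hCo hBad (by positivity) (by positivity) (by positivity)
    (by positivity) n1 n2 n3 n4

end RER

/-! ### Tuned parameters and the limit of a large horizon. -/

namespace RER

variable {d : ℕ}

lemma tendsto_log_natCast : Tendsto (fun T : ℕ => Real.log T) atTop atTop :=
  Real.tendsto_log_atTop.comp tendsto_natCast_atTop_atTop

lemma isLittleO_log_pow_natCast (n : ℕ) :
    (fun T : ℕ => Real.log T ^ n) =o[atTop] (fun T : ℕ => (T : ℝ)) :=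
  (Real.isLittleO_pow_log_id_atTop (n := n)).comp_tendsto tendsto_natCast_atTop_atTop

lemma isBigO_natCeil_mul {f : ℕ → ℝ} (hf : Tendsto f atTop atTop) :
    (fun T => ((⌈f T⌉₊ : ℕ) : ℝ)) =O[atTop] f := by
  refine IsBigO.of_bound 2 ?_
  filter_upwards [hf.eventually_ge_atTop 1] with T hT
  rw [Real.norm_of_nonneg (Nat.cast_nonneg _), Real.norm_of_nonneg (by linarith)]
  have := (Nat.ceil_lt_add_one (by linarith : 0 ≤ f T)).le
  linarith

/-- Admissible choices of burn-in, buffer size and gap. -/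
lemma exists_isTuning {A : Op d} (hA : ‖A‖ < 1) {G : Matrix (Fin d) (Fin d) ℝ} {CR : ℝ}
    (hCR : 0 < CR) (hG : 0 < G.trace) (hσ : 0 < sigmaMin G) :
    ∃ a B u : ℕ → ℕ, IsTuning A G CR (1 / 2) a B u := by
  -- The lower cutoff keeps `log ρ` a usable negative number when `A = 0`.
  set ρ := max ‖A‖ (1 / 2) with hρ
  have hρ0 : 0 < ρ := lt_max_of_lt_right (by norm_num)
  have hρ1 : ρ < 1 := max_lt hA (by norm_num)
  have hlog : Real.log ρ < 0 := Real.log_neg hρ0 hρ1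
  set k := 4 / (-Real.log ρ) with hk
  have hk0 : 0 < k := div_pos (by norm_num) (by linarith)
  set k' := CR * G.trace / sigmaMin G with hk'
  have hk'0 : 0 < k' := by positivity
  set u : ℕ → ℕ := fun T => ⌈k * Real.log T⌉₊ with hu
  set a : ℕ → ℕ := fun T => ⌈k' * Real.log T ^ 2⌉₊ with ha
  have hkL : Tendsto (fun T : ℕ => k * Real.log T) atTop atTop :=
    tendsto_log_natCast.const_mul_atTop hk0
  have hkL2 : Tendsto (fun T : ℕ => k' * Real.log T ^ 2) atTop atTop :=
    ((tendsto_pow_atTop two_ne_zero).comp tendsto_log_natCast).const_mul_atTop hk'0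
  have hut : Tendsto u atTop atTop := tendsto_nat_ceil_atTop.comp hkL
  have hB : (fun T => ((4 * u T : ℕ) : ℝ)) =O[atTop] (fun T : ℕ => Real.log T) := by
    push_cast
    exact ((isBigO_natCeil_mul hkL).trans (isBigO_const_mul_self _ _ _)).const_mul_left 4
  have haO : (fun T => (a T : ℝ)) =O[atTop] (fun T : ℕ => Real.log T ^ 2) :=
    (isBigO_natCeil_mul hkL2).trans (isBigO_const_mul_self _ _ _)
  -- With `B = 4 u` four fifths of the samples are used. Rounding and burn-in cost `B (1 + a)`, of
  -- order `log³ T` and eventually below `3T/10`, so at least `T/2` remains.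
  refine ⟨a, fun T => 4 * u T, u, ?_, hB, ?_, ⟨1, one_pos, ?_⟩, ?_⟩
  · exact hut.const_mul_atTop' (by norm_num)
  · filter_upwards [eventually_ge_atTop 1] with T hT
    have hT0 : (0 : ℝ) < T := by exact_mod_cast hT
    have h1 : k * Real.log T ≤ u T := Nat.le_ceil _
    calc ‖A ^ u T‖ ≤ ‖A‖ ^ u T := norm_pow_op_le A _
      _ ≤ ρ ^ u T := by gcongr; exact le_max_left _ _
      _ = Real.exp (u T * Real.log ρ) := by rw [Real.exp_nat_mul, Real.exp_log hρ0]
      _ ≤ Real.exp (k * Real.log T * Real.log ρ) := by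
          rw [Real.exp_le_exp]
          exact mul_le_mul_of_nonpos_right h1 hlog.le
      _ = Real.exp (-(Real.log T * 4)) := by
          congr 1
          have := hlog.ne
          rw [hk]
          field_simp
      _ = 1 / (T : ℝ) ^ 4 := by
          rw [Real.exp_neg, ← Real.rpow_def_of_pos hT0, one_div]
          norm_cast
  · filter_upwards with T
    calc 1 * ((CR * G.trace * Real.log T) * Real.log T / sigmaMin G) = k' * Real.log T ^ 2 := by
          rw [hk']; ring
      _ ≤ a T := Nat.le_ceil _
  · have h1 : (fun T => ((4 * u T : ℕ) : ℝ) * (1 + a T)) =o[atTop] (fun T : ℕ => (T : ℝ)) := by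
      have h2 : (fun T => (1 : ℝ) + a T) =O[atTop] (fun T : ℕ => Real.log T ^ 2) := by
        refine IsBigO.add ?_ haO
        refine IsBigO.of_bound 1 ?_
        filter_upwards [tendsto_log_natCast.eventually_ge_atTop 1] with T hT
        rw [norm_one, one_mul, Real.norm_of_nonneg (by positivity)]
        exact one_le_pow₀ hT
      refine (hB.mul h2).trans_isLittleO ?_
      refine (isLittleO_log_pow_natCast 3).congr_left fun T => ?_
      ring
    filter_upwards [h1.bound (show (0 : ℝ) < 3 / 10 by norm_num), hut.eventually_ge_atTop 1]
      with T hT hu1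
    rw [Real.norm_of_nonneg (by positivity), Real.norm_of_nonneg (by positivity)] at hT
    have hu0 : (0 : ℝ) < u T := by exact_mod_cast hu1
    have h3 : (T : ℝ) / ((4 * u T + u T : ℕ) : ℝ) - 1 ≤ ((T / (4 * u T + u T) : ℕ) : ℝ) := by
      have := Nat.lt_floor_add_one ((T : ℝ) / ((4 * u T + u T : ℕ) : ℝ))
      rw [Nat.floor_div_eq_div] at this
      linarith
    have h4 : ((4 * u T : ℕ) : ℝ) * ((T : ℝ) / ((4 * u T + u T : ℕ) : ℝ)) = 4 / 5 * T := by
      push_cast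
      field_simp
      ring
    have h5 := mul_le_mul_of_nonneg_left h3 (Nat.cast_nonneg (α := ℝ) (4 * u T))
    nlinarith

/-- The error terms are negligible for tuned parameters. -/
lemma isLittleO_remainder {B : ℕ → ℕ} (hB : Tendsto B atTop atTop)
    (hBlog : (fun T => (B T : ℝ)) =O[atTop] (fun T : ℕ => Real.log T)) (x y z : ℝ) {w : ℝ}
    (hw : 0 < w) :
    (fun T : ℕ => 1 / (T : ℝ) * (x * (B T : ℝ)⁻¹ + y * (B T * Real.log T / T) +
      z * (B T * Real.log T / Real.exp (w * Real.log T)))) =o[atTop] (fun T : ℕ => 1 / (T : ℝ)) := by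
  have h0 : (fun T => (B T : ℝ) * Real.log T) =O[atTop] (fun T : ℕ => Real.log T ^ 2) := by
    simpa only [sq] using hBlog.mul (isBigO_refl _ _)
  have h1 : Tendsto (fun T => (B T : ℝ)⁻¹) atTop (nhds 0) :=
    tendsto_inv_atTop_zero.comp (tendsto_natCast_atTop_atTop.comp hB)
  have h2 : Tendsto (fun T : ℕ => (B T : ℝ) * Real.log T / T) atTop (nhds 0) :=
    (h0.trans_isLittleO (isLittleO_log_pow_natCast 2)).tendsto_div_nhds_zero
  have h3 : Tendsto (fun T : ℕ => (B T : ℝ) * Real.log T / Real.exp (w * Real.log T)) atTop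
      (nhds 0) :=
    (h0.trans_isLittleO ((isLittleO_pow_exp_pos_mul_atTop 2 hw).comp_tendsto
      tendsto_log_natCast)).tendsto_div_nhds_zero
  have h4 := ((h1.const_mul x).add (h2.const_mul y)).add (h3.const_mul z)
  simp only [mul_zero, add_zero] at h4
  simpa using (isBigO_refl (fun T : ℕ => 1 / (T : ℝ)) atTop).mul_isLittleO
    ((isLittleO_one_iff ℝ).2 h4)

/-- From `B m ≥ θ T` every `1/m` becomes at most `B / (θ T)`. The burn-in turns the bias factor into
`exp (-w L)`, a negative power of `T`; `‖A^u‖ ≤ T⁻⁴` beats `T³`, and `α ≥ 6` gives `T^(α/2) ≥ T³`.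
What remains has a factor `1/B`, `B L / T` or `B L exp (-w L)` beside `1/T`. -/
lemma asymptotic_terms_le {T B m L θ c₂ c₃ d sS κ w trS trG D Aw R CR α σ b C a b₂ : ℝ}
    (hT : 1 ≤ T) (hB : 1 ≤ B) (hL : 1 ≤ L) (hθ : 0 < θ) (hm : θ * T ≤ B * m)
    (hm0 : 0 < m) (hc₂ : 0 ≤ c₂) (hc₃ : 0 ≤ c₃) (hd : 0 < d) (hsS : 0 ≤ sS) (hκ : 0 < κ)
    (htrS : 0 ≤ trS) (htrG : 0 < trG) (hAw : Aw ≤ 1 / T ^ 4)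
    (hR : R = CR * trG * L) (hCR : 0 < CR) (hα : 6 ≤ α) (hb₂ : 0 < b₂)
    (hb : b = 1 * (d * κ * L / m) * Real.exp (-(b₂ * (a / (d * κ * L)))))
    (hσ : 0 < σ) (hw : w = b₂ * (C * (CR * trG / σ) / (d * κ)))
    (ha : C * ((CR * trG * L) * L / σ) ≤ a) :
    c₂ * (d * trS / (B * m) + d ^ 2 * sS / (B * m) * (√κ / B)) +
        c₃ * (d ^ 2 * sS / (B ^ 2 * m ^ 2) * (κ ^ (3 / 2 : ℝ) * (d * B * L)) + b * trG * D ^ 2 +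
          (T ^ 3 / B ^ 3 * Aw + d * sS / R * (T ^ 2 / B ^ 2) * (1 / T ^ (α / 2))) * trG) ≤
      c₂ / θ * (d * trS / T) + 1 / T * ((c₂ * d ^ 2 * sS * √κ / θ + c₃ * trG +
          c₃ * (d * sS / CR)) * B⁻¹ +
        c₃ * (d ^ 2 * sS * κ ^ (3 / 2 : ℝ) * d / θ ^ 2) * (B * L / T) +
        c₃ * (d * κ * trG * D ^ 2 / θ) * (B * L / Real.exp (w * L))) := by
  have hT0 : 0 < T := by linarith
  have hB0 : 0 < B := by linarith
  have hL0 : 0 < L := by linarith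
  have hκ' : 0 < κ ^ (3 / 2 : ℝ) := Real.rpow_pos_of_pos hκ _
  have hθT : 0 < θ * T := by positivity
  have h1 : d * trS / (B * m) ≤ d * trS / (θ * T) := by gcongr
  have h2 : d ^ 2 * sS / (B * m) * (√κ / B) ≤ d ^ 2 * sS / (θ * T) * (√κ / B) := by gcongr
  have h3 : d ^ 2 * sS / (B ^ 2 * m ^ 2) * (κ ^ (3 / 2 : ℝ) * (d * B * L)) ≤
      d ^ 2 * sS / (θ * T) ^ 2 * (κ ^ (3 / 2 : ℝ) * (d * B * L)) := by
    rw [← mul_pow]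
    gcongr
  have h4 : b ≤ d * κ * L * B / (θ * T) * (Real.exp (w * L))⁻¹ := by
    have e : d * κ * L / m ≤ d * κ * L * B / (θ * T) := by
      rw [div_le_div_iff₀ hm0 hθT]
      calc d * κ * L * (θ * T) ≤ d * κ * L * (B * m) := by gcongr
        _ = _ := by ring
    rw [hb, one_mul]
    refine mul_le_mul e ?_ (Real.exp_pos _).le (by positivity)
    rw [← Real.exp_neg, Real.exp_le_exp, neg_le_neg_iff, hw]
    calc b₂ * (C * (CR * trG / σ) / (d * κ)) * L =
          b₂ * (C * ((CR * trG * L) * L / σ) / (d * κ * L)) := by field_simp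
      _ ≤ _ := by gcongr
  have h5 : T ^ 3 / B ^ 3 * Aw ≤ 1 / T * B⁻¹ := by
    calc T ^ 3 / B ^ 3 * Aw ≤ T ^ 3 / B ^ 3 * (1 / T ^ 4) := by gcongr
      _ = 1 / T * (B ^ 3)⁻¹ := by field_simp
      _ ≤ _ := by
          gcongr
          exact le_self_pow₀ hB (by norm_num)
  have h6 : d * sS / R * (T ^ 2 / B ^ 2) * (1 / T ^ (α / 2)) * trG ≤
      d * sS / CR * (1 / T * B⁻¹) := by
    have e : T ^ 3 ≤ T ^ (α / 2) := by
      rw [← Real.rpow_natCast]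
      exact Real.rpow_le_rpow_of_exponent_le hT (by push_cast; linarith)
    rw [hR]
    calc _ ≤ d * sS / (CR * trG * 1) * (T ^ 2 / B ^ 1) * (1 / T ^ 3) * trG := by
          gcongr
          norm_num
      _ = _ := by field_simp
  calc _ ≤ c₂ * (d * trS / (θ * T) + d ^ 2 * sS / (θ * T) * (√κ / B)) +
        c₃ * (d ^ 2 * sS / (θ * T) ^ 2 * (κ ^ (3 / 2 : ℝ) * (d * B * L)) +
          (d * κ * L * B / (θ * T) * (Real.exp (w * L))⁻¹) * trG * D ^ 2 +
          (1 / T * B⁻¹ * trG + d * sS / CR * (1 / T * B⁻¹))) := by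
        rw [add_mul _ _ trG]
        gcongr
    _ = _ := by
        field_simp
        ring

end RER

/-! ### Assembly of the theorem. -/

theorem mainTheorem2 :
    ∀ Cμ : ℝ, 0 < Cμ →
    ∃ c₁ > (0 : ℝ), ∃ c₂ > (0 : ℝ),
    ∀ α : ℝ, 0 < α →
    ∃ C₀ > (0 : ℝ), ∀ C_R : ℝ, C₀ ≤ C_R →
    ∀ c : ℝ, 0 < c → c < 1 →
    -- the non-asymptotic bound
    (∃ b₁ > (0 : ℝ), ∃ b₂ > (0 : ℝ), ∀ K : ℝ, 0 ≤ K → ∃ c₃ > (0 : ℝ),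
      ∀ (d : ℕ) (A A₀ : Op d) (μ π : Measure (Vec d)),
      0 < d → ‖A‖ < 1 → ‖A₀‖ ≤ K → IsNoiseLaw Cμ μ → IsStationaryLaw A μ π →
      ∀ (Sig G : Matrix (Fin d) (Fin d) ℝ), Sig = momentMatrix μ → G = momentMatrix π →
      ∀ (Ω : Type*) [MeasurableSpace Ω] (P : Measure Ω) [IsProbabilityMeasure P]
        (T : ℕ) (X η : ℕ → Ω → Vec d), IsStationaryVAR A μ π P T X η →
      ∀ (B u a t : ℕ), 0 < B → a < t → t ≤ T / (B + u) →
      ∀ (R γ : ℝ), R = C_R * G.trace * Real.log T → γ = c / (4 * R * B) →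
      (T : ℝ) ^ (α / 2) > c₁ * (√(fourthMoment π) / sigmaMin G) →
        Integrable
          (fun ω => predLoss A μ π (rerOutput R γ B u a t A₀ (fun τ => X τ ω))) P ∧
        (∫ ω, predLoss A μ π (rerOutput R γ B u a t A₀ (fun τ => X τ ω)) ∂P) - Sig.trace ≤
          c₂ * (d * Sig.trace / (B * ((t : ℝ) - a)) +
              d ^ 2 * sigmaMax Sig / (B * ((t : ℝ) - a)) * (√(condNumber G) / B)) +
          c₃ * (d ^ 2 * sigmaMax Sig / ((B : ℝ) ^ 2 * ((t : ℝ) - a) ^ 2) *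
                (condNumber G ^ (3 / 2 : ℝ) * (d * B * Real.log T)) +
              biasCoeff b₁ b₂ d (condNumber G) T a t * G.trace * ‖A₀ - A‖ ^ 2 +
              ((T : ℝ) ^ 3 / (B : ℝ) ^ 3 * ‖A ^ u‖ +
                d * sigmaMax Sig / R * ((T : ℝ) ^ 2 / (B : ℝ) ^ 2) *
                  (1 / (T : ℝ) ^ (α / 2))) * G.trace)) ∧
    -- the rate for a fixed system as the horizon tends to infinity
    (6 ≤ α →
      ∀ (d : ℕ) (A A₀ : Op d) (μ π : Measure (Vec d)),
      0 < d → ‖A‖ < 1 → IsNoiseLaw Cμ μ → IsStationaryLaw A μ π →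
      ∀ (Sig G : Matrix (Fin d) (Fin d) ℝ), Sig = momentMatrix μ → G = momentMatrix π →
      (∃ a B u : ℕ → ℕ, IsTuning A G C_R (1 / 2) a B u) ∧
      ∀ (Ω : Type*) [MeasurableSpace Ω] (P : Measure Ω) [IsProbabilityMeasure P]
        (X η : ℕ → Ω → Vec d), (∀ T, IsStationaryVAR A μ π P T X η) →
      ∀ (θ : ℝ), 0 < θ → ∀ (a B u : ℕ → ℕ), IsTuning A G C_R θ a B u →
      ∀ (R γ : ℕ → ℝ), (∀ T : ℕ, R T = C_R * G.trace * Real.log T) →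
        (∀ T, γ T = c / (4 * R T * B T)) →
      ∃ r : ℕ → ℝ, r =o[atTop] (fun T : ℕ => 1 / (T : ℝ)) ∧
        ∀ᶠ T : ℕ in atTop,
          Integrable (fun ω => predLoss A μ π
            (rerOutput (R T) (γ T) (B T) (u T) (a T) (T / (B T + u T)) A₀
              (fun τ => X τ ω))) P ∧
          (∫ ω, predLoss A μ π
            (rerOutput (R T) (γ T) (B T) (u T) (a T) (T / (B T + u T)) A₀
              (fun τ => X τ ω)) ∂P) - Sig.trace ≤
            c₂ / θ * (d * Sig.trace / T) + r T) := by
  intro Cμ hC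
  refine ⟨1 + 32 * Cμ, by positivity, 20, by norm_num, fun α hα => ?_⟩
  refine ⟨2 + 4 * Cμ * (3 + α), by positivity, fun C_R hCR c hc hc1 => ?_⟩
  have hCR0 : 0 < C_R := lt_of_lt_of_le (by positivity) hCR
  constructor
  · refine ⟨1, one_pos, 3 / 20 * c / C_R, by positivity, fun K hK => ?_⟩
    refine ⟨600 * C_R / c + 20 * C_R / c + 144 * ((K + 1) ^ 4 + 4 * Cμ ^ 2 + 1) + (2 + 2 * C_R),
      by positivity, ?_⟩
    intro d A A₀ μ π hd hA hA₀ hμ hπ Sig G hSig hG Ω _ P _ T X η hX B u a t hB hat htT R γ hR hγ hT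
    exact RER.nonasymptotic_bound hC hα hCR hc hc1 hK A A₀ μ π hd hA hA₀ hμ hπ Sig G hSig hG P T X η
      hX B u a t hB hat htT R γ hR hγ hT
  · intro hα6 d A A₀ μ π hd hA hμ hπ Sig G hSig hG
    have hμs := RER.IsNoiseLaw.subGaussianLaw hμ hC
    have hπs := RER.IsStationaryLaw.subGaussianLaw hC hμ hA hπ
    have hσ := hπs.sigmaMin_pos hd
    have htrG := hπs.trace_pos hd
    have htrS := hμs.trace_pos hd
    rw [← hG] at hσ htrG
    rw [← hSig] at htrS
    refine ⟨RER.exists_isTuning hA hCR0 htrG hσ, ?_⟩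
    intro Ω _ P _ X η hX θ hθ a B u htun R γ hR hγ
    obtain ⟨C, hC0, hburn⟩ := htun.burnIn
    have hκ : 0 < condNumber G := div_pos (hσ.trans_le (RER.sigmaMin_le_sigmaMax G)) hσ
    have hd0 : (0 : ℝ) < d := by exact_mod_cast hd
    -- For a fixed system the non-asymptotic bound is applied with `K = ‖A₀‖`, so `c₃` does not
    -- depend on `T`.
    set c₃ := 600 * C_R / c + 20 * C_R / c + 144 * ((‖A₀‖ + 1) ^ 4 + 4 * Cμ ^ 2 + 1) +
      (2 + 2 * C_R) with hc₃
    set w := 3 / 20 * c / C_R * (C * (C_R * G.trace / sigmaMin G) / (d * condNumber G)) with hw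
    refine ⟨_, RER.isLittleO_remainder htun.buffer_large htun.buffer_log
      (20 * d ^ 2 * sigmaMax Sig * √(condNumber G) / θ + c₃ * G.trace +
        c₃ * (d * sigmaMax Sig / C_R))
      (c₃ * (d ^ 2 * sigmaMax Sig * condNumber G ^ (3 / 2 : ℝ) * d / θ ^ 2))
      (c₃ * (d * condNumber G * G.trace * ‖A₀ - A‖ ^ 2 / θ)) (w := w) (by positivity), ?_⟩
    have hpow : Tendsto (fun T : ℕ => (T : ℝ) ^ (α / 2)) atTop atTop :=
      (tendsto_rpow_atTop (by positivity)).comp tendsto_natCast_atTop_atTop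
    filter_upwards [htun.buffer_large.eventually_ge_atTop 1,
      RER.tendsto_log_natCast.eventually_ge_atTop 1, eventually_ge_atTop 1, htun.gap, hburn,
      htun.used, hpow.eventually_gt_atTop ((1 + 32 * Cμ) * (√(fourthMoment π) / sigmaMin G))]
      with T hB hL hT hgap hbT hused hTα
    have hT1 : (1 : ℝ) ≤ T := by exact_mod_cast hT
    have hB1 : (1 : ℝ) ≤ B T := by exact_mod_cast hB
    have hm : (0 : ℝ) < ((T / (B T + u T) : ℕ) : ℝ) - a T := by
      have : 0 < θ * T := by positivity
      exact pos_of_mul_pos_right (this.trans_le hused) (by linarith)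
    have hat : a T < T / (B T + u T) := by
      have : (a T : ℝ) < ((T / (B T + u T) : ℕ) : ℝ) := by linarith
      exact_mod_cast this
    obtain ⟨hint, hle⟩ := RER.nonasymptotic_bound hC hα hCR hc hc1 (norm_nonneg A₀) A A₀ μ π hd hA
      le_rfl hμ hπ Sig G hSig hG P T X η (hX T) (B T) (u T) (a T) (T / (B T + u T)) hB hat le_rfl
      (R T) (γ T) (hR T) (hγ T) hTα
    refine ⟨hint, hle.trans ?_⟩
    exact RER.asymptotic_terms_le hT1 hB1 hL hθ hused hm (by norm_num) (by positivity) hd0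
      (RER.sigmaMax_nonneg Sig) hκ htrS.le htrG hgap (hR T) hCR0 hα6 (by positivity) rfl hσ hw hbT
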